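/- Graphs may have loops and parallel edges. A \emph{trail} is a non-empty sequence of distinct edges $e_1e_2\dots e_n$ that can be oriented so that the head of $e_i$ is the tail of $e_{i+1}$ for all $i<n$; its \emph{ends} are the tail of $e_1$ and the head of $e_n$, its \emph{length} is $n$, and its \emph{internal vertices} are the ends of $e_2,\dots,e_{n-1}$. A \emph{circuit} is a trail whose two ends are identical, and an \emph{$x$-circuit} is a circuit that hits the vertex $x$ and has no internal vertex equal to $x$. A (weak) \emph{$K_k$-immersion} in a graph $G$ is an injection $\varphi$ of $V(K_k)$ into $V(G)$ (whose values are the \emph{branch vertices}) together with pairwise edge-disjoint trails of $G$ (the \emph{branch trails}), one for each edge $uv$ of $K_k$, the trail for $uv$ having ends $\varphi(u)$ and $\varphi(v)$. It is \emph{totally odd} (\emph{totally even}) if all branch trails have odd (even) length. \textbf{Theorem.} Let $t\ge 49$, and let $G$ be a graph with a totally even $K_{1400t}$-immersion with set of branch vertices $S\subseteq V(G)$. Let $H$ be obtained from $G$ by adding a new vertex $x$ that is joined to every vertex of $S$ by exactly $20t$ parallel edges (and has no other edges). Suppose that $H$ has a collection of $3500t^2$ pairwise edge-disjoint odd $x$-circuits.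 Then $G$ contains a totally odd $K_t$-immersion. Furthermore, there is an algorithm (one program for all $t$) that takes as input $t$, the finite graph $H$ given by its list of edges, the vertex $x$, the branch vertices and branch trails of a totally even $K_{1400t}$-immersion in $G$ as above, and the collection of $3500t^2$ pairwise edge-disjoint odd $x$-circuits in $H$, and returns the branch vertices and branch trails of a totally odd $K_t$-immersion in $G$ in time $\mathcal{O}_t(|E(G)|^2)$, that is, in at most $f(t)\,|E(G)|^2$ steps for some function $f$ of $t$ alone. Time is measured on a unit-cost random access machine whose only arithmetic operations are adding and subtracting one. -/

import Mathlib

universe u v u' v'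

namespace OddImmersion

open scoped Graph

/-! ### Trails, circuits and immersions in multigraphs

Graphs are Mathlib's multigraphs `Graph α β` (loops and parallel edges are allowed). -/

section Graphs

variable {α : Type u} {β : Type v} {γ : Type u'} {δ : Type v'}

/-- The edges in the list can be traversed one after the other, starting at the first vertex and
finishing at the second one. -/
def IsWalk (G : Graph α β) : α → List β → α → Prop
  | a, [], b => a ∈ V(G) ∧ a = b
  | a, e :: es, b => ∃ c, G.IsLink e a c ∧ IsWalk G c es b

/-- `es` is a trail of `G`, traversed from its end `a` to its end `b`: a non-empty sequence of
distinct edges that can be oriented head to tail. -/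
def IsTrail (G : Graph α β) (a : α) (es : List β) (b : α) : Prop :=
  es ≠ [] ∧ es.Nodup ∧ IsWalk G a es b

/-- A circuit is a trail whose two ends are identical. -/
def IsCircuit (G : Graph α β) (es : List β) : Prop :=
  ∃ a, IsTrail G a es a

/-- An `x`-circuit is a circuit that hits `x` and has no internal vertex equal to `x`. The internal
vertices of `e₁ e₂ … eₙ` are the ends of `e₂, …, eₙ₋₁`, that is, of the edges in
`es.tail.dropLast`. -/
def IsCircuitAt (G : Graph α β) (x : α) (es : List β) : Prop :=
  IsCircuit G es ∧ (∃ e ∈ es, G.Inc e x) ∧ ∀ e ∈ es.tail.dropLast, ¬ G.Inc e x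

/-- `C` is a collection of pairwise edge-disjoint odd `x`-circuits of `G`. -/
def IsOddCircuitPacking (G : Graph α β) (x : α) (C : List (List β)) : Prop :=
  (∀ c ∈ C, IsCircuitAt G x c ∧ Odd c.length) ∧ C.Pairwise List.Disjoint

/-- A (weak) immersion of `H` in `G`. Vertices of `H` go injectively to vertices of `G`, edges of
`H` go to pairwise edge-disjoint trails of `G` with the corresponding ends. (The list of edges
of a branch trail may be written down from either of the two ends. As trails are non-empty,
edge-disjointness makes the map on edges injective.) -/
structure Immersion (H : Graph γ δ) (G : Graph α β) where
  vertexMap : γ → α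
  edgeMap : δ → List β
  mapsTo : Set.MapsTo vertexMap V(H) V(G)
  injOn : Set.InjOn vertexMap V(H)
  isTrail : ∀ e ∈ E(H), ∃ a b, H.IsLink e a b ∧
    IsTrail G (vertexMap a) (edgeMap e) (vertexMap b)
  disjoint : ∀ e ∈ E(H), ∀ f ∈ E(H), e ≠ f → List.Disjoint (edgeMap e) (edgeMap f)

/-- The set of branch vertices of an immersion. -/
def Immersion.branchVertices {H : Graph γ δ} {G : Graph α β} (φ : Immersion H G) : Set α :=
  φ.vertexMap '' V(H)

/-- All branch trails have odd length. -/
def Immersion.TotallyOdd {H : Graph γ δ} {G : Graph α β} (φ : Immersion H G) : Prop :=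
  ∀ e ∈ E(H), Odd (φ.edgeMap e).length

/-- All branch trails have even length. -/
def Immersion.TotallyEven {H : Graph γ δ} {G : Graph α β} (φ : Immersion H G) : Prop :=
  ∀ e ∈ E(H), Even (φ.edgeMap e).length

/-- The complete graph `K_k` on the vertex set `Fin k`; its edges are the unordered pairs of
distinct vertices. -/
def completeK (k : ℕ) : Graph (Fin k) (Sym2 (Fin k)) :=
  Graph.ofSimpleGraph (⊤ : SimpleGraph (Fin k))

/-- `H` is obtained from `G` by adding a new vertex `x` that is joined to every vertex in `S` by
exactly `k` parallel edges (and to nothing else). -/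
structure IsApexExtension (G : Graph α β) (S : Set α) (k : ℕ) (x : α) (H : Graph α β) : Prop where
  notMem : x ∉ V(G)
  vertexSet_eq : V(H) = insert x V(G)
  le : G ≤ H
  new_edge : ∀ e ∈ E(H), e ∉ E(G) → ∃ s ∈ S, H.IsLink e x s
  multiplicity : ∀ s ∈ S, {e | H.IsLink e x s}.encard = k

end Graphs

/-! ### The machine model

A random access machine with unit costs, programmed by structured programs. The memory has
registers and arrays of natural numbers (a program mentions finitely many of each). The only
arithmetic is adding or subtracting one, so that the numbers in memory grow by at most one per
unit of time; hence no work can be hidden in the manipulation of long numbers. -/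

/-- A memory content: register `r` holds `reg r`, entry `i` of array `a` is `arr a i`. -/
structure Memory where
  reg : ℕ → ℕ
  arr : ℕ → ℕ → ℕ

/-- Write `n` to register `r`. -/
def Memory.setReg (s : Memory) (r n : ℕ) : Memory :=
  { s with reg := Function.update s.reg r n }

/-- Write `n` to entry `i` of array `a`. -/
def Memory.setArr (s : Memory) (a i n : ℕ) : Memory :=
  { s with arr := Function.update s.arr a (Function.update (s.arr a) i n) }

/-- The memory whose first registers and first arrays hold the given numbers and which is zero
everywhere else. -/
def Memory.ofLists (regs : List ℕ) (arrs : List (List ℕ)) : Memory where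
  reg r := regs.getD r 0
  arr a i := (arrs.getD a []).getD i 0

/-- Array `a` starts with the entries of `l`. -/
def Memory.Holds (s : Memory) (a : ℕ) (l : List ℕ) : Prop :=
  ∀ (i : ℕ) (h : i < l.length), s.arr a i = l[i]

/-- Expressions: constants, registers, array entries, successor and (truncated) predecessor. -/
inductive Expr where
  | num (n : ℕ)
  | reg (r : ℕ)
  | entry (a : ℕ) (i : Expr)
  | succ (e : Expr)
  | pred (e : Expr)

/-- The value of an expression. -/
def Expr.eval (s : Memory) : Expr → ℕ
  | num n => n
  | reg r => s.reg r
  | entry a i => s.arr a (i.eval s)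
  | succ e => e.eval s + 1
  | pred e => e.eval s - 1

/-- Evaluating an expression takes one unit of time per operation in it. -/
def Expr.cost : Expr → ℕ
  | num _ => 1
  | reg _ => 1
  | entry _ i => i.cost + 1
  | succ e => e.cost + 1
  | pred e => e.cost + 1

/-- Tests. -/
inductive Test where
  | eq (e f : Expr)
  | lt (e f : Expr)
  | not (b : Test)
  | and (b c : Test)

/-- The truth value of a test. -/
def Test.Holds (s : Memory) : Test → Prop
  | eq e f => e.eval s = f.eval s
  | lt e f => e.eval s < f.eval s
  | not b => ¬ b.Holds s
  | and b c => b.Holds s ∧ c.Holds s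

/-- Evaluating a test takes one unit of time per operation in it. -/
def Test.cost : Test → ℕ
  | eq e f => e.cost + f.cost + 1
  | lt e f => e.cost + f.cost + 1
  | not b => b.cost + 1
  | and b c => b.cost + c.cost + 1

/-- Programs: assignment to a register, assignment to an array entry, sequential composition,
branching and while-loops. -/
inductive Program where
  | skip
  | setReg (r : ℕ) (e : Expr)
  | setArr (a : ℕ) (i e : Expr)
  | seq (p q : Program)
  | ite (b : Test) (p q : Program)
  | loop (b : Test) (p : Program)

/-- `Runs p s s' n`: started on memory content `s`, the program `p` halts after `n` units of time
with memory content `s'`. -/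
inductive Runs : Program → Memory → Memory → ℕ → Prop where
  | skip (s : Memory) : Runs .skip s s 1
  | setReg (s : Memory) (r : ℕ) (e : Expr) :
      Runs (.setReg r e) s (s.setReg r (e.eval s)) (e.cost + 1)
  | setArr (s : Memory) (a : ℕ) (i e : Expr) :
      Runs (.setArr a i e) s (s.setArr a (i.eval s) (e.eval s)) (i.cost + e.cost + 1)
  | seq {p q : Program} {s s' s'' : Memory} {m n : ℕ} :
      Runs p s s' m → Runs q s' s'' n → Runs (.seq p q) s s'' (m + n)
  | ite_true {b : Test} {p : Program} (q : Program) {s s' : Memory} {n : ℕ} :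
      b.Holds s → Runs p s s' n → Runs (.ite b p q) s s' (b.cost + n)
  | ite_false {b : Test} (p : Program) {q : Program} {s s' : Memory} {n : ℕ} :
      ¬ b.Holds s → Runs q s s' n → Runs (.ite b p q) s s' (b.cost + n)
  | loop_true {b : Test} {p : Program} {s s' s'' : Memory} {m n : ℕ} :
      b.Holds s → Runs p s s' m → Runs (.loop b p) s' s'' n →
        Runs (.loop b p) s s'' (b.cost + m + n)
  | loop_false {b : Test} (p : Program) {s : Memory} :
      ¬ b.Holds s → Runs (.loop b p) s s b.cost

/-! ### Input and output formats -/

/-- `H` is the graph with vertices `0, …, N - 1` and edges `0, …, ends.length - 1` in which the two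
ends of the edge `e` are the two components of `ends[e]`. -/
structure IsEdgeList (H : Graph ℕ ℕ) (N : ℕ) (ends : List (ℕ × ℕ)) : Prop where
  vertexSet_eq : V(H) = Set.Iio N
  edgeSet_eq : E(H) = Set.Iio ends.length
  isLink : ∀ (e : ℕ) (h : e < ends.length), H.IsLink e ends[e].1 ends[e].2

/-- The edges of `K_k` in the order `01, 02, 12, 03, 13, 23, …`. -/
def pairs (k : ℕ) : List (Sym2 (Fin k)) :=
  (List.finRange k).flatMap fun j => ((List.finRange k).filter (· < j)).map fun i => s(i, j)

/-- The positions at which the members of `L`, and the end, are found in `L.flatten`: a list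
of lists is stored as the array `L.flatten` together with the array `offsets L`. -/
def offsets (L : List (List ℕ)) : List ℕ :=
  (List.range (L.length + 1)).map fun p => (L.take p).flatten.length

/-- The branch vertices of a `K_k`-immersion, in order. -/
def Immersion.vertexList {k : ℕ} {G : Graph ℕ ℕ} (φ : Immersion (completeK k) G) : List ℕ :=
  (List.finRange k).map φ.vertexMap

/-- The branch trails of a `K_k`-immersion, in the order of `pairs k`. -/
def Immersion.trailList {k : ℕ} {G : Graph ℕ ℕ} (φ : Immersion (completeK k) G) :
    List (List ℕ) :=
  (pairs k).map φ.edgeMap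

/-- The initial memory content. Registers: the parameter `t`, the number of vertices and the number
of edges of the auxiliary graph, and its special vertex `x`. Arrays: first and second ends of the
edges of the auxiliary graph; branch vertices; branch trails (two arrays); circuits (two
arrays). -/
def inputMemory {k : ℕ} {G : Graph ℕ ℕ} (t N x : ℕ) (ends : List (ℕ × ℕ))
    (φ : Immersion (completeK k) G) (C : List (List ℕ)) : Memory :=
  Memory.ofLists [t, N, ends.length, x]
    [ends.map Prod.fst, ends.map Prod.snd, φ.vertexList,
      φ.trailList.flatten, offsets φ.trailList, C.flatten, offsets C]

/-- The arrays with numbers 7, 8 and 9 hold the branch vertices and the branch trails of the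
immersion `ψ`. -/
def IsOutput {k : ℕ} {G : Graph ℕ ℕ} (s : Memory) (ψ : Immersion (completeK k) G) : Prop :=
  s.Holds 7 ψ.vertexList ∧ s.Holds 8 ψ.trailList.flatten ∧ s.Holds 9 (offsets ψ.trailList)

end OddImmersion

namespace OddImmersion

open scoped Graph

/-! ### Walks -/

section Walks

variable {α : Type u} {β : Type v} {G H : Graph α β}

/-! Put m = 3500t², and let S be the set of the 1400t given branch vertices. The given branch
trails, read in either direction, form a linkage of even trails Q u v between the vertices of S. An
odd x-circuit has length at least three, because every edge at x leads to S and hence none is a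
loop. Removing its two edges at x leaves an odd trail of G with both ends in S. This gives m
edge-disjoint odd trails, and as x has only 20t edges to each vertex of S, at most 20t of their ends
lie at any one vertex (`Routing.valid_of_packing`).

If an odd trail from a to b is disjoint from the linking trails Q u a and Q b v, the three together
form an odd branch trail from u to v. Disjointness is obtained by rerouting. Every odd trail is kept
in the form arm, core, arm: the core is a segment of the original trail, and each arm is an initial
segment of a linking trail, starting at an end (root) of the odd trail. Suppose that Q u v is
assigned to no arm, that u lies in fewer than 20t of the pairs assigned to arms, and that Q u v
meets a core. Follow Q u v from u to its first edge e on a core. From there the core can be followed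
in either direction, and the lengths of the two resulting trails add up to an even number plus the
old odd length. So exactly one of them is odd, and it replaces the old trail (`Routing.Valid.step`).
The cores lose the edge e, so at most |E(G)| reroutings are possible. At the end, every Q u v whose
pair is unassigned and whose vertex u lies in fewer than 20t pairs is disjoint from all the odd
trails.

The rest is counting. The 2m pairs have 14000t² places, so at most 700t vertices of S lie in 20t
pairs or more, and t other vertices B i can be taken as branch vertices
(`Routing.le_length_filter_incidences`). At most 23t vertices are unsuitable as partners of a given
B i, and each of them is a root at most 20t times. Hence at most 2 · 20t · 23t + t² = 921t² < m odd
trails are unavailable for a given pair of branch vertices, and a greedy choice succeeds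
(`Routing.exists_admissible`). `Routing.exists_totallyOdd` assembles the immersion.

The program carries out the same construction on arrays. A lookup array gives the position of an
edge on the circuits, so a sweep over all linking trails takes time linear in |E(G)| for fixed t.
Every sweep but the last one reroutes something, so there are at most |E(G)| + 1 sweeps, and all
other phases are linear in |E(G)|. Only edges on the given trails and circuits are ever looked up,
and a circuit has at most |E(G)| + 2 of them. This is why the bound involves G and not H. -/

lemma IsWalk.left_mem {a b : α} {l : List β} (h : IsWalk G a l b) : a ∈ V(G) := by
  cases l with
  | nil => exact h.1
  | cons e es => obtain ⟨c, hc, -⟩ := h; exact hc.left_mem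

lemma isWalk_append {a b : α} {l l' : List β} :
    IsWalk G a (l ++ l') b ↔ ∃ c, IsWalk G a l c ∧ IsWalk G c l' b := by
  induction l generalizing a with
  | nil =>
    constructor
    · intro h; exact ⟨a, ⟨h.left_mem, rfl⟩, h⟩
    · rintro ⟨c, ⟨-, rfl⟩, h⟩; exact h
  | cons e es ih =>
    simp only [List.cons_append, IsWalk, ih]
    constructor
    · rintro ⟨c, h, d, h1, h2⟩; exact ⟨d, ⟨c, h, h1⟩, h2⟩
    · rintro ⟨d, ⟨c, h, h1⟩, h2⟩; exact ⟨c, h, d, h1, h2⟩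

lemma IsWalk.right_mem {a b : α} {l : List β} (h : IsWalk G a l b) : b ∈ V(G) := by
  induction l generalizing a with
  | nil => exact h.2 ▸ h.1
  | cons e es ih => obtain ⟨c, -, hc⟩ := h; exact ih hc

lemma isWalk_singleton {a b : α} {e : β} : IsWalk G a [e] b ↔ G.IsLink e a b := by
  constructor
  · rintro ⟨c, h, -, rfl⟩; exact h
  · intro h; exact ⟨b, h, h.right_mem, rfl⟩

lemma IsWalk.reverse {a b : α} {l : List β} (h : IsWalk G a l b) : IsWalk G b l.reverse a := by
  induction l generalizing a with
  | nil => exact ⟨h.2 ▸ h.1, h.2.symm⟩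
  | cons e es ih =>
    obtain ⟨c, hc, h⟩ := h
    rw [List.reverse_cons, isWalk_append]
    exact ⟨c, ih h, isWalk_singleton.2 hc.symm⟩

/-- An edge and one of its ends determine the other end. By this fact the vertices stored by the
program, or picked by choice, agree with those of any abstract walk along the same edges. -/
lemma IsWalk.right_unique {a b b' : α} {l : List β} (h : IsWalk G a l b) (h' : IsWalk G a l b') :
    b = b' := by
  induction l generalizing a with
  | nil => exact h.2.symm.trans h'.2
  | cons e es ih =>
    obtain ⟨c, hc, h⟩ := h
    obtain ⟨d, hd, h'⟩ := h'
    obtain rfl := hc.right_unique hd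
    exact ih h h'

lemma IsWalk.edge_mem {a b : α} {l : List β} (h : IsWalk G a l b) {e : β} (he : e ∈ l) :
    e ∈ E(G) := by
  induction l generalizing a with
  | nil => simp at he
  | cons f es ih =>
    obtain ⟨c, hc, h⟩ := h
    rcases List.mem_cons.1 he with rfl | he
    · exact hc.edge_mem
    · exact ih h he

lemma IsWalk.mono {a b : α} {l : List β} (hGH : G ≤ H) (h : IsWalk G a l b) : IsWalk H a l b := by
  induction l generalizing a with
  | nil => exact ⟨hGH.vertexSet_mono h.1, h.2⟩
  | cons f es ih =>
    obtain ⟨c, hc, h⟩ := h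
    exact ⟨c, hc.mono hGH, ih h⟩

/-- The program walks in H, while the linkage lives in G; on edges of G the two notions of walk
agree. -/
lemma IsWalk.of_le {a b : α} {l : List β} (hGH : G ≤ H) (ha : a ∈ V(G)) (hl : ∀ e ∈ l, e ∈ E(G))
    (h : IsWalk H a l b) : IsWalk G a l b := by
  induction l generalizing a with
  | nil => exact ⟨ha, h.2⟩
  | cons f es ih =>
    obtain ⟨c, hc, h⟩ := h
    have hc' := (hGH.isLink_iff (hl f (by simp))).2 hc
    exact ⟨c, hc', ih hc'.right_mem (fun e he => hl e (by simp [he])) h⟩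

lemma isWalk_take_succ {a b : α} {l : List β} {k : ℕ} (hk : k < l.length) :
    IsWalk G a (l.take (k + 1)) b ↔ ∃ c, IsWalk G a (l.take k) c ∧ G.IsLink l[k] c b := by
  rw [List.take_succ_eq_append_getElem hk, isWalk_append]
  simp only [isWalk_singleton]

lemma IsWalk.exists_take {a b : α} {l : List β} (h : IsWalk G a l b) (k : ℕ) :
    ∃ c, IsWalk G a (l.take k) c := by
  rw [← List.take_append_drop k l, isWalk_append] at h
  obtain ⟨c, hc, -⟩ := h
  exact ⟨c, hc⟩

/-- The edges at the positions `i, …, j - 1` of a sequence. -/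
def segment (c : ℕ → β) (i j : ℕ) : List β := (List.range' i (j - i)).map c

lemma length_segment (c : ℕ → β) (i j : ℕ) : (segment c i j).length = j - i := by
  simp [segment]

lemma mem_segment {c : ℕ → β} {i j : ℕ} {e : β} :
    e ∈ segment c i j ↔ ∃ z, i ≤ z ∧ z < j ∧ c z = e := by
  simp only [segment, List.mem_map, List.mem_range'_1]
  constructor
  · rintro ⟨z, ⟨h1, h2⟩, h⟩; exact ⟨z, h1, by omega, h⟩
  · rintro ⟨z, h1, h2, h⟩; exact ⟨z, ⟨h1, by omega⟩, h⟩

lemma isWalk_segment {c : ℕ → β} {p : ℕ → α} {i j : ℕ} (hij : i ≤ j) (hi : p i ∈ V(G))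
    (h : ∀ z, i ≤ z → z < j → G.IsLink (c z) (p z) (p (z + 1))) :
    IsWalk G (p i) (segment c i j) (p j) := by
  induction j, hij using Nat.le_induction with
  | base => simpa [segment, IsWalk] using hi
  | succ j hij ih =>
    have hs : segment c i (j + 1) = segment c i j ++ [c j] := by
      simp only [segment, Nat.sub_add_comm hij, List.range'_concat, List.map_append]
      simp [Nat.add_sub_cancel' hij]
    rw [hs, isWalk_append]
    exact ⟨p j, ih fun z h1 h2 => h z h1 (by omega), isWalk_singleton.2 (h j hij (by omega))⟩

end Walks

/-! ### Rerouting edge-disjoint trails through a clique of trails -/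

section Routing

variable {α : Type u} {β : Type v} {G H : Graph α β}

/-- Pairwise edge-disjoint trails `Q u v` of even length between the vertices of a list. -/
structure Linkage (G : Graph α β) (S : List α) (Q : α → α → List β) : Prop where
  isTrail : ∀ u ∈ S, ∀ v ∈ S, u ≠ v → IsTrail G u (Q u v) v
  even : ∀ u ∈ S, ∀ v ∈ S, u ≠ v → Even (Q u v).length
  symm : ∀ u ∈ S, ∀ v ∈ S, u ≠ v → ∀ e ∈ Q u v, e ∈ Q v u
  eq_of_mem : ∀ u ∈ S, ∀ v ∈ S, u ≠ v → ∀ u' ∈ S, ∀ v' ∈ S, u' ≠ v' → ∀ e ∈ Q u v, e ∈ Q u' v' →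
    s(u, v) = s(u', v')

/-- The number of pairs `root σ, other σ` with `σ < N` that contain `u`. -/
noncomputable def incidences (root other : ℕ → α) (N : ℕ) (u : α) : ℕ :=
  open scoped Classical in Nat.count (fun σ => root σ = u ∨ other σ = u) N

/-- The unordered pair `u, v` is one of the first `N` pairs. -/
def Touched (root other : ℕ → α) (N : ℕ) (u v : α) : Prop :=
  ∃ σ < N, s(root σ, other σ) = s(u, v)

/-- A family of trails, each of which consists of the segment of a fixed edge sequence between the
positions `pos (2 * k)` and `pos (2 * k + 1)` and of initial segments of two trails of a linkage, of
lengths `len (2 * k)` and `len (2 * k + 1)`. -/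
structure Routing (α : Type u) where
  root : ℕ → α
  other : ℕ → α
  len : ℕ → ℕ
  pos : ℕ → ℕ

namespace Routing

/-- The part on the linkage. -/
def arm (r : Routing α) (Q : α → α → List β) (σ : ℕ) : List β :=
  (Q (r.root σ) (r.other σ)).take (r.len σ)

/-- Position `z` belongs to the middle segment of trail `k`. -/
def InCore (r : Routing α) (k z : ℕ) : Prop :=
  r.pos (2 * k) ≤ z ∧ z < r.pos (2 * k + 1)

/-- Replace one arm. -/
def reroute (r : Routing α) (σ : ℕ) (u v : α) (l p : ℕ) : Routing α where
  root := Function.update r.root σ u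
  other := Function.update r.other σ v
  len := Function.update r.len σ l
  pos := Function.update r.pos σ p

/-- The number of positions in the middle segments. -/
def size (r : Routing α) (m : ℕ) : ℕ :=
  ∑ k ∈ Finset.range m, (r.pos (2 * k + 1) - r.pos (2 * k))

/-- The `m` trails are odd and edge-disjoint, and at most `q` of their ends are at the same
vertex. -/
structure Valid (G : Graph α β) (S : List α) (Q : α → α → List β) (c : ℕ → β) (p : ℕ → α)
    (m q : ℕ) (r : Routing α) : Prop where
  pos_le : ∀ k < m, r.pos (2 * k) ≤ r.pos (2 * k + 1)
  link : ∀ k < m, ∀ z, r.InCore k z → G.IsLink (c z) (p z) (p (z + 1))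
  inj : ∀ k < m, ∀ z, r.InCore k z → ∀ k' < m, ∀ z', r.InCore k' z' → c z = c z' → k = k' ∧ z = z'
  root_mem : ∀ σ < 2 * m, r.root σ ∈ S
  len_valid : ∀ σ < 2 * m, r.len σ = 0 ∨ (r.other σ ∈ S ∧ r.root σ ≠ r.other σ ∧
    r.len σ ≤ (Q (r.root σ) (r.other σ)).length)
  isWalk : ∀ σ < 2 * m, IsWalk G (r.root σ) (r.arm Q σ) (p (r.pos σ))
  arm_disjoint : ∀ σ < 2 * m, ∀ τ < 2 * m, ∀ e ∈ r.arm Q σ, e ∈ r.arm Q τ → σ = τ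
  core_notMem : ∀ σ < 2 * m, ∀ k < m, ∀ z, r.InCore k z → c z ∉ r.arm Q σ
  odd : ∀ k < m, Odd (r.len (2 * k) + (r.pos (2 * k + 1) - r.pos (2 * k)) + r.len (2 * k + 1))
  count_le : ∀ s, (open scoped Classical in Nat.count (fun σ => r.root σ = s) (2 * m)) ≤ q

/-- No trail of the linkage can be used for rerouting any more. -/
def Terminal (S : List α) (Q : α → α → List β) (c : ℕ → β) (m q : ℕ) (r : Routing α) : Prop :=
  ∀ u ∈ S, ∀ v ∈ S, u ≠ v → incidences r.root r.other (2 * m) u < q →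
    ¬ Touched r.root r.other (2 * m) u v → ∀ e ∈ Q u v, ∀ k < m, ∀ z, r.InCore k z → c z ≠ e

variable {S : List α} {Q : α → α → List β} {c : ℕ → β} {p : ℕ → α} {m q : ℕ} {r : Routing α}

lemma arm_reroute_self (σ : ℕ) (u v : α) (l x : ℕ) :
    (r.reroute σ u v l x).arm Q σ = (Q u v).take l := by
  simp [arm, reroute]

lemma arm_reroute_of_ne {σ τ : ℕ} (h : τ ≠ σ) (u v : α) (l x : ℕ) :
    (r.reroute σ u v l x).arm Q τ = r.arm Q τ := by
  simp [arm, reroute, Function.update_of_ne h]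

/-- `incidences` counts the pairs containing u on either side, so it bounds the number of roots at
u. A strict inequality leaves room for one more root there, and no other vertex gains a root. -/
lemma count_reroute_le {σ u v l x} (hu : incidences r.root r.other (2 * m) u < q)
    (hq : ∀ s, (open scoped Classical in Nat.count (fun σ => r.root σ = s) (2 * m)) ≤ q) (s : α) :
    (open scoped Classical in
      Nat.count (fun τ => (r.reroute σ u v l x).root τ = s) (2 * m)) ≤ q := by
  classical
  by_cases hs : s = u
  · subst hs
    refine le_trans ?_ (Nat.succ_le_of_lt hu)
    rw [incidences, Nat.count_eq_card_filter_range, Nat.count_eq_card_filter_range]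
    refine le_trans (Finset.card_le_card (t := insert σ _) ?_) (Finset.card_insert_le _ _)
    intro τ hτ
    rw [Finset.mem_filter, Finset.mem_range] at hτ
    by_cases h : τ = σ
    · simp [h]
    · have h2 := hτ.2
      simp only [reroute, Function.update_of_ne h] at h2
      simp [hτ.1, h2]
  · refine le_trans ?_ (hq s)
    rw [Nat.count_eq_card_filter_range, Nat.count_eq_card_filter_range]
    refine Finset.card_le_card fun τ hτ => ?_
    rw [Finset.mem_filter] at hτ ⊢
    refine ⟨hτ.1, ?_⟩
    have h2 := hτ.2
    by_cases h : τ = σ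
    · subst h; simp only [reroute, Function.update_self] at h2; exact absurd h2.symm hs
    · simpa only [reroute, Function.update_of_ne h] using h2

/-- The part of a rerouting that does not depend on which side of the core is kept. Cores only
shrink, so their links and disjointness are inherited. The new arm is disjoint from the other arms
because its linking trail is assigned to none of them. What does depend on the side (parity, and
disjointness of the new arm from the cores) is a hypothesis. -/
lemma Valid.reroute (hr : r.Valid G S Q c p m q) (hQ : Linkage G S Q) {σ : ℕ} {u v : α} {l x : ℕ}
    (hσ : σ < 2 * m) (hu : u ∈ S) (hv : v ∈ S) (huv : u ≠ v)
    (hcap : incidences r.root r.other (2 * m) u < q)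
    (hunt : ¬ Touched r.root r.other (2 * m) u v)
    (hl : l ≤ (Q u v).length) (hwalk : IsWalk G u ((Q u v).take l) (p x))
    (hle : ∀ k < m, (r.reroute σ u v l x).pos (2 * k) ≤ (r.reroute σ u v l x).pos (2 * k + 1))
    (hsub : ∀ k < m, ∀ z, (r.reroute σ u v l x).InCore k z → r.InCore k z)
    (hdisj : ∀ k < m, ∀ z, (r.reroute σ u v l x).InCore k z → c z ∉ (Q u v).take l)
    (hodd : ∀ k < m, Odd ((r.reroute σ u v l x).len (2 * k) +
      ((r.reroute σ u v l x).pos (2 * k + 1) - (r.reroute σ u v l x).pos (2 * k)) +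
      (r.reroute σ u v l x).len (2 * k + 1))) :
    (r.reroute σ u v l x).Valid G S Q c p m q := by
  -- An arm of positive length lies on the linking trail of its own pair, which differs from the
  -- pair u, v. An arm of length zero has no edges, whatever its pair is.
  have key : ∀ τ < 2 * m, τ ≠ σ → ∀ e ∈ (Q u v).take l, e ∉ r.arm Q τ := by
    intro τ hτ hne e he he'
    rcases hr.len_valid τ hτ with h0 | ⟨h1, h2, -⟩
    · simp [arm, h0] at he'
    · exact hunt ⟨τ, hτ, hQ.eq_of_mem _ (hr.root_mem τ hτ) _ h1 h2 _ hu _ hv huv e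
        (List.mem_of_mem_take he') (List.mem_of_mem_take he)⟩
  refine ⟨hle, fun k hk z hz => hr.link k hk z (hsub k hk z hz),
    fun k hk z hz k' hk' z' hz' => hr.inj k hk z (hsub k hk z hz) k' hk' z' (hsub k' hk' z' hz'),
    ?_, ?_, ?_, ?_, ?_, hodd, count_reroute_le hcap hr.count_le⟩
  · intro τ hτ
    by_cases h : τ = σ
    · subst h; simpa [Routing.reroute] using hu
    · simpa [Routing.reroute, Function.update_of_ne h] using hr.root_mem τ hτ
  · intro τ hτ
    by_cases h : τ = σ
    · subst h; simpa [Routing.reroute] using Or.inr ⟨hv, huv, hl⟩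
    · simpa [Routing.reroute, Function.update_of_ne h] using hr.len_valid τ hτ
  · intro τ hτ
    by_cases h : τ = σ
    · subst h; rw [arm_reroute_self]; simpa [Routing.reroute] using hwalk
    · rw [arm_reroute_of_ne h]
      simpa [Routing.reroute, Function.update_of_ne h] using hr.isWalk τ hτ
  · intro τ hτ τ' hτ' e he he'
    by_cases h : τ = σ <;> by_cases h' : τ' = σ
    · rw [h, h']
    · subst h
      rw [arm_reroute_self] at he; rw [arm_reroute_of_ne h'] at he'
      exact absurd he' (key τ' hτ' h' e he)
    · subst h'
      rw [arm_reroute_self] at he'; rw [arm_reroute_of_ne h] at he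
      exact absurd he (key τ hτ h e he')
    · rw [arm_reroute_of_ne h] at he; rw [arm_reroute_of_ne h'] at he'
      exact hr.arm_disjoint τ hτ τ' hτ' e he he'
  · intro τ hτ k hk z hz
    by_cases h : τ = σ
    · subst h; rw [arm_reroute_self]; exact hdisj k hk z hz
    · rw [arm_reroute_of_ne h]; exact hr.core_notMem τ hτ k hk z (hsub k hk z hz)

lemma pos_reroute (σ τ : ℕ) (u v : α) (l x : ℕ) :
    (r.reroute σ u v l x).pos τ = if τ = σ then x else r.pos τ := by
  simp [reroute, Function.update_apply]

lemma len_reroute (σ τ : ℕ) (u v : α) (l x : ℕ) :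
    (r.reroute σ u v l x).len τ = if τ = σ then l else r.len τ := by
  simp [reroute, Function.update_apply]

/-- The result of rerouting when the trail from `u` to `v` first meets a middle segment at its
edge number `i`, which is at position `z` of trail `k`. Here `d` is `1` if the two trails traverse
this edge in the same direction, and `0` otherwise. -/
noncomputable def step (r : Routing α) (u v : α) (i k z d : ℕ) : Routing α :=
  open scoped Classical in
  if Odd (i + d + (r.pos (2 * k + 1) - (z + 1)) + r.len (2 * k + 1)) then
    r.reroute (2 * k) u v (i + d) (z + 1)
  else r.reroute (2 * k + 1) u v (i + 1 - d) z

/-- The edge at position z splits trail k into a left part of length L and a right part of length R,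
arms included, where L + 1 + R is odd. The candidates have lengths i + d + R and i + 1 - d + L: the
linking trail takes the edge itself exactly when this is needed to reach the start of the part that
is kept. The two lengths add up to 2i + (L + 1 + R), so exactly one of them is odd. -/
lemma Valid.step (hr : r.Valid G S Q c p m q) (hQ : Linkage G S Q) {u v w : α} {i k z d : ℕ}
    (hk : k < m) (hu : u ∈ S) (hv : v ∈ S) (huv : u ≠ v)
    (hcap : incidences r.root r.other (2 * m) u < q)
    (hunt : ¬ Touched r.root r.other (2 * m) u v)
    (hi : i < (Q u v).length) (hw : IsWalk G u ((Q u v).take i) w) (hz : r.InCore k z)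
    (hcz : c z = (Q u v)[i])
    (hfirst : ∀ j (h : j < (Q u v).length), j < i → ∀ k < m, ∀ z, r.InCore k z → c z ≠ (Q u v)[j])
    (hd : (p z = w ∧ d = 1) ∨ (p z ≠ w ∧ d = 0)) :
    (r.step u v i k z d).Valid G S Q c p m q ∧ (r.step u v i k z d).size m < r.size m := by
  have hlink := hr.link k hk z hz
  -- Including edge number i in the prefix does no harm: its only position on the cores is z, by
  -- injectivity, and z leaves the core.
  have hfirst' : ∀ k' < m, ∀ z', r.InCore k' z' → z' ≠ z → c z' ∉ (Q u v).take (i + 1) := by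
    intro k' hk' z' hz' hne hmem
    obtain ⟨j, hj, hje⟩ := List.mem_iff_getElem.1 hmem
    simp only [List.length_take, lt_inf_iff] at hj
    rw [List.getElem_take] at hje
    rcases Nat.lt_or_ge j i with hji | hji
    · exact hfirst j hj.2 hji k' hk' z' hz' hje.symm
    · obtain rfl : j = i := by omega
      exact hne (hr.inj k' hk' z' hz' k hk z hz (by rw [hcz, ← hje])).2
  have htake : ∀ l ≤ i + 1, ∀ k' < m, ∀ z', r.InCore k' z' → z' ≠ z → c z' ∉ (Q u v).take l :=
    fun l hl k' hk' z' hz' hne hmem =>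
      hfirst' k' hk' z' hz' hne ((List.take_subset_take_left _ hl) hmem)
  have hdle : d ≤ 1 := by omega
  -- For d = 1 the linking trail arrives at the tail `p z` of the edge and leaves at `p (z + 1)`.
  -- For d = 0 it does not arrive at `p z`, so it must traverse the edge backwards, and the two
  -- prefixes change roles.
  have hwalks : IsWalk G u ((Q u v).take (i + d)) (p (z + 1)) ∧
      IsWalk G u ((Q u v).take (i + 1 - d)) (p z) := by
    rcases hd with ⟨rfl, rfl⟩ | ⟨hne, rfl⟩
    · exact ⟨(isWalk_take_succ hi).2 ⟨_, hw, hcz ▸ hlink⟩, hw⟩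
    · obtain ⟨w', hw'⟩ := (hQ.isTrail u hu v hv huv).2.2.exists_take (i + 1)
      obtain ⟨w₁, h1, h2⟩ := (isWalk_take_succ hi).1 hw'
      obtain rfl := hw.right_unique h1
      rw [← hcz] at h2
      rcases h2.eq_and_eq_or_eq_and_eq hlink with ⟨h, -⟩ | ⟨h, h'⟩
      · exact absurd h.symm hne
      · rw [h] at hw; rw [h'] at hw'; exact ⟨hw, hw'⟩
  obtain ⟨hz1, hz2⟩ := hz
  -- Only core k changes, and it loses at least position z on either side.
  have hsize : ∀ r' : Routing α, (∀ k' < m, r'.pos (2 * k' + 1) - r'.pos (2 * k') ≤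
      r.pos (2 * k' + 1) - r.pos (2 * k')) → r'.pos (2 * k + 1) - r'.pos (2 * k) <
      r.pos (2 * k + 1) - r.pos (2 * k) → r'.size m < r.size m := fun r' h1 h2 =>
    Finset.sum_lt_sum (fun k' hk' => h1 k' (Finset.mem_range.1 hk'))
      ⟨k, Finset.mem_range.2 hk, h2⟩
  rw [Routing.step]
  split_ifs with hodd
  -- The right part gives an odd trail: the core now starts at z + 1.
  · refine ⟨hr.reroute hQ (by omega) hu hv huv hcap hunt (by omega) hwalks.1 ?_ ?_ ?_ ?_,
      hsize _ ?_ ?_⟩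
    · intro k' hk'
      have := hr.pos_le k' hk'
      simp only [pos_reroute]; grind
    · intro k' hk' z' hz'
      simp only [InCore, pos_reroute] at hz' ⊢; grind
    · intro k' hk' z' hz'
      refine htake _ (by omega) k' hk' z' ?_ ?_ <;> simp only [InCore, pos_reroute] at hz' ⊢
      · grind
      · rintro rfl
        by_cases hkk : k' = k
        · subst hkk; simp at hz'
        · have : ¬ (2 * k' = 2 * k) := by omega
          have h2 : ¬ (2 * k' + 1 = 2 * k) := by omega
          simp only [this, h2, if_false] at hz'
          exact hkk (hr.inj k' hk' z' hz' k hk z' ⟨hz1, hz2⟩ rfl).1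
    · intro k' hk'
      have := hr.odd k' hk'
      by_cases hkk : k' = k
      · subst hkk; simp [pos_reroute, len_reroute]; exact hodd
      · have : ¬ (2 * k' = 2 * k) := by omega
        have h2 : ¬ (2 * k' + 1 = 2 * k) := by omega
        simpa only [pos_reroute, len_reroute, this, h2, if_false]
    · intro k' hk'
      simp only [pos_reroute]; grind
    · simp [pos_reroute]; omega
  -- The right part gives an even trail, so the left part is kept and the core now ends at z.
  · refine ⟨hr.reroute hQ (by omega) hu hv huv hcap hunt (by omega) hwalks.2 ?_ ?_ ?_ ?_,
      hsize _ ?_ ?_⟩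
    · intro k' hk'
      have := hr.pos_le k' hk'
      simp only [pos_reroute]; grind
    · intro k' hk' z' hz'
      simp only [InCore, pos_reroute] at hz' ⊢; grind
    · intro k' hk' z' hz'
      refine htake _ (by omega) k' hk' z' ?_ ?_ <;> simp only [InCore, pos_reroute] at hz' ⊢
      · grind
      · rintro rfl
        by_cases hkk : k' = k
        · subst hkk; simp at hz'
        · have : ¬ (2 * k' = 2 * k + 1) := by omega
          have h2 : ¬ (2 * k' + 1 = 2 * k + 1) := by omega
          simp only [this, h2, if_false] at hz'
          exact hkk (hr.inj k' hk' z' hz' k hk z' ⟨hz1, hz2⟩ rfl).1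
    · intro k' hk'
      -- The old length is odd and the rejected candidate is even, so the other candidate is odd.
      have h0 := hr.odd k' hk'
      by_cases hkk : k' = k
      · subst hkk
        simp [pos_reroute, len_reroute] at *
        grind
      · have : ¬ (2 * k' = 2 * k + 1) := by omega
        have h2 : ¬ (2 * k' + 1 = 2 * k + 1) := by omega
        simpa only [pos_reroute, len_reroute, this, h2, if_false]
    · intro k' hk'
      simp only [pos_reroute]; grind
    · simp [pos_reroute]; omega

/-- A linking trail that violates terminality meets some core. The edge with the least index that
does so is the one at which to reroute. -/
lemma Valid.exists_step (hr : r.Valid G S Q c p m q) (hQ : Linkage G S Q)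
    (ht : ¬ r.Terminal S Q c m q) :
    ∃ r' : Routing α, r'.Valid G S Q c p m q ∧ r'.size m < r.size m := by
  classical
  simp only [Terminal, not_forall] at ht
  obtain ⟨u, hu, v, hv, huv, hcap, hunt, e, he, k, hk, z, hz, hcz⟩ := ht
  have hex : ∃ i, ∃ h : i < (Q u v).length, ∃ k < m, ∃ z, r.InCore k z ∧ c z = (Q u v)[i] := by
    obtain ⟨i, hi, rfl⟩ := List.mem_iff_getElem.1 he
    exact ⟨i, hi, k, hk, z, hz, not_not.1 hcz⟩
  obtain ⟨hi, k', hk', z', hz', hcz'⟩ := Nat.find_spec hex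
  obtain ⟨w, hw⟩ := (hQ.isTrail u hu v hv huv).2.2.exists_take (Nat.find hex)
  refine ⟨_, hr.step hQ (d := if p z' = w then 1 else 0) hk' hu hv huv hcap hunt hi hw hz' hcz'
    ?_ ?_⟩
  · intro j hj hji k hk z hz h
    exact Nat.find_min hex hji ⟨hj, k, hk, z, hz, h⟩
  · split_ifs with h <;> simp [h]

/-- The total size of the cores is a natural number that drops with every rerouting. -/
lemma Valid.exists_terminal (hr : r.Valid G S Q c p m q) (hQ : Linkage G S Q) :
    ∃ r' : Routing α, r'.Valid G S Q c p m q ∧ r'.Terminal S Q c m q := by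
  induction h : r.size m using Nat.strong_induction_on generalizing r with
  | _ n ih =>
    subst h
    by_cases ht : r.Terminal S Q c m q
    · exact ⟨r, hr, ht⟩
    · obtain ⟨r', hr', hlt⟩ := hr.exists_step hQ ht
      exact ih _ hlt hr' rfl

end Routing

end Routing

/-! ### Selecting the branch trails -/

section Selection

/-- The pairs `(i, j)` with `i < j < k`, in the order of `pairs k`. -/
def pairList (k : ℕ) : List (ℕ × ℕ) :=
  (List.range k).flatMap fun j => (List.range j).map fun i => (i, j)

lemma pairList_succ (k : ℕ) :
    pairList (k + 1) = pairList k ++ (List.range k).map fun i => (i, k) := by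
  simp [pairList, List.range_succ]

lemma mem_pairList {k : ℕ} {x : ℕ × ℕ} : x ∈ pairList k ↔ x.1 < x.2 ∧ x.2 < k := by
  obtain ⟨i, j⟩ := x
  simp only [pairList, List.mem_flatMap, List.mem_range, List.mem_map, Prod.mk.injEq]
  constructor
  · rintro ⟨j', h, i', h', rfl, rfl⟩; exact ⟨h', h⟩
  · rintro ⟨h, h'⟩; exact ⟨j, h', i, h, rfl, rfl⟩

lemma nodup_pairList (k : ℕ) : (pairList k).Nodup := by
  induction k with
  | zero => simp [pairList]
  | succ k ih =>
    rw [pairList_succ, List.nodup_append']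
    refine ⟨ih, List.nodup_range.map fun i j h => by simpa using h, fun x hx hx' => ?_⟩
    obtain ⟨i, -, rfl⟩ := List.mem_map.1 hx'
    exact absurd (mem_pairList.1 hx).2 (lt_irrefl _)

lemma length_pairList_le (k : ℕ) : (pairList k).length ≤ k * k := by
  induction k with
  | zero => simp [pairList]
  | succ k ih => rw [pairList_succ]; simp; nlinarith

/-- Transfers the prescribed output order to pairs of natural numbers, where prefixes and positions
are easy to handle and which the loops of the program follow. -/
lemma pairs_map (k : ℕ) :
    (pairs k).map (Sym2.map Fin.val) = (pairList k).map fun x => s(x.1, x.2) := by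
  have h2 : ∀ j : Fin k, ((List.finRange k).filter (· < j)).map Fin.val = List.range j := by
    intro j
    have : ((List.finRange k).filter (· < j)).map Fin.val =
        ((List.finRange k).map Fin.val).filter (· < (j : ℕ)) := by
      rw [List.filter_map]; rfl
    rw [this, List.map_coe_finRange_eq_range]
    have hj := j.2
    generalize (j : ℕ) = j' at hj ⊢
    obtain ⟨d, rfl⟩ := Nat.exists_eq_add_of_lt hj
    rw [add_assoc, List.range_add, List.filter_append,
      List.filter_eq_self.2 (by simp), List.filter_eq_nil_iff.2 (by simp), List.append_nil]
  have h3 : (List.range k) = (List.finRange k).map Fin.val := (List.map_coe_finRange_eq_range).symm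
  rw [pairs, pairList, h3, List.map_flatMap, List.map_flatMap, List.flatMap_map]
  refine List.flatMap_congr fun j _ => ?_
  rw [← h2 j]
  simp [Function.comp_def]

lemma length_pairs (k : ℕ) : (pairs k).length = (pairList k).length := by
  simpa using congrArg List.length (pairs_map k)

lemma map_pairs_getElem {k n : ℕ} (h : n < (pairs k).length) (h' : n < (pairList k).length) :
    Sym2.map Fin.val (pairs k)[n] = s((pairList k)[n].1, (pairList k)[n].2) := by
  have := List.getElem_of_eq (pairs_map k) (i := n) (by simpa using h)
  simpa using this

lemma sym2_map_val_injective (k : ℕ) : Function.Injective (Sym2.map (Fin.val (n := k))) :=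
  Sym2.map.injective Fin.val_injective

lemma nodup_pairs (k : ℕ) : (pairs k).Nodup := by
  refine List.Nodup.of_map (Sym2.map Fin.val) ?_
  rw [pairs_map]
  refine (List.nodup_map_iff_inj_on (nodup_pairList k)).2 fun x hx y hy h => ?_
  have := mem_pairList.1 hx; have := mem_pairList.1 hy
  rcases Sym2.eq_iff.1 h with ⟨h1, h2⟩ | ⟨h1, h2⟩
  · exact Prod.ext h1 h2
  · omega

lemma pairs_getElem {k n : ℕ} (h : n < (pairs k).length) (h' : n < (pairList k).length)
    {i j : Fin k} (hi : (pairList k)[n].1 = i) (hj : (pairList k)[n].2 = j) :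
    (pairs k)[n] = s(i, j) := by
  apply sym2_map_val_injective
  rw [map_pairs_getElem h h', hi, hj]; rfl

lemma mem_pairs {k : ℕ} {e : Sym2 (Fin k)} : e ∈ pairs k ↔ ¬ e.IsDiag := by
  constructor
  · intro he hd
    obtain ⟨n, hn, rfl⟩ := List.mem_iff_getElem.1 he
    have hn' : n < (pairList k).length := length_pairs k ▸ hn
    have h2 := mem_pairList.1 (List.getElem_mem hn')
    rw [pairs_getElem (i := ⟨(pairList k)[n].1, h2.1.trans h2.2⟩) (j := ⟨(pairList k)[n].2, h2.2⟩)
      hn hn' rfl rfl, Sym2.mk_isDiag_iff, Fin.mk.injEq] at hd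
    omega
  · induction e with
    | _ i j =>
      intro hd
      wlog hij : i < j generalizing i j
      · rw [Sym2.eq_swap]
        refine this j i (by simpa [eq_comm] using hd) ?_
        simp at hd; omega
      · simp only [pairs, List.mem_flatMap, List.mem_finRange, true_and, List.mem_map,
          List.mem_filter, decide_eq_true_eq]
        exact ⟨j, i, hij, rfl⟩

lemma mem_edgeSet_completeK {k : ℕ} {e : Sym2 (Fin k)} : e ∈ E(completeK k) ↔ e ∈ pairs k := by
  rw [mem_pairs]
  induction e with
  | _ i j => simp [completeK, Graph.ofSimpleGraph]

lemma completeK_isLink {k : ℕ} {i j : Fin k} (h : i ≠ j) : (completeK k).IsLink s(i, j) i j := by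
  simpa [completeK, Graph.ofSimpleGraph] using h

end Selection

/-! ### The counting argument and the assembly of the odd branch trails -/

section BranchTrails

variable {α : Type u} {β : Type v} {G H : Graph α β}

namespace Routing

variable {S : List α} {Q : α → α → List β} {c : ℕ → β} {p : ℕ → α} {m q : ℕ} {r : Routing α}

/-- Trail number `k` of the family. -/
def middle (r : Routing α) (Q : α → α → List β) (c : ℕ → β) (k : ℕ) : List β :=
  r.arm Q (2 * k) ++ segment c (r.pos (2 * k)) (r.pos (2 * k + 1)) ++
    (r.arm Q (2 * k + 1)).reverse

lemma mem_middle {k : ℕ} {e : β} : e ∈ r.middle Q c k ↔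
    (∃ σ, (σ = 2 * k ∨ σ = 2 * k + 1) ∧ e ∈ r.arm Q σ) ∨ ∃ z, r.InCore k z ∧ c z = e := by
  simp only [middle, List.mem_append, mem_segment, List.mem_reverse, InCore]
  grind

lemma Valid.arm_nodup (hr : r.Valid G S Q c p m q) (hQ : Linkage G S Q) {σ : ℕ} (hσ : σ < 2 * m) :
    (r.arm Q σ).Nodup := by
  rcases hr.len_valid σ hσ with h | ⟨h1, h2, -⟩
  · simp [arm, h]
  · exact (hQ.isTrail _ (hr.root_mem σ hσ) _ h1 h2).2.1.sublist (List.take_sublist _ _)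

lemma Valid.length_arm (hr : r.Valid G S Q c p m q) {σ : ℕ} (hσ : σ < 2 * m) :
    (r.arm Q σ).length = r.len σ := by
  rcases hr.len_valid σ hσ with h | ⟨-, -, h⟩
  · simp [arm, h]
  · simpa [arm] using h

/-- A common edge would be shared by two arms, by an arm and a core, or by two cores; validity
excludes each of these unless the trails coincide. -/
lemma Valid.middle_disjoint (hr : r.Valid G S Q c p m q) {k k' : ℕ} (hk : k < m) (hk' : k' < m)
    {e : β} (he : e ∈ r.middle Q c k) (he' : e ∈ r.middle Q c k') : k = k' := by
  rw [mem_middle] at he he'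
  rcases he with ⟨σ, hσ, he⟩ | ⟨z, hz, he⟩ <;> rcases he' with ⟨τ, hτ, he'⟩ | ⟨z', hz', he'⟩
  · have := hr.arm_disjoint σ (by omega) τ (by omega) e he he'
    omega
  · exact absurd he (he' ▸ hr.core_notMem σ (by omega) k' hk' z' hz')
  · exact absurd he' (he ▸ hr.core_notMem τ (by omega) k hk z hz)
  · exact (hr.inj k hk z hz k' hk' z' hz' (he.trans he'.symm)).1

lemma Valid.middle_nodup (hr : r.Valid G S Q c p m q) (hQ : Linkage G S Q) {k : ℕ} (hk : k < m) :
    (r.middle Q c k).Nodup := by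
  rw [middle, List.nodup_append', List.nodup_append', List.nodup_reverse]
  refine ⟨⟨hr.arm_nodup hQ (by omega), ?_, ?_⟩, hr.arm_nodup hQ (by omega), ?_⟩
  · refine (List.nodup_map_iff_inj_on List.nodup_range').2 fun z hz z' hz' h => ?_
    rw [List.mem_range'_1] at hz hz'
    exact (hr.inj k hk z ⟨hz.1, by omega⟩ k hk z' ⟨hz'.1, by omega⟩ h).2
  · intro e he he'
    obtain ⟨z, h1, h2, rfl⟩ := mem_segment.1 he'
    exact hr.core_notMem _ (by omega) k hk z ⟨h1, h2⟩ he
  · intro e he he'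
    rw [List.mem_reverse] at he'
    rcases List.mem_append.1 he with he | he
    · have := hr.arm_disjoint _ (by omega) _ (by omega) e he he'
      omega
    · obtain ⟨z, h1, h2, rfl⟩ := mem_segment.1 he
      exact hr.core_notMem _ (by omega) k hk z ⟨h1, h2⟩ he'

lemma Valid.middle_isWalk (hr : r.Valid G S Q c p m q) {k : ℕ} (hk : k < m) :
    IsWalk G (r.root (2 * k)) (r.middle Q c k) (r.root (2 * k + 1)) := by
  have h1 := hr.isWalk (2 * k) (by omega)
  have h2 := hr.isWalk (2 * k + 1) (by omega)
  rw [middle, isWalk_append]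
  refine ⟨_, isWalk_append.2 ⟨_, h1, isWalk_segment (hr.pos_le k hk) h1.right_mem ?_⟩, h2.reverse⟩
  exact fun z hz hz' => hr.link k hk z ⟨hz, hz'⟩

lemma Valid.middle_odd (hr : r.Valid G S Q c p m q) {k : ℕ} (hk : k < m) :
    Odd (r.middle Q c k).length := by
  simpa [middle, length_segment, ← add_assoc, hr.length_arm (show 2 * k < 2 * m by omega),
    hr.length_arm (show 2 * k + 1 < 2 * m by omega)] using hr.odd k hk

/-- This is what rerouting is for. An unassigned linking trail misses the arms because these lie on
other linking trails, and it misses the cores by terminality. The capacity condition concerns the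
first vertex u only. -/
lemma Terminal.notMem_middle (ht : r.Terminal S Q c m q) (hr : r.Valid G S Q c p m q)
    (hQ : Linkage G S Q) {u v : α} (hu : u ∈ S) (hv : v ∈ S) (huv : u ≠ v)
    (hd : incidences r.root r.other (2 * m) u < q) (hunt : ¬ Touched r.root r.other (2 * m) u v)
    {e : β} (he : e ∈ Q u v) {k : ℕ} (hk : k < m) : e ∉ r.middle Q c k := by
  rw [mem_middle]
  rintro (⟨σ, hσ, hσe⟩ | ⟨z, hz, hze⟩)
  · have hσm : σ < 2 * m := by omega
    rcases hr.len_valid σ hσm with h | ⟨h1, h2, -⟩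
    · simp [arm, h] at hσe
    · exact hunt ⟨σ, hσm, hQ.eq_of_mem _ (hr.root_mem σ hσm) _ h1 h2 _ hu _ hv huv e
        (List.mem_of_mem_take hσe) he⟩
  · exact ht u hu v hv huv hd hunt e he k hk z hz hze

/-- Double counting: every pair contributes to at most two vertices. -/
lemma sum_incidences_le (root other : ℕ → α) (N : ℕ) (A : Finset α) :
    ∑ s ∈ A, incidences root other N s ≤ 2 * N := by
  classical
  have h1 : ∀ s, incidences root other N s =
      ∑ σ ∈ Finset.range N, if root σ = s ∨ other σ = s then 1 else 0 := by
    intro s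
    rw [incidences, Nat.count_eq_card_filter_range, Finset.card_filter]
  simp only [h1]
  rw [Finset.sum_comm, mul_comm]
  refine le_trans (Finset.sum_le_card_nsmul _ _ 2 fun σ _ => ?_) (by simp)
  rw [← Finset.card_filter]
  refine le_trans (Finset.card_le_card (t := {root σ, other σ}) fun s hs => ?_) Finset.card_le_two
  simp only [Finset.mem_filter] at hs
  rcases hs.2 with h | h <;> simp [h]

-- Were there fewer than t vertices of small incidence, at least 1399t + 1 vertices would have
-- incidence at least 20t, giving a sum of at least 20t(1399t + 1). This exceeds the bound 2N =
-- 14000t².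
open scoped Classical in
lemma le_length_filter_incidences (root other : ℕ → α) {t N : ℕ} (hS : S.Nodup)
    (hlen : S.length = 1400 * t) (hN : N = 7000 * t ^ 2) :
    t ≤ (S.filter fun s => incidences root other N s < 20 * t).length := by
  have h1 := sum_incidences_le root other N
    (S.filter fun s => ¬ incidences root other N s < 20 * t).toFinset
  have h2 := Finset.card_nsmul_le_sum
    (S.filter fun s => ¬ incidences root other N s < 20 * t).toFinset
    (incidences root other N) (20 * t) (by
      intro s hs
      simp only [List.mem_toFinset, List.mem_filter, decide_eq_true_eq] at hs
      omega)
  rw [List.toFinset_card_of_nodup (hS.filter _), smul_eq_mul] at h2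
  have h3 : (S.filter fun s => incidences root other N s < 20 * t).length +
      (S.filter fun s => ¬ incidences root other N s < 20 * t).length = S.length := by
    rw [List.length_eq_length_filter_add (l := S) (fun s => incidences root other N s < 20 * t)]
    simp only [decide_not]
  by_contra hlt
  have h4 : 1399 * t + 1 ≤ (S.filter fun s => ¬ incidences root other N s < 20 * t).length := by
    omega
  have ht : 0 < t := by omega
  have h5 := (Nat.mul_le_mul_right (20 * t) h4).trans (h2.trans h1)
  subst hN
  nlinarith

/-- A branch trail joins the branch vertices number `x.1.1` and `x.1.2` by means of the odd trail
number `x.2`; the latter has to be attached by trails of the linkage that are not in use. -/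
structure Admissible (r : Routing α) (m t : ℕ) (B : ℕ → α) (x : (ℕ × ℕ) × ℕ) : Prop where
  fst_lt : x.1.1 < t
  snd_lt : x.1.2 < t
  lt : x.2 < m
  fst_ne : ∀ i < t, B i ≠ r.root (2 * x.2)
  snd_ne : ∀ i < t, B i ≠ r.root (2 * x.2 + 1)
  fst_untouched : ¬ Touched r.root r.other (2 * m) (B x.1.1) (r.root (2 * x.2))
  snd_untouched : ¬ Touched r.root r.other (2 * m) (B x.1.2) (r.root (2 * x.2 + 1))

/-- Two branch trails use different trails throughout. -/
structure Compatible (r : Routing α) (B : ℕ → α) (x y : (ℕ × ℕ) × ℕ) : Prop where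
  ne : x.2 ≠ y.2
  fst_fst : s(B x.1.1, r.root (2 * x.2)) ≠ s(B y.1.1, r.root (2 * y.2))
  snd_fst : s(B x.1.2, r.root (2 * x.2 + 1)) ≠ s(B y.1.1, r.root (2 * y.2))
  fst_snd : s(B x.1.1, r.root (2 * x.2)) ≠ s(B y.1.2, r.root (2 * y.2 + 1))
  snd_snd : s(B x.1.2, r.root (2 * x.2 + 1)) ≠ s(B y.1.2, r.root (2 * y.2 + 1))

/-- A family of compatible branch trails. -/
structure Selection (r : Routing α) (m t : ℕ) (B : ℕ → α) (sel : List ((ℕ × ℕ) × ℕ)) : Prop where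
  admissible : ∀ x ∈ sel, r.Admissible m t B x
  pairwise : sel.Pairwise (r.Compatible B)

-- Each vertex of A is a root at most q times. Here d = 0 and d = 1 stand for the two ends of the
-- odd trails.
open scoped Classical in
lemma card_filter_root_mem_le (hq : ∀ s, Nat.count (fun σ => r.root σ = s) (2 * m) ≤ q)
    (A : Finset α) {d : ℕ} (hd : d < 2) :
    ((Finset.range m).filter fun k => r.root (2 * k + d) ∈ A).card ≤ q * A.card := by
  refine Finset.card_le_mul_card_image_of_maps_to (f := fun k => r.root (2 * k + d))
    (fun k hk => (Finset.mem_filter.1 hk).2) q fun a _ => le_trans ?_ (hq a)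
  rw [Nat.count_eq_card_filter_range]
  refine Finset.card_le_card_of_injOn (fun k => 2 * k + d) (fun k hk => ?_) ?_
  · simp only [Finset.coe_filter, Finset.mem_filter, Finset.mem_range, Set.mem_ofPred_eq] at hk ⊢
    exact ⟨by omega, hk.2⟩
  · intro k _ k' _ h
    simp only at h; omega

/-- The vertices that cannot be joined to `B i`. -/
lemma exists_finset_forall_notMem {t : ℕ} {B : ℕ → α} {sel : List ((ℕ × ℕ) × ℕ)}
    (hB : ∀ i < t, ∀ j < t, B i = B j → i = j) (hsel : r.Selection m t B sel)
    (hkeys : (sel.map Prod.fst).Nodup) {i : ℕ} (hi : i < t)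
    (hdeg : incidences r.root r.other (2 * m) (B i) ≤ 20 * t) :
    ∃ A : Finset α, A.card ≤ 23 * t ∧ ∀ a ∉ A, (∀ j < t, B j ≠ a) ∧
      ¬ Touched r.root r.other (2 * m) (B i) a ∧ ∀ x ∈ sel,
        s(B x.1.1, r.root (2 * x.2)) ≠ s(B i, a) ∧
        s(B x.1.2, r.root (2 * x.2 + 1)) ≠ s(B i, a) := by
  classical
  -- The bound 23t is t + 20t + t + t: the branch vertices, the partners of B i in the pairs of the
  -- routing, and the roots already linked to B i by earlier branch trails that have i as their
  -- first or as their second index.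
  let A1 := (Finset.range t).image B
  let A2 := ((Finset.range (2 * m)).filter fun σ => r.root σ = B i ∨ r.other σ = B i).image
    fun σ => if r.root σ = B i then r.other σ else r.root σ
  let A3 := (sel.toFinset.filter fun x => x.1.1 = i).image fun x => r.root (2 * x.2)
  let A4 := (sel.toFinset.filter fun x => x.1.2 = i).image fun x => r.root (2 * x.2 + 1)
  -- A selected branch trail is determined by its two indices. With one index equal to i, the other
  -- one leaves at most t possibilities.
  have hinj : ∀ x ∈ sel, ∀ y ∈ sel, x.1 = y.1 → x = y := by
    intro x hx y hy h
    exact List.inj_on_of_nodup_map hkeys hx hy h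
  have c1 : A1.card ≤ t := Finset.card_image_le.trans (by simp)
  have c2 : A2.card ≤ 20 * t := by
    refine Finset.card_image_le.trans (le_trans (le_of_eq ?_) hdeg)
    rw [incidences, Nat.count_eq_card_filter_range]
  have c3 : A3.card ≤ t := by
    refine Finset.card_image_le.trans ?_
    rw [← Finset.card_range t]
    refine Finset.card_le_card_of_injOn (fun x => x.1.2) (fun x hx => ?_) fun x hx y hy h => ?_
    · simp only [Finset.coe_filter, List.mem_toFinset, Set.mem_ofPred_eq] at hx
      simpa using (hsel.admissible x hx.1).snd_lt
    · simp only [Finset.coe_filter, List.mem_toFinset, Set.mem_ofPred_eq] at hx hy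
      exact hinj x hx.1 y hy.1 (Prod.ext (hx.2.trans hy.2.symm) h)
  have c4 : A4.card ≤ t := by
    refine Finset.card_image_le.trans ?_
    rw [← Finset.card_range t]
    refine Finset.card_le_card_of_injOn (fun x => x.1.1) (fun x hx => ?_) fun x hx y hy h => ?_
    · simp only [Finset.coe_filter, List.mem_toFinset, Set.mem_ofPred_eq] at hx
      simpa using (hsel.admissible x hx.1).fst_lt
    · simp only [Finset.coe_filter, List.mem_toFinset, Set.mem_ofPred_eq] at hx hy
      exact hinj x hx.1 y hy.1 (Prod.ext h (hx.2.trans hy.2.symm))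
  refine ⟨A1 ∪ A2 ∪ A3 ∪ A4, ?_, fun a ha => ?_⟩
  · have h1 := Finset.card_union_le (A1 ∪ A2 ∪ A3) A4
    have h2 := Finset.card_union_le (A1 ∪ A2) A3
    have h3 := Finset.card_union_le A1 A2
    omega
  · simp only [Finset.mem_union, not_or] at ha
    obtain ⟨⟨⟨h1, h2⟩, h3⟩, h4⟩ := ha
    have hne : ∀ j < t, B j ≠ a := fun j hj h =>
      h1 (Finset.mem_image.2 ⟨j, Finset.mem_range.2 hj, h⟩)
    refine ⟨hne, ?_, fun x hx => ⟨fun h => ?_, fun h => ?_⟩⟩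
    · rintro ⟨σ, hσ, h⟩
      refine h2 (Finset.mem_image.2 ⟨σ, ?_, ?_⟩)
      · rw [Finset.mem_filter, Finset.mem_range]
        refine ⟨hσ, ?_⟩
        rcases Sym2.eq_iff.1 h with h | h
        · exact Or.inl h.1
        · exact Or.inr h.2
      · rcases Sym2.eq_iff.1 h with h | h
        · simp [h.1, h.2]
        · have : r.root σ ≠ B i := fun h' => hne i hi (h'.symm.trans h.1)
          rw [if_neg this, h.1]
    · have hx' := hsel.admissible x hx
      rcases Sym2.eq_iff.1 h with h | h
      · exact h3 (Finset.mem_image.2 ⟨x, by simp [hx, hB _ hx'.fst_lt _ hi h.1], h.2⟩)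
      · exact hne _ hx'.fst_lt h.1
    · have hx' := hsel.admissible x hx
      rcases Sym2.eq_iff.1 h with h | h
      · exact h4 (Finset.mem_image.2 ⟨x, by simp [hx, hB _ hx'.snd_lt _ hi h.1], h.2⟩)
      · exact hne _ hx'.snd_lt h.1

/-- On either side at most 23t roots are forbidden, and each of them rules out at most 20t odd
trails. At most t² odd trails were chosen before. The total 921t² is less than 3500t². -/
lemma exists_admissible {t : ℕ} {B : ℕ → α} {sel : List ((ℕ × ℕ) × ℕ)}
    (hcount : ∀ s, (open scoped Classical in Nat.count (fun σ => r.root σ = s) (2 * m)) ≤ 20 * t)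
    (hm : m = 3500 * t ^ 2)
    (hB : ∀ i < t, ∀ j < t, B i = B j → i = j) (hsel : r.Selection m t B sel)
    (hdeg : ∀ i < t, incidences r.root r.other (2 * m) (B i) ≤ 20 * t)
    (hkeys : (sel.map Prod.fst).Nodup) (hlen : sel.length ≤ t ^ 2) {i j : ℕ} (hi : i < t)
    (hj : j < t) :
    ∃ k, r.Admissible m t B ((i, j), k) ∧ ∀ x ∈ sel, r.Compatible B x ((i, j), k) := by
  classical
  obtain ⟨A, hA, hA'⟩ := exists_finset_forall_notMem hB hsel hkeys hi (hdeg i hi)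
  obtain ⟨A', hAA, hAA'⟩ := exists_finset_forall_notMem hB hsel hkeys hj (hdeg j hj)
  -- The unavailable odd trails: those already chosen, and those with a bad first or a bad second
  -- end.
  let K := (sel.map Prod.snd).toFinset ∪ ((Finset.range m).filter fun k => r.root (2 * k + 0) ∈ A) ∪
    ((Finset.range m).filter fun k => r.root (2 * k + 1) ∈ A')
  have h1 : (sel.map Prod.snd).toFinset.card ≤ t ^ 2 :=
    (List.toFinset_card_le _).trans (by simpa using hlen)
  have h2 := card_filter_root_mem_le (r := r) (m := m) (q := 20 * t) hcount A (d := 0) (by omega)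
  have h3 := card_filter_root_mem_le (r := r) (m := m) (q := 20 * t) hcount A' (d := 1) (by omega)
  have hK : K.card < (Finset.range m).card := by
    have ht : 0 < t := by omega
    refine lt_of_le_of_lt ((Finset.card_union_le _ _).trans
      (Nat.add_le_add_right (Finset.card_union_le _ _) _)) ?_
    have h4 := h2.trans (Nat.mul_le_mul_left (20 * t) hA)
    have h5 := h3.trans (Nat.mul_le_mul_left (20 * t) hAA)
    rw [Finset.card_range]
    refine lt_of_le_of_lt (Nat.add_le_add (Nat.add_le_add h1 h4) h5) ?_
    rw [hm]; nlinarith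
  obtain ⟨k, hkm, hk⟩ := Finset.exists_mem_notMem_of_card_lt_card hK
  rw [Finset.mem_range] at hkm
  simp only [K, Finset.mem_union, not_or, Finset.mem_filter, Finset.mem_range, hkm, true_and,
    add_zero, List.mem_toFinset] at hk
  obtain ⟨⟨h6, h7⟩, h8⟩ := hk
  obtain ⟨a1, a2, a3⟩ := hA' _ h7
  obtain ⟨b1, b2, b3⟩ := hAA' _ h8
  refine ⟨k, ⟨hi, hj, hkm, a1, b1, a2, b2⟩, fun x hx => ⟨fun h => h6 ?_, (a3 x hx).1, (a3 x hx).2,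
    (b3 x hx).1, (b3 x hx).2⟩⟩
  exact List.mem_map.2 ⟨x, hx, h⟩

lemma Selection.concat {t : ℕ} {B : ℕ → α} {sel : List ((ℕ × ℕ) × ℕ)} {y : (ℕ × ℕ) × ℕ}
    (hsel : r.Selection m t B sel) (hy : r.Admissible m t B y)
    (h : ∀ x ∈ sel, r.Compatible B x y) : r.Selection m t B (sel ++ [y]) := by
  refine ⟨fun x hx => ?_, ?_⟩
  · rcases List.mem_append.1 hx with hx | hx
    · exact hsel.admissible x hx
    · obtain rfl := List.mem_singleton.1 hx; exact hy
  · rw [List.pairwise_append]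
    exact ⟨hsel.pairwise, List.pairwise_singleton _ _, fun x hx z hz => by
      obtain rfl := List.mem_singleton.1 hz; exact h x hx⟩

/-- The branch trail encoded by `x`. -/
def branchTrail (r : Routing α) (Q : α → α → List β) (c : ℕ → β) (B : ℕ → α) (x : (ℕ × ℕ) × ℕ) :
    List β :=
  Q (B x.1.1) (r.root (2 * x.2)) ++ r.middle Q c x.2 ++ Q (r.root (2 * x.2 + 1)) (B x.1.2)

section

variable {t : ℕ} {B : ℕ → α}

lemma mem_branchTrail (hQ : Linkage G S Q) (hr : r.Valid G S Q c p m q)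
    (hBS : ∀ i < t, B i ∈ S) {x : (ℕ × ℕ) × ℕ} (hx : r.Admissible m t B x) {e : β} :
    e ∈ r.branchTrail Q c B x ↔ e ∈ r.middle Q c x.2 ∨ e ∈ Q (B x.1.1) (r.root (2 * x.2)) ∨
      e ∈ Q (B x.1.2) (r.root (2 * x.2 + 1)) := by
  have h1 := hr.root_mem (2 * x.2 + 1) (by have := hx.lt; omega)
  have h2 := hBS _ hx.snd_lt
  have h3 := hx.snd_ne _ hx.snd_lt
  have h4 : e ∈ Q (B x.1.2) (r.root (2 * x.2 + 1)) ↔ e ∈ Q (r.root (2 * x.2 + 1)) (B x.1.2) :=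
    ⟨hQ.symm _ h2 _ h1 h3 e, hQ.symm _ h1 _ h2 h3.symm e⟩
  rw [branchTrail, List.mem_append, List.mem_append, h4]
  tauto

/-- Each branch trail has three parts, two links and an odd trail. Different odd trails are
disjoint, a link is disjoint from all odd trails by terminality, and two links are disjoint because
their pairs of ends differ. -/
lemma branchTrail_disjoint (hQ : Linkage G S Q) (hr : r.Valid G S Q c p m q)
    (ht : r.Terminal S Q c m q) (hBS : ∀ i < t, B i ∈ S)
    (hdeg : ∀ i < t, incidences r.root r.other (2 * m) (B i) < q) {x y : (ℕ × ℕ) × ℕ}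
    (hx : r.Admissible m t B x) (hy : r.Admissible m t B y) (hxy : r.Compatible B x y) :
    (r.branchTrail Q c B x).Disjoint (r.branchTrail Q c B y) := by
  intro e he he'
  rw [mem_branchTrail hQ hr hBS hx] at he
  rw [mem_branchTrail hQ hr hBS hy] at he'
  have hroot : ∀ z, r.Admissible m t B z → r.root (2 * z.2) ∈ S ∧ r.root (2 * z.2 + 1) ∈ S :=
    fun z hz => ⟨hr.root_mem _ (by have := hz.lt; omega), hr.root_mem _ (by have := hz.lt; omega)⟩
  have hfst : ∀ z, r.Admissible m t B z → e ∈ Q (B z.1.1) (r.root (2 * z.2)) →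
      ∀ k < m, e ∉ r.middle Q c k := fun z hz hze k hk =>
    ht.notMem_middle hr hQ (hBS _ hz.fst_lt) (hroot z hz).1 (hz.fst_ne _ hz.fst_lt)
      (hdeg _ hz.fst_lt) hz.fst_untouched hze hk
  have hsnd : ∀ z, r.Admissible m t B z → e ∈ Q (B z.1.2) (r.root (2 * z.2 + 1)) →
      ∀ k < m, e ∉ r.middle Q c k := fun z hz hze k hk =>
    ht.notMem_middle hr hQ (hBS _ hz.snd_lt) (hroot z hz).2 (hz.snd_ne _ hz.snd_lt)
      (hdeg _ hz.snd_lt) hz.snd_untouched hze hk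
  have hmid : ∀ {a b a' b' : α}, a ∈ S → b ∈ S → a ≠ b → a' ∈ S → b' ∈ S → a' ≠ b' → e ∈ Q a b →
      e ∈ Q a' b' → s(a, b) = s(a', b') := fun h1 h2 h3 h4 h5 h6 h7 h8 =>
    hQ.eq_of_mem _ h1 _ h2 h3 _ h4 _ h5 h6 e h7 h8
  have bx1 := hBS _ hx.fst_lt
  have bx2 := hBS _ hx.snd_lt
  have by1 := hBS _ hy.fst_lt
  have by2 := hBS _ hy.snd_lt
  have nx1 := hx.fst_ne _ hx.fst_lt
  have nx2 := hx.snd_ne _ hx.snd_lt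
  have ny1 := hy.fst_ne _ hy.fst_lt
  have ny2 := hy.snd_ne _ hy.snd_lt
  rcases he with he | he | he <;> rcases he' with he' | he' | he'
  · exact hxy.ne (hr.middle_disjoint hx.lt hy.lt he he')
  · exact hfst y hy he' _ hx.lt he
  · exact hsnd y hy he' _ hx.lt he
  · exact hfst x hx he _ hy.lt he'
  · exact hxy.fst_fst (hmid bx1 (hroot x hx).1 nx1 by1 (hroot y hy).1 ny1 he he')
  · exact hxy.fst_snd (hmid bx1 (hroot x hx).1 nx1 by2 (hroot y hy).2 ny2 he he')
  · exact hsnd x hx he _ hy.lt he'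
  · exact hxy.snd_fst (hmid bx2 (hroot x hx).2 nx2 by1 (hroot y hy).1 ny1 he he')
  · exact hxy.snd_snd (hmid bx2 (hroot x hx).2 nx2 by2 (hroot y hy).2 ny2 he he')

/-- The length is even plus odd plus even. Terminality separates the links from the odd trail. The
two links belong to different pairs, since B i is neither the far root nor B j. -/
lemma isTrail_branchTrail (hQ : Linkage G S Q) (hr : r.Valid G S Q c p m q)
    (ht : r.Terminal S Q c m q) (hBS : ∀ i < t, B i ∈ S)
    (hdeg : ∀ i < t, incidences r.root r.other (2 * m) (B i) < q) {x : (ℕ × ℕ) × ℕ}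
    (hx : r.Admissible m t B x) (hne : B x.1.1 ≠ B x.1.2) :
    IsTrail G (B x.1.1) (r.branchTrail Q c B x) (B x.1.2) ∧ Odd (r.branchTrail Q c B x).length := by
  have r1 := hr.root_mem (2 * x.2) (by have := hx.lt; omega)
  have r2 := hr.root_mem (2 * x.2 + 1) (by have := hx.lt; omega)
  have b1 := hBS _ hx.fst_lt
  have b2 := hBS _ hx.snd_lt
  have n1 := hx.fst_ne _ hx.fst_lt
  have n2 := hx.snd_ne _ hx.snd_lt
  have t1 := hQ.isTrail _ b1 _ r1 n1
  have t2 := hQ.isTrail _ r2 _ b2 n2.symm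
  have hodd : Odd (r.branchTrail Q c B x).length := by
    rw [branchTrail, List.length_append, List.length_append]
    exact ((hQ.even _ b1 _ r1 n1).add_odd (hr.middle_odd hx.lt)).add_even
      (hQ.even _ r2 _ b2 n2.symm)
  refine ⟨⟨fun h => ?_, ?_, ?_⟩, hodd⟩
  · simp [h] at hodd
  · have hd2 : ∀ e ∈ Q (r.root (2 * x.2 + 1)) (B x.1.2), e ∈ Q (B x.1.2) (r.root (2 * x.2 + 1)) :=
      hQ.symm _ r2 _ b2 n2.symm
    rw [branchTrail, List.nodup_append', List.nodup_append']
    refine ⟨⟨t1.2.1, hr.middle_nodup hQ hx.lt, fun e he he' => ?_⟩, t2.2.1, fun e he he' => ?_⟩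
    · exact ht.notMem_middle hr hQ b1 r1 n1 (hdeg _ hx.fst_lt) hx.fst_untouched he hx.lt he'
    · rcases List.mem_append.1 he with he | he
      · have := hQ.eq_of_mem _ b1 _ r1 n1 _ r2 _ b2 n2.symm e he he'
        rcases Sym2.eq_iff.1 this with h | h
        · exact hx.snd_ne _ hx.fst_lt h.1
        · exact hne h.1
      · exact ht.notMem_middle hr hQ b2 r2 n2 (hdeg _ hx.snd_lt) hx.snd_untouched (hd2 e he')
          hx.lt he
  · exact isWalk_append.2 ⟨_, isWalk_append.2 ⟨_, t1.2.2, hr.middle_isWalk hx.lt⟩, t2.2.2⟩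

/-- Holds for every selection whose index pairs are those of `pairList t`, no matter how it was
found. The conclusion records the vertices and the list of branch trails so that the output of the
program can be compared with the immersion. -/
theorem exists_totallyOdd (hQ : Linkage G S Q) (hr : r.Valid G S Q c p m q)
    (ht : r.Terminal S Q c m q) (hSG : ∀ s ∈ S, s ∈ V(G)) (hBS : ∀ i < t, B i ∈ S)
    (hB : ∀ i < t, ∀ j < t, B i = B j → i = j)
    (hdeg : ∀ i < t, incidences r.root r.other (2 * m) (B i) < q) {sel : List ((ℕ × ℕ) × ℕ)}
    (hsel : r.Selection m t B sel) (hkeys : sel.map Prod.fst = pairList t) :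
    ∃ ψ : Immersion (completeK t) G, ψ.TotallyOdd ∧ (∀ i, ψ.vertexMap i = B i) ∧
      (pairs t).map ψ.edgeMap = sel.map (r.branchTrail Q c B) := by
  classical
  have hlen : (pairs t).length = sel.length := by
    rw [length_pairs, ← hkeys, List.length_map]
  have hkey : ∀ n (h : n < sel.length), ∃ h' : n < (pairs t).length,
      ∃ i j : Fin t, i < j ∧ (sel[n].1.1 = i ∧ sel[n].1.2 = j) ∧ (pairs t)[n] = s(i, j) := by
    intro n h
    have h2 : n < (pairList t).length := by rwa [← hkeys, List.length_map]
    have h3 : (pairList t)[n] = sel[n].1 := by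
      have := List.getElem_of_eq hkeys (i := n) (by simpa using h)
      simpa using this.symm
    have h4 := mem_pairList.1 (List.getElem_mem h2)
    rw [h3] at h4
    refine ⟨hlen ▸ h, ⟨sel[n].1.1, h4.1.trans h4.2⟩, ⟨sel[n].1.2, h4.2⟩, h4.1, ⟨rfl, rfl⟩, ?_⟩
    exact pairs_getElem _ h2 (by rw [h3]) (by rw [h3])
  -- An edge of the complete graph is sent to the branch trail at its position in `pairs t`; the
  -- default value occurs only for diagonal elements, which are not edges.
  let f : Sym2 (Fin t) → List β := fun e => (sel.map (r.branchTrail Q c B)).getD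
    ((pairs t).idxOf e) []
  have hf : ∀ n (h : n < (pairs t).length), f (pairs t)[n] =
      r.branchTrail Q c B (sel[n]'(hlen ▸ h)) := by
    intro n h
    simp only [f, (nodup_pairs t).idxOf_getElem n h]
    rw [List.getD_eq_getElem _ _ (by simpa using hlen ▸ h)]
    simp
  have hidx : ∀ e ∈ E(completeK t), ∃ n, ∃ h : n < sel.length, ∃ h' : n < (pairs t).length,
      e = (pairs t)[n] ∧ f e = r.branchTrail Q c B sel[n] := by
    intro e he
    obtain ⟨n, hn, rfl⟩ := List.mem_iff_getElem.1 (mem_edgeSet_completeK.1 he)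
    exact ⟨n, hlen ▸ hn, hn, rfl, hf n hn⟩
  have htr : ∀ n (h : n < sel.length),
      IsTrail G (B sel[n].1.1) (r.branchTrail Q c B sel[n]) (B sel[n].1.2) ∧
        Odd (r.branchTrail Q c B sel[n]).length := by
    intro n h
    obtain ⟨h', i, j, hij, ⟨hi, hj⟩, -⟩ := hkey n h
    have hadm := hsel.admissible _ (List.getElem_mem h)
    refine isTrail_branchTrail hQ hr ht hBS hdeg hadm fun hb => ?_
    have := hB _ hadm.fst_lt _ hadm.snd_lt hb
    omega
  refine ⟨⟨fun i => B i, f, fun i _ => hSG _ (hBS _ i.2),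
    fun i _ j _ h => Fin.ext (hB _ i.2 _ j.2 h), ?_, ?_⟩, ?_, fun i => rfl, ?_⟩
  · intro e he
    obtain ⟨n, h, h', rfl, hfe⟩ := hidx e he
    obtain ⟨_, i, j, hij, ⟨hi, hj⟩, hp⟩ := hkey n h
    refine ⟨i, j, ?_, ?_⟩
    · rw [hp]; exact completeK_isLink hij.ne
    · rw [hfe, ← hi, ← hj]; exact (htr n h).1
  · intro e he e' he' hne
    obtain ⟨n, h, h', rfl, hfe⟩ := hidx e he
    obtain ⟨n', g, g', rfl, hge⟩ := hidx e' he'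
    rw [hfe, hge]
    have hP := List.pairwise_iff_getElem.1 hsel.pairwise
    have hadm := hsel.admissible _ (List.getElem_mem h)
    have hadm' := hsel.admissible _ (List.getElem_mem g)
    rcases lt_trichotomy n n' with hlt | heq | hlt
    · exact branchTrail_disjoint hQ hr ht hBS hdeg hadm hadm' (hP n n' h g hlt)
    · subst heq; exact absurd rfl hne
    · exact (branchTrail_disjoint hQ hr ht hBS hdeg hadm' hadm (hP n' n g h hlt)).symm
  · intro e he
    obtain ⟨n, h, h', rfl, hfe⟩ := hidx e he
    simp only
    rw [hfe]; exact (htr n h).2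
  · refine List.ext_getElem (by simpa using hlen) fun n h1 h2 => ?_
    simp only [List.getElem_map]
    exact hf n (by simpa using h1)

end

end Routing

end BranchTrails

section Setup

variable {α : Type u} {β : Type v} {G H : Graph α β}

/-! ### The linkage of an immersion of a complete graph -/

lemma Immersion.vertexMap_inj {k : ℕ} (φ : Immersion (completeK k) G) {i j : Fin k}
    (h : φ.vertexMap i = φ.vertexMap j) : i = j :=
  φ.injOn (by simp [completeK]) (by simp [completeK]) h

/-- The branch vertices, in order. -/
def Immersion.branchList {k : ℕ} (φ : Immersion (completeK k) G) : List α :=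
  (List.finRange k).map φ.vertexMap

lemma Immersion.mem_branchList {k : ℕ} {φ : Immersion (completeK k) G} {s : α} :
    s ∈ φ.branchList ↔ ∃ i, φ.vertexMap i = s := by
  simp [branchList]

lemma Immersion.branchVertices_eq {k : ℕ} (φ : Immersion (completeK k) G) :
    φ.branchVertices = {s | s ∈ φ.branchList} := by
  ext s
  simp only [branchVertices, Set.mem_image, Set.mem_ofPred_eq, mem_branchList]
  exact ⟨fun ⟨i, _, hi⟩ => ⟨i, hi⟩, fun ⟨i, hi⟩ => ⟨i, by simp [completeK], hi⟩⟩

lemma Immersion.mem_vertexSet_of_mem_branchList {k : ℕ} (φ : Immersion (completeK k) G) :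
    ∀ s ∈ φ.branchList, s ∈ V(G) := by
  intro s hs
  obtain ⟨i, rfl⟩ := mem_branchList.1 hs
  exact φ.mapsTo (by simp [completeK])

lemma Immersion.nodup_branchList {k : ℕ} (φ : Immersion (completeK k) G) : φ.branchList.Nodup :=
  (List.nodup_finRange k).map fun _ _ h => φ.vertexMap_inj h

open scoped Classical in
/-- The branch trail between two branch vertices, oriented from the first one to the second one. -/
noncomputable def Immersion.orientedTrail {k : ℕ} (φ : Immersion (completeK k) G) (a b : α) :
    List β :=
  if h : ∃ x : Fin k × Fin k, φ.vertexMap x.1 = a ∧ φ.vertexMap x.2 = b then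
    if IsWalk G a (φ.edgeMap s(h.choose.1, h.choose.2)) b then
      φ.edgeMap s(h.choose.1, h.choose.2)
    else (φ.edgeMap s(h.choose.1, h.choose.2)).reverse
  else []

open scoped Classical in
lemma Immersion.orientedTrail_vertexMap {k : ℕ} (φ : Immersion (completeK k) G) (i j : Fin k) :
    φ.orientedTrail (φ.vertexMap i) (φ.vertexMap j) =
      if IsWalk G (φ.vertexMap i) (φ.edgeMap s(i, j)) (φ.vertexMap j) then φ.edgeMap s(i, j)
      else (φ.edgeMap s(i, j)).reverse := by
  have h : ∃ x : Fin k × Fin k, φ.vertexMap x.1 = φ.vertexMap i ∧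
    φ.vertexMap x.2 = φ.vertexMap j := ⟨(i, j), rfl, rfl⟩
  have h1 : h.choose.1 = i := φ.vertexMap_inj h.choose_spec.1
  have h2 : h.choose.2 = j := φ.vertexMap_inj h.choose_spec.2
  rw [orientedTrail, dif_pos h, h1, h2]

lemma Immersion.mem_orientedTrail {k : ℕ} (φ : Immersion (completeK k) G) {i j : Fin k} {e : β} :
    e ∈ φ.orientedTrail (φ.vertexMap i) (φ.vertexMap j) ↔ e ∈ φ.edgeMap s(i, j) := by
  rw [orientedTrail_vertexMap]
  split_ifs <;> simp

lemma mem_edgeSet_completeK_mk {k : ℕ} {i j : Fin k} (h : i ≠ j) : s(i, j) ∈ E(completeK k) :=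
  (completeK_isLink h).edge_mem

lemma Immersion.isTrail_or {k : ℕ} (φ : Immersion (completeK k) G) {i j : Fin k} (h : i ≠ j) :
    IsTrail G (φ.vertexMap i) (φ.edgeMap s(i, j)) (φ.vertexMap j) ∨
      IsTrail G (φ.vertexMap j) (φ.edgeMap s(i, j)) (φ.vertexMap i) := by
  obtain ⟨a, b, hab, ht⟩ := φ.isTrail _ (mem_edgeSet_completeK_mk h)
  rcases (completeK_isLink h).eq_and_eq_or_eq_and_eq hab with ⟨rfl, rfl⟩ | ⟨rfl, rfl⟩
  · exact Or.inl ht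
  · exact Or.inr ht

/-- Reversing a trail changes neither its parity nor its set of edges, so orientation may be chosen
freely for each ordered pair. -/
lemma Immersion.linkage {k : ℕ} (φ : Immersion (completeK k) G) (hφ : φ.TotallyEven) :
    Linkage G φ.branchList φ.orientedTrail := by
  have key : ∀ {i j : Fin k}, φ.vertexMap i ≠ φ.vertexMap j → i ≠ j :=
    fun h h' => h (congrArg _ h')
  refine ⟨fun u hu v hv huv => ?_, fun u hu v hv huv => ?_, fun u hu v hv huv e he => ?_,
    fun u hu v hv huv u' hu' v' hv' huv' e he he' => ?_⟩ <;> rw [mem_branchList] at hu hv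
  · obtain ⟨i, rfl⟩ := hu
    obtain ⟨j, rfl⟩ := hv
    rw [orientedTrail_vertexMap]
    rcases φ.isTrail_or (key huv) with h | h
    · rwa [if_pos h.2.2]
    -- Some lists, such as a single edge, can be read from both ends as they stand. They are not
    -- reversed, and they are trails in the required direction all the same.
    · split_ifs with h'
      · exact ⟨h.1, h.2.1, h'⟩
      · exact ⟨by simpa using h.1, by simpa using h.2.1, h.2.2.reverse⟩
  · obtain ⟨i, rfl⟩ := hu
    obtain ⟨j, rfl⟩ := hv
    rw [orientedTrail_vertexMap]
    have := hφ _ (mem_edgeSet_completeK_mk (key huv))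
    split_ifs
    · exact this
    · simpa using this
  · obtain ⟨i, rfl⟩ := hu
    obtain ⟨j, rfl⟩ := hv
    rw [mem_orientedTrail] at he ⊢
    rwa [Sym2.eq_swap]
  · rw [mem_branchList] at hu' hv'
    obtain ⟨i, rfl⟩ := hu
    obtain ⟨j, rfl⟩ := hv
    obtain ⟨i', rfl⟩ := hu'
    obtain ⟨j', rfl⟩ := hv'
    rw [mem_orientedTrail] at he he'
    have : s(i, j) = s(i', j') := by
      by_contra hne
      exact φ.disjoint _ (mem_edgeSet_completeK_mk (key huv)) _ (mem_edgeSet_completeK_mk (key huv'))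
        hne he he'
    simpa using congrArg (Sym2.map φ.vertexMap) this

/-! ### The odd trails given by odd circuits through the apex -/

variable {S : Set α} {q : ℕ} {x : α}

/-- An edge of G incident with x would put x into V(G). -/
lemma IsApexExtension.exists_of_inc (h : IsApexExtension G S q x H) {e : β} (he : H.Inc e x) :
    ∃ s ∈ S, H.IsLink e x s := by
  refine h.new_edge e he.edge_mem fun heG => h.notMem ?_
  exact ((h.le.inc_congr heG).2 he).vertex_mem

lemma IsApexExtension.mem_of_isLink (h : IsApexExtension G S q x H) {e : β} {s : α}
    (he : H.IsLink e x s) : s ∈ S := by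
  obtain ⟨s', hs', h'⟩ := h.exists_of_inc he.inc_left
  exact he.right_unique h' ▸ hs'

lemma IsApexExtension.isLink_of_not_inc (h : IsApexExtension G S q x H) {e : β} {a b : α}
    (he : H.IsLink e a b) (hx : ¬ H.Inc e x) : G.IsLink e a b := by
  by_cases heG : e ∈ E(G)
  · exact (h.le.isLink_iff heG).2 he
  · obtain ⟨s, -, hs⟩ := h.new_edge e he.edge_mem heG
    exact absurd hs.inc_left hx

/-- The definition of an x-circuit does not say where the circuit starts; it must start at x. A
single edge that hits x would be a loop at x, which does not exist, so by parity there are at least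
three edges. If the common end were not x, then x could only be hit by the first or the last edge,
at its inner end, and the neighbouring internal edge would also be incident with x. -/
lemma IsCircuitAt.isWalk (h : IsApexExtension G S q x H) (hS : S ⊆ V(G)) {es : List β}
    (hes : IsCircuitAt H x es) (hodd : Odd es.length) :
    3 ≤ es.length ∧ es.Nodup ∧ IsWalk H x es x ∧
      ∀ i (hi : i < es.length), 1 ≤ i → i + 1 < es.length → ¬ H.Inc es[i] x := by
  obtain ⟨⟨a, hne, hnd, hw⟩, ⟨e, he, hex⟩, hint⟩ := hes
  have hint' : ∀ i (hi : i < es.length), 1 ≤ i → i + 1 < es.length → ¬ H.Inc es[i] x := by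
    intro i hi h1 h2
    refine hint _ (List.mem_iff_getElem.2 ⟨i - 1, by simp; omega, ?_⟩)
    simp only [List.getElem_dropLast, List.getElem_tail]
    congr 1; omega
  have h3 : 3 ≤ es.length := by
    by_contra hlt
    have hlen : es.length = 1 := by
      rcases hodd with ⟨d, hd⟩; omega
    obtain ⟨f, rfl⟩ := List.length_eq_one_iff.1 hlen
    obtain rfl := List.mem_singleton.1 he
    rw [isWalk_singleton] at hw
    have hxa : x = a := by rcases hex.eq_or_eq_of_isLink hw with h | h <;> exact h
    subst hxa
    exact h.notMem (hS (h.mem_of_isLink hw))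
  refine ⟨h3, hnd, ?_, hint'⟩
  suffices hxa : x = a by subst hxa; exact hw
  by_contra hxa
  -- the first and the last edge
  have hfirst : ¬ H.Inc es[0] x := by
    intro hinc
    obtain ⟨w, hw2⟩ := hw.exists_take 2
    obtain ⟨b, hb1, hb2⟩ := (isWalk_take_succ (show 1 < es.length by omega)).1 hw2
    obtain ⟨b', hb3, hb4⟩ := (isWalk_take_succ (show 0 < es.length by omega)).1 hb1
    obtain rfl : a = b' := by simpa [IsWalk] using hb3.2
    obtain rfl : x = b := hinc.eq_of_isLink_of_ne_left hb4 hxa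
    exact hint' 1 (by omega) le_rfl (by omega) hb2.inc_left
  have hlast : ¬ H.Inc (es[es.length - 1]) x := by
    intro hinc
    have hfull : es.take (es.length - 1 + 1) = es := by
      rw [Nat.sub_add_cancel (by omega), List.take_length]
    rw [← hfull] at hw
    obtain ⟨b, hb1, hb2⟩ := (isWalk_take_succ (show es.length - 1 < es.length by omega)).1 hw
    obtain rfl : x = b := hinc.eq_of_isLink_of_ne_left hb2.symm hxa
    rw [show es.length - 1 = es.length - 2 + 1 by omega] at hb1
    obtain ⟨b', hb3, hb4⟩ := (isWalk_take_succ (show es.length - 2 < es.length by omega)).1 hb1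
    exact hint' _ (by omega) (by omega) (by omega) hb4.inc_right
  obtain ⟨i, hi, rfl⟩ := List.mem_iff_getElem.1 he
  rcases Nat.eq_zero_or_pos i with rfl | hpos
  · exact hfirst hex
  · rcases Nat.lt_or_ge (i + 1) es.length with h' | h'
    · exact hint' i hi hpos h' hex
    · obtain rfl : i = es.length - 1 := by omega
      exact hlast hex

/-- The initial routing has empty arms, and its cores are the circuits without their first and last
edges. Position `off k + i` stands for edge i of circuit k, so the same statement serves the
abstract proof and the memory layout of the program. -/
theorem Routing.valid_of_packing {L : List α} {Q : α → α → List β} {C : List (List β)}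
    {r : Routing α} {c : ℕ → β} {p : ℕ → α} {off : ℕ → ℕ}
    (h : IsApexExtension G {s | s ∈ L} q x H) (hL : ∀ s ∈ L, s ∈ V(G))
    (hC : IsOddCircuitPacking H x C)
    (hc : ∀ k (hk : k < C.length) i (hi : i < C[k].length), c (off k + i) = C[k][i])
    (hp : ∀ k (hk : k < C.length) i, i ≤ C[k].length → IsWalk H x (C[k].take i) (p (off k + i)))
    (hpos : ∀ k (hk : k < C.length), r.pos (2 * k) = off k + 1 ∧
      r.pos (2 * k + 1) = off k + (C[k].length - 1))
    (hroot : ∀ σ < 2 * C.length, r.root σ = p (r.pos σ))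
    (hlen : ∀ σ < 2 * C.length, r.len σ = 0) :
    r.Valid G L Q c p C.length q := by
  have hcirc := fun k (hk : k < C.length) =>
    (hC.1 _ (List.getElem_mem hk)).1.isWalk h hL (hC.1 _ (List.getElem_mem hk)).2
  have hlink : ∀ k (hk : k < C.length) i (hi : i < C[k].length),
      H.IsLink C[k][i] (p (off k + i)) (p (off k + i + 1)) := by
    intro k hk i hi
    obtain ⟨w, hw1, hw2⟩ := (isWalk_take_succ hi).1 (hp k hk (i + 1) hi)
    rwa [(hp k hk i hi.le).right_unique hw1]
  have hcinj : ∀ k (hk : k < C.length) i (hi : i < C[k].length) k' (hk' : k' < C.length) i'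
      (hi' : i' < C[k'].length), C[k][i] = C[k'][i'] → k = k' ∧ i = i' := by
    intro k hk i hi k' hk' i' hi' heq
    have hP := List.pairwise_iff_getElem.1 hC.2
    rcases lt_trichotomy k k' with hlt | rfl | hlt
    · exact absurd (heq ▸ List.getElem_mem hi') (hP k k' hk hk' hlt (List.getElem_mem hi))
    · exact ⟨rfl, ((hcirc k hk).2.1.getElem_inj_iff).1 heq⟩
    · exact absurd (heq ▸ List.getElem_mem hi) (hP k' k hk' hk hlt (List.getElem_mem hi'))
  have hcore : ∀ k (hk : k < C.length) z, r.InCore k z →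
      ∃ i, ∃ hi : i < C[k].length, 1 ≤ i ∧ i + 1 < C[k].length ∧ z = off k + i := by
    rintro k hk z ⟨h1, h2⟩
    rw [(hpos k hk).1] at h1; rw [(hpos k hk).2] at h2
    exact ⟨z - off k, by omega, by omega, by omega, by omega⟩
  -- Root σ is the end in S of an edge at x: the first edge of circuit σ / 2 if σ is even, the last
  -- one if σ is odd.
  have hend : ∀ σ < 2 * C.length, ∃ hk : σ / 2 < C.length, ∃ i, ∃ hi : i < C[σ / 2].length,
      H.IsLink C[σ / 2][i] x (r.root σ) ∧
        (σ % 2 = 0 ∧ i = 0 ∨ σ % 2 = 1 ∧ i = C[σ / 2].length - 1) := by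
    intro σ hσ
    have hk : σ / 2 < C.length := by omega
    have h3 := (hcirc _ hk).1
    rcases Nat.mod_two_eq_zero_or_one σ with h0 | h1
    · refine ⟨hk, 0, by omega, ?_, Or.inl ⟨h0, rfl⟩⟩
      have h4 := hlink _ hk 0 (by omega)
      have h5 := hp _ hk 0 (by omega)
      rw [List.take_zero] at h5
      rw [hroot σ hσ]
      conv in r.pos σ => rw [show σ = 2 * (σ / 2) by omega]
      rw [(hpos _ hk).1]
      rwa [← h5.2] at h4
    · refine ⟨hk, C[σ / 2].length - 1, by omega, ?_, Or.inr ⟨h1, rfl⟩⟩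
      have h4 := hlink _ hk (C[σ / 2].length - 1) (by omega)
      have h5 := hp _ hk (C[σ / 2].length) le_rfl
      rw [List.take_length] at h5
      rw [hroot σ hσ]
      conv in r.pos σ => rw [show σ = 2 * (σ / 2) + 1 by omega]
      rw [(hpos _ hk).2]
      rw [add_assoc, Nat.sub_add_cancel (by omega), ← (hcirc _ hk).2.2.1.right_unique h5] at h4
      exact h4.symm
  have hrootL : ∀ σ < 2 * C.length, r.root σ ∈ L := by
    intro σ hσ
    obtain ⟨_, i, _, h1, _⟩ := hend σ hσ
    exact h.mem_of_isLink h1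
  have harm : ∀ σ < 2 * C.length, r.arm Q σ = [] := fun σ hσ => by simp [arm, hlen σ hσ]
  refine ⟨fun k hk => ?_, fun k hk z hz => ?_, fun k hk z hz k' hk' z' hz' heq => ?_, hrootL,
    fun σ hσ => Or.inl (hlen σ hσ), fun σ hσ => ?_, fun σ hσ τ hτ e he => ?_,
    fun σ hσ k hk z hz he => ?_, fun k hk => ?_, fun s => ?_⟩
  · have := (hcirc k hk).1
    rw [(hpos k hk).1, (hpos k hk).2]; omega
  · obtain ⟨i, hi, h1, h2, rfl⟩ := hcore k hk z hz
    rw [hc k hk i hi]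
    exact h.isLink_of_not_inc (hlink k hk i hi) ((hcirc k hk).2.2.2 i hi h1 h2)
  · obtain ⟨i, hi, h1, h2, rfl⟩ := hcore k hk z hz
    obtain ⟨i', hi', h1', h2', rfl⟩ := hcore k' hk' z' hz'
    rw [hc k hk i hi, hc k' hk' i' hi'] at heq
    obtain ⟨rfl, rfl⟩ := hcinj k hk i hi k' hk' i' hi' heq
    exact ⟨rfl, rfl⟩
  · rw [harm σ hσ]
    exact ⟨hL _ (hrootL σ hσ), hroot σ hσ⟩
  · simp [harm σ hσ] at he
  · simp [harm σ hσ] at he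
  · obtain ⟨d, hd⟩ := (hC.1 _ (List.getElem_mem hk)).2
    have := (hcirc k hk).1
    rw [hlen _ (by omega), hlen _ (by omega), (hpos k hk).1, (hpos k hk).2]
    exact ⟨d - 1, by omega⟩
  -- The roots at s correspond to distinct edges between x and s, of which there are q. They are
  -- distinct because the circuits are disjoint and the first and last edges of a circuit differ.
  · classical
    by_cases hs : s ∈ L
    swap
    · rw [Nat.count_eq_card_filter_range, Finset.filter_eq_empty_iff.2]
      · simp
      · intro σ hσ hσs
        exact hs (hσs ▸ hrootL σ (Finset.mem_range.1 hσ))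
    have hmul := h.multiplicity s hs
    choose hk i hi hl hpar using hend
    let f : ℕ → β := fun σ => if hσ : σ < 2 * C.length then (C[σ / 2]'(hk σ hσ))[i σ hσ]'(hi σ hσ)
      else c 0
    have : ((Finset.range (2 * C.length)).filter fun σ => r.root σ = s).card ≤ (q : ℕ∞) := by
      rw [← hmul, ← Set.encard_coe_eq_coe_finsetCard]
      refine Set.encard_le_encard_of_injOn (f := f) (fun σ hσ => ?_) fun σ hσ τ hτ heq => ?_
      · simp only [Finset.coe_filter, Finset.mem_range, Set.mem_ofPred_eq] at hσ ⊢
        simp only [f, dif_pos hσ.1]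
        exact hσ.2 ▸ hl σ hσ.1
      · simp only [Finset.coe_filter, Finset.mem_range, Set.mem_ofPred_eq] at hσ hτ
        simp only [f, dif_pos hσ.1, dif_pos hτ.1] at heq
        obtain ⟨h1, h2⟩ := hcinj _ (hk σ hσ.1) _ (hi σ hσ.1) _ (hk τ hτ.1) _ (hi τ hτ.1) heq
        have h3 := (hcirc _ (hk σ hσ.1)).1
        have h4 := hpar σ hσ.1
        have h5 := hpar τ hτ.1
        simp only [← h1] at h5
        omega
    rw [Nat.count_eq_card_filter_range]
    exact_mod_cast this

/-- The circuits are laid out in blocks of a common length M, which supplies the sequences of edges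
and vertices required by `Routing.valid_of_packing`. A terminal routing and a greedy selection then
finish the proof. -/
theorem exists_totallyOdd_immersion {t : ℕ} {C : List (List β)}
    (φ : Immersion (completeK (1400 * t)) G) (ht : 49 ≤ t) (hφ : φ.TotallyEven)
    (hH : IsApexExtension G φ.branchVertices (20 * t) x H) (hC : IsOddCircuitPacking H x C)
    (hlen : C.length = 3500 * t ^ 2) :
    ∃ ψ : Immersion (completeK t) G, ψ.TotallyOdd := by
  classical
  rw [φ.branchVertices_eq] at hH
  have hL := φ.mem_vertexSet_of_mem_branchList
  have hQ := φ.linkage hφ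
  have hnonempty : 0 < C.length := by rw [hlen]; positivity
  have hcirc := fun k (hk : k < C.length) =>
    (hC.1 _ (List.getElem_mem hk)).1.isWalk hH hL (hC.1 _ (List.getElem_mem hk)).2
  -- Any edge will do as the value at positions that belong to no circuit.
  have e0 : β := C[0][0]'(by have := (hcirc 0 hnonempty).1; omega)
  -- Longer than every circuit, so that even the position after the last edge stays within its
  -- block.
  let M := C.flatten.length + 1
  have hM : ∀ k (hk : k < C.length), C[k].length < M := fun k hk =>
    Nat.lt_succ_of_le (List.Sublist.length_le (List.sublist_flatten_of_mem (List.getElem_mem hk)))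
  have hMpos : 0 < M := Nat.succ_pos _
  let c : ℕ → β := fun z => (C.getD (z / M) []).getD (z % M) e0
  let p : ℕ → α := fun z => if h : ∃ w, IsWalk H x ((C.getD (z / M) []).take (z % M)) w then
    h.choose else x
  have hdiv : ∀ k i, i < M → (M * k + i) / M = k ∧ (M * k + i) % M = i := fun k i hi =>
    ⟨by rw [Nat.mul_add_div hMpos, Nat.div_eq_of_lt hi, add_zero],
      by rw [Nat.mul_add_mod, Nat.mod_eq_of_lt hi]⟩
  let pos : ℕ → ℕ := fun σ => M * (σ / 2) +
    if σ % 2 = 0 then 1 else (C.getD (σ / 2) []).length - 1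
  -- All arms have length zero, so the second components of the pairs are arbitrary.
  let r : Routing α := ⟨fun σ => p (pos σ), fun _ => x, fun _ => 0, pos⟩
  have hr : r.Valid G φ.branchList φ.orientedTrail c p C.length (20 * t) := by
    refine Routing.valid_of_packing (off := fun k => M * k) hH hL hC ?_ ?_ ?_ (fun _ _ => rfl)
      (fun _ _ => rfl)
    · intro k hk i hi
      have := hdiv k i (hi.trans (hM k hk))
      simp only [c, this.1, this.2]
      simp [hk, hi]
    · intro k hk i hi
      have := hdiv k i (lt_of_le_of_lt hi (hM k hk))
      have hw : ∃ w, IsWalk H x (C[k].take i) w := (hcirc k hk).2.2.1.exists_take i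
      simp only [p, this.1, this.2, List.getD_eq_getElem _ _ hk, dif_pos hw]
      exact hw.choose_spec
    · intro k hk
      have h1 : (2 * k + 1) / 2 = k := by omega
      simp only [r, pos]
      simp [hk, h1]
  obtain ⟨r', hr', hterm⟩ := hr.exists_terminal hQ
  have hfilter := Routing.le_length_filter_incidences (S := φ.branchList) r'.root r'.other
    (t := t) (N := 2 * C.length) φ.nodup_branchList (by simp [Immersion.branchList])
    (by rw [hlen]; ring)
  set F := φ.branchList.filter fun s => incidences r'.root r'.other (2 * C.length) s < 20 * t
    with hF
  let B : ℕ → α := fun i => F.getD i x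
  have hBF : ∀ i (hi : i < t), B i = F[i]'(by omega) := fun i hi =>
    List.getD_eq_getElem _ _ _
  have hBmem : ∀ i < t, B i ∈ φ.branchList ∧
      incidences r'.root r'.other (2 * C.length) (B i) < 20 * t := by
    intro i hi
    have := List.getElem_mem (show i < F.length by omega)
    rw [← hBF i hi, hF, List.mem_filter, decide_eq_true_eq] at this
    exact this
  have hBinj : ∀ i < t, ∀ j < t, B i = B j → i = j := by
    intro i hi j hj hij
    rw [hBF i hi, hBF j hj] at hij
    exact ((φ.nodup_branchList.filter _).getElem_inj_iff).1 hij
  -- Greedy selection, by induction along the prefixes of the list of index pairs.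
  have hselect : ∀ l, l <+: pairList t → ∃ sel, r'.Selection C.length t B sel ∧
      sel.map Prod.fst = l := by
    intro l
    induction l using List.reverseRecOn with
    | nil => exact fun _ => ⟨[], ⟨by simp, by simp⟩, rfl⟩
    | append_singleton l y ih =>
      intro hl
      obtain ⟨sel, hsel, hkeys⟩ := ih ((List.prefix_append l [y]).trans hl)
      have hy := mem_pairList.1 (hl.subset (by simp : y ∈ l ++ [y]))
      have hnd := (nodup_pairList t).sublist ((List.prefix_append l [y]).trans hl).sublist
      obtain ⟨k, hk1, hk2⟩ := Routing.exists_admissible hr'.count_le hlen hBinj hsel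
        (fun i hi => (hBmem i hi).2.le) (hkeys ▸ hnd) (by
          rw [← List.length_map (f := Prod.fst), hkeys, sq]
          exact (((List.prefix_append l [y]).trans hl).length_le).trans (length_pairList_le t))
        (hy.1.trans hy.2) hy.2
      exact ⟨sel ++ [(y, k)], hsel.concat hk1 hk2, by simp [hkeys]⟩
  obtain ⟨sel, hsel, hkeys⟩ := hselect _ List.prefix_rfl
  obtain ⟨ψ, hψ, -⟩ := Routing.exists_totallyOdd hQ hr' hterm hL (fun i hi => (hBmem i hi).1) hBinj
    (fun i hi => (hBmem i hi).2) hsel hkeys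
  exact ⟨ψ, hψ⟩

end Setup

/-! ### Reasoning about programs -/

section Logic

@[simp] lemma Memory.setReg_reg (s : Memory) (r n r' : ℕ) :
    (s.setReg r n).reg r' = if r' = r then n else s.reg r' := by
  simp [Memory.setReg, Function.update_apply]

@[simp] lemma Memory.setReg_arr (s : Memory) (r n : ℕ) : (s.setReg r n).arr = s.arr := rfl

@[simp] lemma Memory.setArr_reg (s : Memory) (a i n : ℕ) : (s.setArr a i n).reg = s.reg := rfl

lemma Memory.setArr_arr (s : Memory) (a i n a' : ℕ) :
    (s.setArr a i n).arr a' = if a' = a then Function.update (s.arr a) i n else s.arr a' := by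
  simp [Memory.setArr, Function.update_apply]

lemma Memory.setArr_arr_apply (s : Memory) (a i n a' j : ℕ) :
    (s.setArr a i n).arr a' j = if a' = a ∧ j = i then n else s.arr a' j := by
  rw [setArr_arr]
  by_cases h : a' = a
  · subst h; by_cases h' : j = i <;> simp [h']
  · simp [h]

/-- Started on `s`, the program halts within `c` units of time, and `post` holds afterwards. -/
def Comp (p : Program) (s : Memory) (c : ℕ) (post : Memory → Prop) : Prop :=
  ∃ s' n, Runs p s s' n ∧ n ≤ c ∧ post s'

variable {p q : Program} {s : Memory} {c c₁ c₂ : ℕ} {post post' : Memory → Prop} {b : Test}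

lemma Comp.mono (h : Comp p s c₁ post) (hc : c₁ ≤ c₂) (hpost : ∀ s', post s' → post' s') :
    Comp p s c₂ post' := by
  obtain ⟨s', n, h1, h2, h3⟩ := h
  exact ⟨s', n, h1, h2.trans hc, hpost s' h3⟩

lemma Comp.seq {mid : Memory → Prop} (hp : Comp p s c₁ mid)
    (hq : ∀ s', mid s' → Comp q s' c₂ post) : Comp (.seq p q) s (c₁ + c₂) post := by
  obtain ⟨s', n, h1, h2, h3⟩ := hp
  obtain ⟨s'', n', h4, h5, h6⟩ := hq s' h3
  exact ⟨s'', n + n', .seq h1 h4, by omega, h6⟩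

lemma Comp.ite (hp : b.Holds s → Comp p s c post) (hq : ¬ b.Holds s → Comp q s c post) :
    Comp (.ite b p q) s (b.cost + c) post := by
  by_cases hb : b.Holds s
  · obtain ⟨s', n, h1, h2, h3⟩ := hp hb
    exact ⟨s', b.cost + n, .ite_true q hb h1, by omega, h3⟩
  · obtain ⟨s', n, h1, h2, h3⟩ := hq hb
    exact ⟨s', b.cost + n, .ite_false p hb h1, by omega, h3⟩

/-- A loop that decreases a measure. -/
lemma Comp.loop (I : ℕ → Memory → Prop)
    (hstep : ∀ n s, I n s → b.Holds s → Comp p s c fun s' => ∃ n' < n, I n' s') {n : ℕ}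
    (hs : I n s) (hpost : ∀ n s, I n s → ¬ b.Holds s → post s) :
    Comp (.loop b p) s (n * (b.cost + c) + b.cost) post := by
  induction n using Nat.strong_induction_on generalizing s with
  | _ n ih =>
    by_cases hb : b.Holds s
    · obtain ⟨s', l, h1, h2, n', hn', h3⟩ := hstep n s hs hb
      obtain ⟨s'', l', h4, h5, h6⟩ := ih n' hn' h3
      refine ⟨s'', b.cost + l + l', .loop_true hb h1 h4, ?_, h6⟩
      have : (n' + 1) * (b.cost + c) ≤ n * (b.cost + c) := Nat.mul_le_mul_right _ hn'
      rw [Nat.add_mul, one_mul] at this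
      omega
    · exact ⟨s, b.cost, .loop_false p hb, by omega, hpost n s hs hb⟩

/-- Run `p` for the values of register `i` up to, but excluding, the content of register `b`. -/
def Program.forLoop (i b : ℕ) (p : Program) : Program :=
  .loop (.lt (.reg i) (.reg b)) (.seq p (.setReg i (.succ (.reg i))))

/-- One round costs the body, three units for the test and three for the increment; the failing last
test costs three. The invariant is stated at the head of the loop, so the body has to establish it
after the increment. -/
lemma Comp.forLoop {i b : ℕ} (I : ℕ → Memory → Prop) (a N : ℕ) (haN : a ≤ N)
    (hI : ∀ k s, I k s → s.reg i = k ∧ s.reg b = N) (hs : I a s)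
    (hbody : ∀ k, a ≤ k → k < N → ∀ s, I k s →
      Comp p s c fun s' => I (k + 1) (s'.setReg i (s'.reg i + 1)))
    (hpost : ∀ s, I N s → post s) :
    Comp (.forLoop i b p) s ((N - a) * (c + 6) + 3) post := by
  refine Comp.mono (Comp.loop (c := c + 3) (post := post)
    (fun n s => ∃ k, a ≤ k ∧ k ≤ N ∧ n = N - k ∧ I k s) ?_ ⟨a, le_rfl, haN, rfl, hs⟩ ?_) ?_
    fun _ h => h
  · rintro n s ⟨k, hak, hkN, rfl, hk⟩ hb
    have h1 := hI k s hk
    simp only [Test.Holds, Expr.eval, h1] at hb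
    refine (hbody k hak hb s hk).seq fun s' hs' => ?_
    exact ⟨_, 3, Runs.setReg s' i (.succ (.reg i)), le_rfl, N - (k + 1), by omega, k + 1, by omega,
      by omega, rfl, hs'⟩
  · rintro n s ⟨k, hak, hkN, rfl, hk⟩ hb
    have h1 := hI k s hk
    simp only [Test.Holds, Expr.eval, h1] at hb
    obtain rfl : k = N := by omega
    exact hpost s hk
  · simp only [Test.cost, Expr.cost]
    have : 1 + 1 + 1 + (c + 3) = c + 6 := by omega
    rw [this]

/-- Run several programs one after the other. -/
@[simp] def Program.block : List Program → Program
  | [] => .skip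
  | p :: ps => .seq p (Program.block ps)

/-- The result of a test. -/
@[simp] def Test.check (s : Memory) : Test → Bool
  | eq e f => e.eval s = f.eval s
  | lt e f => e.eval s < f.eval s
  | not b => !b.check s
  | and b c => b.check s && c.check s

lemma Test.check_iff (b : Test) (s : Memory) : b.check s = true ↔ b.Holds s := by
  induction b with
  | eq e f => simp [Test.Holds]
  | lt e f => simp [Test.Holds]
  | not b ih => simp [Test.Holds, ← ih]
  | and b c ihb ihc => simp [Test.Holds, ← ihb, ← ihc]

attribute [simp] Expr.eval

/-- The final memory content of a program without loops. -/
@[simp] def Program.exec : Program → Memory → Memory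
  | skip, s => s
  | setReg r e, s => s.setReg r (e.eval s)
  | setArr a i e, s => s.setArr a (i.eval s) (e.eval s)
  | seq p q, s => q.exec (p.exec s)
  | ite b p q, s => if b.check s then p.exec s else q.exec s
  | loop _ _, s => s

/-- A program without loops. -/
def Program.IsFlat : Program → Bool
  | skip => true
  | setReg _ _ => true
  | setArr _ _ _ => true
  | seq p q => p.IsFlat && q.IsFlat
  | ite _ p q => p.IsFlat && q.IsFlat
  | loop _ _ => false

/-- A bound for the running time of a program without loops. -/
def Program.size : Program → ℕ
  | skip => 1
  | setReg _ e => e.cost + 1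
  | setArr _ i e => i.cost + e.cost + 1
  | seq p q => p.size + q.size
  | ite b p q => b.cost + (p.size + q.size)
  | loop _ _ => 0

lemma Comp.exec (hflat : p.IsFlat = true) : Comp p s p.size fun s' => s' = p.exec s := by
  induction p generalizing s with
  | skip => exact ⟨s, 1, .skip s, le_rfl, rfl⟩
  | setReg r e => exact ⟨_, _, .setReg s r e, le_rfl, rfl⟩
  | setArr a i e => exact ⟨_, _, .setArr s a i e, le_rfl, rfl⟩
  | seq p q ihp ihq =>
    simp only [Program.IsFlat, Bool.and_eq_true] at hflat
    refine (ihp hflat.1).seq fun s' hs' => ?_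
    subst hs'
    exact ihq hflat.2
  | ite b p q ihp ihq =>
    simp only [Program.IsFlat, Bool.and_eq_true] at hflat
    refine Comp.ite (fun hb => ?_) fun hb => ?_
    · exact (ihp hflat.1).mono (by omega) fun s' hs' => by
        simp [(Test.check_iff b s), hb, hs']
    · exact (ihq hflat.2).mono (by omega) fun s' hs' => by
        simp [(Test.check_iff b s), hb, hs']
  | loop b p => simp [Program.IsFlat] at hflat

/-- Code without loops is evaluated symbolically by `Program.exec`, and its running time is a closed
number; only loops need invariants. -/
lemma Comp.flat (hpost : post (p.exec s)) (hflat : p.IsFlat = true := by rfl)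
    (hc : p.size ≤ c := by decide) : Comp p s c post :=
  (Comp.exec hflat).mono hc fun _ h => h ▸ hpost

lemma Comp.flat_seq (hq : Comp q (p.exec s) c₂ post) (hflat : p.IsFlat = true := by rfl)
    (hc : p.size ≤ c₁ := by decide) : Comp (.seq p q) s (c₁ + c₂) post :=
  (Comp.flat (post := fun s' => s' = p.exec s) rfl hflat hc).seq fun _ h => h ▸ hq

end Logic

/-! ### Queries -/

section Queries

/-- Count the pairs (arrays 17 and 18) that contain the vertex in register 60, and find out whether
some pair consists of the vertices in the registers 60 and 61. -/
def pairQuery : Program :=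
  .seq (.block [.setReg 62 (.num 0), .setReg 63 (.num 0), .setReg 64 (.num 0)])
  (.forLoop 64 9 (.block [
    .ite (.eq (.entry 17 (.reg 64)) (.reg 60)) (.block [
      .setReg 62 (.succ (.reg 62)),
      .ite (.eq (.entry 18 (.reg 64)) (.reg 61)) (.setReg 63 (.num 1)) .skip])
    (.ite (.eq (.entry 18 (.reg 64)) (.reg 60)) (.block [
      .setReg 62 (.succ (.reg 62)),
      .ite (.eq (.entry 17 (.reg 64)) (.reg 61)) (.setReg 63 (.num 1)) .skip]) .skip)]))

lemma incidences_succ {α : Type u} (root other : ℕ → α) (N : ℕ) (u : α) :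
    incidences root other (N + 1) u = incidences root other N u +
      open scoped Classical in if root N = u ∨ other N = u then 1 else 0 := by
  classical
  rw [incidences, Nat.count_succ]; rfl

lemma touched_succ {α : Type u} (root other : ℕ → α) (N : ℕ) (u v : α) :
    Touched root other (N + 1) u v ↔ Touched root other N u v ∨
      s(root N, other N) = s(u, v) := by
  simp only [Touched]
  constructor
  · rintro ⟨σ, hσ, h⟩
    rcases Nat.lt_succ_iff_lt_or_eq.1 hσ with h' | rfl
    · exact Or.inl ⟨σ, h', h⟩
    · exact Or.inr h
  · rintro (⟨σ, hσ, h⟩ | h)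
    · exact ⟨σ, by omega, h⟩
    · exact ⟨N, by omega, h⟩

/-- One pass over the list of pairs answers both the capacity test and the assignment test. The
branches are nested so that a pair with two equal entries is counted once. The same query is used
later, when further pairs have been appended to the list. -/
lemma comp_pairQuery (s : Memory) :
    Comp pairQuery s (s.reg 9 * 100 + 20) fun s' => s'.arr = s.arr ∧
      (∀ r < 62, s'.reg r = s.reg r) ∧
      s'.reg 62 = incidences (s.arr 17) (s.arr 18) (s.reg 9) (s.reg 60) ∧
      (s'.reg 63 = 0 ↔ ¬ Touched (s.arr 17) (s.arr 18) (s.reg 9) (s.reg 60) (s.reg 61)) := by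
  refine Comp.mono (Comp.flat_seq (c₁ := 10)
      (Comp.forLoop (c := 60) (fun k s' => s'.reg 64 = k ∧ s'.arr = s.arr ∧
        (∀ r < 62, s'.reg r = s.reg r) ∧
        s'.reg 62 = incidences (s.arr 17) (s.arr 18) k (s.reg 60) ∧
        (s'.reg 63 = 0 ↔ ¬ Touched (s.arr 17) (s.arr 18) k (s.reg 60) (s.reg 61)))
        0 (s.reg 9) (Nat.zero_le _) ?_ ?_ ?_ fun s' h => h.2)) (by omega) fun s' h => h
  · rintro k s' ⟨h1, -, h2, -⟩
    exact ⟨h1, h2 9 (by norm_num)⟩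
  · refine ⟨by simp, by simp, fun r hr => ?_, by simp [incidences], by simp [Touched]⟩
    simp; grind
  · rintro k - hk s' ⟨h1, h2, h3, h4, h5⟩
    refine Comp.flat ?_
    have h60 := h3 60 (by norm_num)
    have h61 := h3 61 (by norm_num)
    rw [incidences_succ, touched_succ]
    simp only [Program.block, Program.exec, Test.check, Expr.eval, h2, h1, h60, Sym2.eq_iff,
      decide_eq_true_eq]
    split_ifs <;> simp_all <;> grind
end Queries

/-! ### Locating cores and rows, and scanning a row for its first edge on a core -/

section Queries

/-- The routing stored in the arrays 17 to 20. -/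
def Memory.routing (s : Memory) : Routing ℕ := ⟨s.arr 17, s.arr 18, s.arr 19, s.arr 20⟩

/-- Find the middle segment that contains the position in register 50. -/
def coreQuery : Program :=
  .seq (.block [.setReg 51 (.num 0), .setReg 53 (.num 0), .setReg 54 (.num 0)])
  (.forLoop 53 10 (.block [
    .ite (.and (.not (.lt (.reg 50) (.entry 20 (.reg 54))))
        (.lt (.reg 50) (.entry 20 (.succ (.reg 54)))))
      (.block [.setReg 51 (.num 1), .setReg 52 (.reg 54)]) .skip,
    .setReg 54 (.succ (.succ (.reg 54)))]))

/-- The machine cannot double a number in one operation, so the index 2k is carried along in a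
second counter and returned in place of k. -/
lemma comp_coreQuery (s : Memory) :
    Comp coreQuery s (s.reg 10 * 100 + 20) fun s' => s'.arr = s.arr ∧
      (∀ r < 51, s'.reg r = s.reg r) ∧
      ((s'.reg 51 = 0 ∧ ∀ k < s.reg 10, ¬ s.routing.InCore k (s.reg 50)) ∨
       (s'.reg 51 = 1 ∧ ∃ k < s.reg 10, s.routing.InCore k (s.reg 50) ∧ s'.reg 52 = 2 * k)) := by
  refine Comp.mono (Comp.flat_seq (c₁ := 10)
    (Comp.forLoop (c := 60) (fun n s' => s'.reg 53 = n ∧ s'.reg 54 = 2 * n ∧ s'.arr = s.arr ∧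
      (∀ r < 51, s'.reg r = s.reg r) ∧
      ((s'.reg 51 = 0 ∧ ∀ k < n, ¬ s.routing.InCore k (s.reg 50)) ∨
       (s'.reg 51 = 1 ∧ ∃ k < n, s.routing.InCore k (s.reg 50) ∧ s'.reg 52 = 2 * k)))
        0 (s.reg 10) (Nat.zero_le _) ?_ ?_ ?_ fun s' h => h.2.2)) (by omega) fun s' h => h
  · rintro k s' ⟨h1, -, -, h2, -⟩
    exact ⟨h1, h2 10 (by norm_num)⟩
  · refine ⟨by simp,
      by simp,
      by simp, fun r hr => ?_,
      Or.inl ⟨by simp, by simp⟩⟩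
    simp; grind
  · rintro n - hn s' ⟨h1, h2, h3, h4, h5⟩
    refine Comp.flat ?_
    have h50 := h4 50 (by norm_num)
    have hcore : s.routing.InCore n (s.reg 50) ↔
        s.arr 20 (2 * n) ≤ s.reg 50 ∧ s.reg 50 < s.arr 20 (2 * n + 1) := Iff.rfl
    simp only [Program.block, Program.exec]
    split_ifs with hc <;> simp only [Test.check_iff, Test.Holds, Expr.eval, h3, h2, h50, not_lt,
      ← hcore] at hc
    · refine ⟨by simp [h1], by simp [h2]; ring, by simp [h3], fun r hr => ?_, Or.inr ⟨by simp, ?_⟩⟩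
      · simp; grind
      · exact ⟨n, by omega, hc, by simp [h2]⟩
    · refine ⟨by simp [h1], by simp [h2]; ring, by simp [h3], fun r hr => ?_, ?_⟩
      · simp; grind
      · rcases h5 with ⟨h5, h6⟩ | ⟨h5, k, h6, h7, h8⟩
        · refine Or.inl ⟨by simpa using h5, fun k hk => ?_⟩
          rcases Nat.lt_succ_iff_lt_or_eq.1 hk with hk | rfl
          · exact h6 k hk
          · exact hc
        · exact Or.inr ⟨by simpa using h5, k, by omega, h7, by simpa using h8⟩

/-- Find the row of the linkage table that starts at the vertex in register 26 and finishes at the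
vertex in register 27. -/
def rowQuery : Program :=
  .seq (.block [.setReg 28 (.num 0), .setReg 29 (.num 0)])
  (.forLoop 29 7 (.block [
    .ite (.and (.eq (.entry 12 (.reg 29)) (.reg 26)) (.eq (.entry 13 (.reg 29)) (.reg 27)))
      (.setReg 28 (.reg 29)) .skip]))

lemma comp_rowQuery (s : Memory) :
    Comp rowQuery s (s.reg 7 * 100 + 20) fun s' => s'.arr = s.arr ∧
      (∀ r, r ≠ 28 → r ≠ 29 → s'.reg r = s.reg r) ∧
      ((∃ d < s.reg 7, s.arr 12 d = s.reg 26 ∧ s.arr 13 d = s.reg 27) →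
        s'.reg 28 < s.reg 7 ∧ s.arr 12 (s'.reg 28) = s.reg 26 ∧
          s.arr 13 (s'.reg 28) = s.reg 27) := by
  refine Comp.mono (Comp.flat_seq (c₁ := 10)
    (Comp.forLoop (c := 60) (fun n s' => s'.reg 29 = n ∧ s'.arr = s.arr ∧
      (∀ r, r ≠ 28 → r ≠ 29 → s'.reg r = s.reg r) ∧
      ((∃ d < n, s.arr 12 d = s.reg 26 ∧ s.arr 13 d = s.reg 27) →
        s'.reg 28 < n ∧ s.arr 12 (s'.reg 28) = s.reg 26 ∧
          s.arr 13 (s'.reg 28) = s.reg 27))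
        0 (s.reg 7) (Nat.zero_le _) ?_ ?_ ?_ fun s' h => h.2)) (by omega) fun s' h => h
  · rintro k s' ⟨h1, -, h2, -⟩
    exact ⟨h1, h2 7 (by norm_num) (by norm_num)⟩
  · refine ⟨by simp,
      by simp, fun r h1 h2 => ?_, by simp⟩
    simp [h1, h2]
  · rintro n - hn s' ⟨h1, h2, h3, h4⟩
    refine Comp.flat ?_
    have h26 := h3 26 (by norm_num) (by norm_num)
    have h27 := h3 27 (by norm_num) (by norm_num)
    simp only [Program.block, Program.exec]
    split_ifs with hc <;> simp only [Test.check_iff, Test.Holds, Expr.eval, h1, h2, h26, h27] at hc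
    · refine ⟨by simp [h1], by simp [h2], fun r h1 h2 => ?_, fun _ => ?_⟩
      · simp [h1, h2, h3]
      · simpa [h1] using hc
    · refine ⟨by simp [h1], by simp [h2], fun r h1 h2 => ?_, ?_⟩
      · simp [h2, h3, h1]
      · rintro ⟨d, hd, h⟩
        rcases Nat.lt_succ_iff_lt_or_eq.1 hd with hd | rfl
        · have := h4 ⟨d, hd, h⟩
          refine ⟨?_, ?_⟩ <;> simp
          · omega
          · exact this.2
        · exact absurd h hc

/-- Row `d` of the table in the arrays 10 to 15 contains the walk `l`. -/
structure IsRow (H : Graph ℕ ℕ) (s : Memory) (d : ℕ) (l : List ℕ) : Prop where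
  finish : s.arr 15 d = s.arr 14 d + l.length
  edge : ∀ i (h : i < l.length), s.arr 10 (s.arr 14 d + i) = l[i]
  isWalk : ∀ i ≤ l.length, IsWalk H (s.arr 12 d) (l.take i) (s.arr 11 (s.arr 14 d + i))

lemma IsRow.congr {H : Graph ℕ ℕ} {s s' : Memory} {d : ℕ} {l : List ℕ} (h : IsRow H s d l)
    (h10 : ∀ i ≤ s.arr 15 d, s'.arr 10 i = s.arr 10 i)
    (h11 : ∀ i ≤ s.arr 15 d, s'.arr 11 i = s.arr 11 i)
    (h12 : s'.arr 12 d = s.arr 12 d) (h14 : s'.arr 14 d = s.arr 14 d)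
    (h15 : s'.arr 15 d = s.arr 15 d) : IsRow H s' d l := by
  have := h.finish
  refine ⟨by rw [h15, h14, this], fun i hi => ?_, fun i hi => ?_⟩
  · rw [h14, h10 _ (by omega), h.edge i hi]
  · rw [h12, h14, h11 _ (by omega)]; exact h.isWalk i hi

/-- Search the row in register 20 for the first edge that belongs to a middle segment. -/
def rowScan : Program :=
  .seq (.block [.setReg 41 (.entry 14 (.reg 20)), .setReg 42 (.entry 15 (.reg 20)),
    .setReg 43 (.num 0), .setReg 44 (.num 0)])
  (.forLoop 41 42 (.seq (.block [.setReg 45 (.entry 10 (.reg 41)),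
      .setReg 50 (.entry 16 (.reg 45)), .setReg 51 (.num 0)])
    (.seq (.ite (.and (.eq (.reg 43) (.num 0)) (.eq (.entry 10 (.reg 50)) (.reg 45)))
      coreQuery .skip)
    (.block [.ite (.and (.eq (.reg 43) (.num 0)) (.eq (.reg 51) (.num 1)))
      (.block [.setReg 43 (.num 1), .setReg 46 (.reg 50), .setReg 47 (.reg 52),
        .setReg 48 (.reg 44), .setReg 49 (.entry 11 (.reg 41))]) .skip,
      .setReg 44 (.succ (.reg 44))]))))

/-- Array 16 is an inverse of array 10 on the cores. An entry for an edge outside the circuits may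
be meaningless, and comparing the edge at the stored position with the given edge detects this.
Hence an edge is located in time depending on the number of cores only. -/
lemma comp_rowScan {H : Graph ℕ ℕ} (s : Memory) {l : List ℕ} (hl : IsRow H s (s.reg 20) l)
    (hpos : ∀ k < s.reg 10, ∀ z, s.routing.InCore k z → s.arr 16 (s.arr 10 z) = z) :
    Comp rowScan s (l.length * (s.reg 10 * 100 + 100) + 50) fun s' => s'.arr = s.arr ∧
      (∀ r < 41, s'.reg r = s.reg r) ∧
      ((s'.reg 43 = 0 ∧ ∀ e ∈ l, ∀ k < s.reg 10, ∀ z, s.routing.InCore k z → s.arr 10 z ≠ e) ∨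
       (s'.reg 43 = 1 ∧ ∃ k < s.reg 10, ∃ z i, ∃ hi : i < l.length, s.routing.InCore k z ∧
          s.arr 10 z = l[i] ∧
          (∀ j (h : j < l.length), j < i → ∀ k < s.reg 10, ∀ z, s.routing.InCore k z →
            s.arr 10 z ≠ l[j]) ∧ IsWalk H (s.arr 12 (s.reg 20)) (l.take i) (s'.reg 49) ∧
          s'.reg 46 = z ∧ s'.reg 47 = 2 * k ∧ s'.reg 48 = i)) := by
  have hfin := hl.finish
  -- The loop runs to the end of the row even after a hit. Register 43 is then 1, which freezes the
  -- registers describing the first hit.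
  refine Comp.mono (Comp.flat_seq (c₁ := 20)
    (Comp.forLoop (c := s.reg 10 * 100 + 90) (fun y s' => ∃ n, y = s.arr 14 (s.reg 20) + n ∧
      s'.reg 41 = y ∧ s'.reg 42 = s.arr 15 (s.reg 20) ∧ s'.reg 44 = n ∧ s'.arr = s.arr ∧
      (∀ r < 41, s'.reg r = s.reg r) ∧
      ((s'.reg 43 = 0 ∧ ∀ j (h : j < l.length), j < n → ∀ k < s.reg 10, ∀ z,
          s.routing.InCore k z → s.arr 10 z ≠ l[j]) ∨
       (s'.reg 43 = 1 ∧ ∃ k < s.reg 10, ∃ z i, ∃ hi : i < l.length, s.routing.InCore k z ∧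
          s.arr 10 z = l[i] ∧
          (∀ j (h : j < l.length), j < i → ∀ k < s.reg 10, ∀ z, s.routing.InCore k z →
            s.arr 10 z ≠ l[j]) ∧ IsWalk H (s.arr 12 (s.reg 20)) (l.take i) (s'.reg 49) ∧
          s'.reg 46 = z ∧ s'.reg 47 = 2 * k ∧ s'.reg 48 = i)))
        (s.arr 14 (s.reg 20)) (s.arr 15 (s.reg 20)) (by omega) ?_ ?_ ?_ ?_)) ?_ fun s' h => h
  · rintro k s' ⟨n, -, h1, h2, -⟩
    exact ⟨h1, h2⟩
  · refine ⟨0, by simp, by simp,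
      by simp,
      by simp,
      by simp, fun r hr => ?_,
      Or.inl ⟨by simp, by simp⟩⟩
    simp; grind
  · rintro y - hy s₁ ⟨n, rfl, h41, h42, h44, harr, hreg, hcase⟩
    have hn : n < l.length := by omega
    have hedge := hl.edge n hn
    refine Comp.mono (Comp.flat_seq (c₁ := 15) (Comp.seq (c₁ := s.reg 10 * 100 + 30) (c₂ := 45)
      (mid := fun s' => s'.arr = s.arr ∧ (∀ r < 50, r ≠ 45 → s'.reg r = s₁.reg r) ∧
        (s₁.reg 43 = 0 → (s'.reg 51 = 0 ∧ ∀ k < s.reg 10, ∀ z, s.routing.InCore k z →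
            s.arr 10 z ≠ l[n]) ∨
          (s'.reg 51 = 1 ∧ ∃ k < s.reg 10, s.routing.InCore k (s'.reg 50) ∧
            s.arr 10 (s'.reg 50) = l[n] ∧ s'.reg 52 = 2 * k))) ?_ fun s₂ h₂ => Comp.flat ?_))
      (by omega) fun s' h => h
    · set s₁' := Program.exec (.block [.setReg 45 (.entry 10 (.reg 41)),
        .setReg 50 (.entry 16 (.reg 45)), .setReg 51 (.num 0)]) s₁ with hs₁'
      have a1 : s₁'.arr = s.arr := by simp [hs₁', harr]
      have a2 : s₁'.reg 45 = l[n] := by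
        simp [hs₁', harr, h41, hedge]
      have a3 : s₁'.reg 50 = s.arr 16 l[n] := by
        simp [hs₁', harr, h41, hedge]
      have a4 : s₁'.reg 51 = 0 := by simp [hs₁']
      have a5 : ∀ r < 50, r ≠ 45 → s₁'.reg r = s₁.reg r := by
        intro r hr hr'; simp [hs₁']; grind
      have a6 : s₁'.routing = s.routing := by simp [Memory.routing, a1]
      have a10 : s₁'.reg 10 = s.reg 10 := by rw [a5 10 (by norm_num) (by norm_num), hreg 10 (by norm_num)]
      refine Comp.mono (Comp.ite (c := s.reg 10 * 100 + 20) (fun hb => ?_) fun hb => ?_) ?_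
        fun s' h => h
      · simp only [Test.Holds, Expr.eval, a1, a2, a3] at hb
        refine (comp_coreQuery s₁').mono (by rw [a10]) ?_
        rintro s' ⟨b1, b2, b3⟩
        rw [a6, a10] at b3
        refine ⟨b1.trans a1, fun r hr hr' => (b2 r (by omega)).trans (a5 r hr hr'), fun _ => ?_⟩
        have b50 := b2 50 (by norm_num)
        rw [b50]
        rcases b3 with ⟨b3, b4⟩ | ⟨b3, k, b4, b5, b6⟩
        -- A core position carrying this edge would be the one stored in array 16, so a negative
        -- answer for that position is conclusive.
        · refine Or.inl ⟨b3, fun k hk z hz heq => b4 k hk ?_⟩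
          rw [a3, ← heq, hpos k hk z hz]; exact hz
        · exact Or.inr ⟨b3, k, b4, b5, a3 ▸ hb.2, b6⟩
      · simp only [Test.Holds, Expr.eval, a1, a2, a3] at hb
        refine Comp.mono (c₁ := 1) (post := fun s' => s' = s₁') ⟨_, _, .skip _, le_rfl, rfl⟩
          (by omega) ?_
        rintro s' rfl
        refine ⟨a1, a5, fun h0 => Or.inl ⟨a4, fun k hk z hz heq => hb ⟨?_, ?_⟩⟩⟩
        · rw [a5 43 (by norm_num) (by norm_num), h0]
        · rw [← heq, hpos k hk z hz]
      · simp [Test.cost, Expr.cost]; omega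
    · obtain ⟨b1, b2, b3⟩ := h₂
      have b41 := b2 41 (by norm_num) (by norm_num)
      have b42 := b2 42 (by norm_num) (by norm_num)
      have b43 := b2 43 (by norm_num) (by norm_num)
      have b44 := b2 44 (by norm_num) (by norm_num)
      have b46 := b2 46 (by norm_num) (by norm_num)
      have b47 := b2 47 (by norm_num) (by norm_num)
      have b48 := b2 48 (by norm_num) (by norm_num)
      have b49 := b2 49 (by norm_num) (by norm_num)
      have breg : ∀ r < 41, s₂.reg r = s.reg r := fun r hr =>
        (b2 r (by omega) (by omega)).trans (hreg r hr)
      refine ⟨n + 1, rfl, ?_⟩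
      simp only [Program.block, Program.exec]
      split_ifs with hc <;> simp only [Test.check_iff, Test.Holds, Expr.eval] at hc
      · obtain ⟨hc1, hc2⟩ := hc
        rw [b43] at hc1
        have hcase' : ∀ j (h : j < l.length), j < n → ∀ k < s.reg 10, ∀ z,
            s.routing.InCore k z → s.arr 10 z ≠ l[j] := by
          rcases hcase with h | h
          · exact h.2
          · omega
        refine ⟨by simp [b41, h41, add_assoc], by simp [b42, h42], by simp [b44, h44],
          by simp [b1], fun r hr => ?_, Or.inr ⟨by simp, ?_⟩⟩
        · simp; grind
        · rcases b3 hc1 with ⟨b3, -⟩ | ⟨b3, k, b4, b5, b6, b7⟩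
          · omega
          · refine ⟨k, b4, s₂.reg 50, n, hn, b5, b6, hcase', ?_, by simp, by simp [b7],
              by simp [b44, h44]⟩
            have := hl.isWalk n hn.le
            simpa [b41, h41, b1] using this
      · refine ⟨by simp [b41, h41, add_assoc], by simp [b42, h42], by simp [b44, h44],
          by simp [b1], fun r hr => ?_, ?_⟩
        · simp; grind
        · rcases hcase with ⟨h43, hcase⟩ | ⟨h43, hcase⟩
          · refine Or.inl ⟨by simp [b43, h43], fun j hj hjn => ?_⟩
            rcases Nat.lt_succ_iff_lt_or_eq.1 hjn with hjn | rfl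
            · exact hcase j hj hjn
            · rcases b3 h43 with b3 | b3
              · exact b3.2
              · exact absurd ⟨b43.trans h43, b3.1⟩ hc
          · exact Or.inr ⟨by simp [b43, h43], by simpa [b46, b47, b48, b49] using hcase⟩
  · rintro s' ⟨n, h1, -, -, -, h2, h3, h4⟩
    refine ⟨h2, h3, ?_⟩
    rcases h4 with ⟨h4, h5⟩ | h4
    · refine Or.inl ⟨h4, fun e he => ?_⟩
      obtain ⟨j, hj, rfl⟩ := List.mem_iff_getElem.1 he
      exact h5 j hj (by omega)
    · exact Or.inr h4
  · rw [hfin, Nat.add_sub_cancel_left]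
    have : s.reg 10 * 100 + 90 + 6 ≤ s.reg 10 * 100 + 100 := by omega
    have := Nat.mul_le_mul_left l.length this
    omega

end Queries

/-! ### Rerouting until no row of the table is useful -/

section Reroute

/-- Execute the rerouting found by `rowScan`, for the row from the vertex in register 21 to the
vertex in register 22. -/
def rerouteStep : Program :=
  .seq (.block [
    .ite (.eq (.entry 11 (.reg 46)) (.reg 49)) (.setReg 50 (.num 1)) (.setReg 50 (.num 0)),
    .setReg 51 (.entry 19 (.succ (.reg 47))), .setReg 52 (.succ (.reg 46)),
    .setReg 53 (.entry 20 (.succ (.reg 47))), .setReg 54 (.num 0)])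
  (.seq (.forLoop 52 53 (.setReg 51 (.succ (.reg 51))))
  (.seq (.forLoop 54 48 (.setReg 51 (.succ (.reg 51))))
  (.seq (.block [.ite (.eq (.reg 50) (.num 1)) (.setReg 51 (.succ (.reg 51))) .skip])
  (.seq (.loop (.lt (.num 1) (.reg 51)) (.setReg 51 (.pred (.pred (.reg 51)))))
  (.block [.ite (.eq (.reg 51) (.num 1))
    (.block [.setArr 17 (.reg 47) (.reg 21), .setArr 18 (.reg 47) (.reg 22),
      .ite (.eq (.reg 50) (.num 1)) (.setArr 19 (.reg 47) (.succ (.reg 48)))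
        (.setArr 19 (.reg 47) (.reg 48)),
      .setArr 20 (.reg 47) (.succ (.reg 46))])
    (.block [.setArr 17 (.succ (.reg 47)) (.reg 21), .setArr 18 (.succ (.reg 47)) (.reg 22),
      .ite (.eq (.reg 50) (.num 1)) (.setArr 19 (.succ (.reg 47)) (.reg 48))
        (.setArr 19 (.succ (.reg 47)) (.succ (.reg 48))),
      .setArr 20 (.succ (.reg 47)) (.reg 46)])])))))

lemma comp_increment {i b : ℕ} (hib : i ≠ 51) (hb : b ≠ 51) (hbi : b ≠ i) (s : Memory)
    (h : s.reg i ≤ s.reg b) :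
    Comp (.forLoop i b (.setReg 51 (.succ (.reg 51)))) s ((s.reg b - s.reg i) * 9 + 3) fun s' =>
      s'.arr = s.arr ∧ (∀ r, r ≠ i → r ≠ 51 → s'.reg r = s.reg r) ∧
      s'.reg 51 = s.reg 51 + (s.reg b - s.reg i) := by
  refine Comp.mono (Comp.forLoop (c := 3) (fun k s' => s'.reg i = k ∧ s'.arr = s.arr ∧
      (∀ r, r ≠ i → r ≠ 51 → s'.reg r = s.reg r) ∧ s'.reg 51 + s.reg i = s.reg 51 + k)
    (s.reg i) (s.reg b) h ?_ ?_ ?_ fun s' h => ?_) le_rfl fun s' h => h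
  · rintro k s' ⟨h1, -, h2, -⟩
    exact ⟨h1, h2 b hbi hb⟩
  · exact ⟨rfl, rfl, fun _ _ _ => rfl, rfl⟩
  · rintro k h1 h2 s' ⟨h3, h4, h5, h6⟩
    refine Comp.flat ⟨?_, ?_, fun r hr hr' => ?_, ?_⟩
    · simp [hib, h3]
    · simp [h4]
    · simp [hr, hr', h5]
    · simp [hib.symm]; omega
  · exact ⟨h.2.1, h.2.2.1, by have := h.2.2.2; omega⟩

lemma comp_parity (s : Memory) :
    Comp (.loop (.lt (.num 1) (.reg 51)) (.setReg 51 (.pred (.pred (.reg 51))))) s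
      (s.reg 51 * 7 + 3) fun s' => s'.arr = s.arr ∧ (∀ r, r ≠ 51 → s'.reg r = s.reg r) ∧
        s'.reg 51 = s.reg 51 % 2 := by
  refine Comp.mono (Comp.loop (c := 4) (fun n s' => n = s'.reg 51 ∧ s'.arr = s.arr ∧
    (∀ r, r ≠ 51 → s'.reg r = s.reg r) ∧ s'.reg 51 % 2 = s.reg 51 % 2) ?_
    (n := s.reg 51) ⟨rfl, rfl, fun _ _ => rfl, rfl⟩ ?_) (by simp [Test.cost, Expr.cost])
    fun s' h => h
  · rintro n s' ⟨rfl, h1, h2, h3⟩ hb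
    simp only [Test.Holds, Expr.eval] at hb
    refine Comp.flat ⟨_, ?_, rfl, by simp [h1], fun r hr => by simp [hr, h2], ?_⟩
    · simp; omega
    · simp; omega
  · rintro n s' ⟨rfl, h1, h2, h3⟩ hb
    simp only [Test.Holds, Expr.eval] at hb
    exact ⟨h1, h2, by omega⟩

/-- Register 51 accumulates the length of the candidate that keeps the right part, by repeated
increments, and is then reduced modulo two by repeated subtraction. This takes time linear in the
lengths involved, which the budget of one sweep allows. -/
lemma comp_rerouteStep (s : Memory) {k : ℕ} (hk : s.reg 47 = 2 * k)
    (hz : s.reg 46 < s.arr 20 (2 * k + 1)) {d : ℕ}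
    (hd : (s.arr 11 (s.reg 46) = s.reg 49 ∧ d = 1) ∨ (s.arr 11 (s.reg 46) ≠ s.reg 49 ∧ d = 0)) :
    Comp rerouteStep s
      ((s.arr 19 (2 * k + 1) + (s.arr 20 (2 * k + 1) - s.reg 46) + s.reg 48) * 20 + 150) fun s' =>
        (∀ r < 50, s'.reg r = s.reg r) ∧ (∀ a, a < 17 → s'.arr a = s.arr a) ∧
        s'.routing = s.routing.step (s.reg 21) (s.reg 22) (s.reg 48) k (s.reg 46) d := by
  refine Comp.mono (Comp.seq (c₁ := 40) (mid := fun s' => s'.arr = s.arr ∧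
      (∀ r < 50, s'.reg r = s.reg r) ∧ s'.reg 50 = d ∧ s'.reg 51 = s.arr 19 (2 * k + 1) ∧
      s'.reg 52 = s.reg 46 + 1 ∧ s'.reg 53 = s.arr 20 (2 * k + 1) ∧ s'.reg 54 = 0)
      (Comp.flat ?_) fun s₁ h₁ => Comp.seq ((comp_increment (i := 52) (b := 53) (by norm_num)
      (by norm_num) (by norm_num) s₁ (by omega)).mono
      (c₂ := (s.arr 20 (2 * k + 1) - s.reg 46) * 9 + 3) (by omega) fun _ h => h) fun s₂ h₂ => Comp.seq ((comp_increment (i := 54) (b := 48)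
      (by norm_num) (by norm_num) (by norm_num) s₂ ?_).mono (c₂ := s.reg 48 * 9 + 3) ?_ fun _ h => h) fun s₃ h₃ => Comp.seq (c₁ := 10) (mid := fun s' =>
        s'.arr = s₃.arr ∧ (∀ r, r ≠ 51 → s'.reg r = s₃.reg r) ∧ s'.reg 51 = s₃.reg 51 + d)
        (Comp.flat ?_) fun s₄ h₄ => Comp.seq ((comp_parity s₄).mono (c₂ := (s.arr 19 (2 * k + 1) +
          (s.arr 20 (2 * k + 1) - s.reg 46) + s.reg 48 + 1) * 7 + 3) ?_ fun _ h => h)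
        fun s₅ h₅ => Comp.flat (c := 60) ?_) ?_ fun s' h => h
  · simp only [Program.block, Program.exec]
    split_ifs with hc <;> simp only [Test.check_iff, Test.Holds, Expr.eval] at hc
    · obtain rfl : d = 1 := by omega
      refine ⟨by simp, fun r hr => ?_, by simp, by simp [hk], by simp, by simp [hk], by simp⟩
      simp; grind
    · obtain rfl : d = 0 := by omega
      refine ⟨by simp, fun r hr => ?_, by simp, by simp [hk], by simp, by simp [hk], by simp⟩
      simp; grind
  · rw [h₂.2.1 54 (by norm_num) (by norm_num)]; omega
  · rw [h₂.2.1 48 (by norm_num) (by norm_num), h₁.2.1 48 (by norm_num)]; omega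
  · have h50 : s₃.reg 50 = d := by
      rw [h₃.2.1 50 (by norm_num) (by norm_num), h₂.2.1 50 (by norm_num) (by norm_num), h₁.2.2.1]
    simp only [Program.block, Program.exec]
    split_ifs with hc <;> simp only [Test.check_iff, Test.Holds, Expr.eval] at hc
    · exact ⟨by simp, fun r hr => by simp [hr], by simp; omega⟩
    · exact ⟨rfl, fun r hr => rfl, by omega⟩
  · have h48 : s₂.reg 48 = s.reg 48 := by
      rw [h₂.2.1 48 (by norm_num) (by norm_num), h₁.2.1 48 (by norm_num)]
    have h54 : s₂.reg 54 = 0 := by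
      rw [h₂.2.1 54 (by norm_num) (by norm_num), h₁.2.2.2.2.2.2]
    rw [h₄.2.2, h₃.2.2, h₂.2.2, h₁.2.2.2.1, h48, h54]
    omega
  · have h48 : s₂.reg 48 = s.reg 48 := by
      rw [h₂.2.1 48 (by norm_num) (by norm_num), h₁.2.1 48 (by norm_num)]
    have h54 : s₂.reg 54 = 0 := by
      rw [h₂.2.1 54 (by norm_num) (by norm_num), h₁.2.2.2.2.2.2]
    have harr : s₅.arr = s.arr := by rw [h₅.1, h₄.1, h₃.1, h₂.1, h₁.1]
    have hreg : ∀ r < 50, s₅.reg r = s.reg r := fun r hr => by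
      rw [h₅.2.1 r (by omega), h₄.2.1 r (by omega), h₃.2.1 r (by omega) (by omega),
        h₂.2.1 r (by omega) (by omega), h₁.2.1 r hr]
    have h50 : s₅.reg 50 = d := by
      rw [h₅.2.1 50 (by norm_num), h₄.2.1 50 (by norm_num), h₃.2.1 50 (by norm_num) (by norm_num),
        h₂.2.1 50 (by norm_num) (by norm_num), h₁.2.2.1]
    have h51 : s₅.reg 51 = (s.reg 48 + d + (s.arr 20 (2 * k + 1) - (s.reg 46 + 1)) +
        s.arr 19 (2 * k + 1)) % 2 := by
      rw [h₅.2.2, h₄.2.2, h₃.2.2, h₂.2.2, h₁.2.2.2.1, h48, h54, h₁.2.2.2.2.1, h₁.2.2.2.2.2.1]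
      congr 1; omega
    have h21 := hreg 21 (by norm_num)
    have h22 := hreg 22 (by norm_num)
    have h46 := hreg 46 (by norm_num)
    have h47 := hreg 47 (by norm_num)
    have h48 := hreg 48 (by norm_num)
    -- The final value of register 51 decides exactly the case distinction in `Routing.step`.
    have hodd : Odd (s.reg 48 + d + (s.routing.pos (2 * k + 1) - (s.reg 46 + 1)) +
        s.routing.len (2 * k + 1)) ↔ s₅.reg 51 = 1 := by
      rw [h51, Nat.odd_iff]; rfl
    have hd' : d = 0 ∨ d = 1 := by omega
    refine ⟨fun r hr => ?_, fun a ha => ?_, ?_⟩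
    · rw [← hreg r hr]
      rcases hd' with rfl | rfl <;> by_cases h : s₅.reg 51 = 1 <;> simp [h, h50]
    · have h1 : a ≠ 17 := by omega
      have h2 : a ≠ 18 := by omega
      have h3 : a ≠ 19 := by omega
      have h4 : a ≠ 20 := by omega
      rcases hd' with rfl | rfl <;> by_cases h : s₅.reg 51 = 1 <;>
        simp [Memory.setArr_arr, h, h50, h1, h2, h3, h4, harr]
    · rw [Routing.step]
      split_ifs with hpar
      · have hc : (Test.eq (Expr.reg 51) (Expr.num 1)).check s₅ = true := by
          exact decide_eq_true (hodd.1 hpar)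
        simp only [Program.block, Program.exec, Memory.routing, Routing.reroute, if_pos hc]
        rcases hd' with rfl | rfl <;>
          simp [Memory.setArr_arr, harr, h21, h22, h46, h47, h48, h50, hk]
      · have hc : ¬ (Test.eq (Expr.reg 51) (Expr.num 1)).check s₅ = true := by
          exact fun h => hpar (hodd.2 (of_decide_eq_true h))
        simp only [Program.block, Program.exec, Memory.routing, Routing.reroute, if_neg hc]
        rcases hd' with rfl | rfl <;>
          simp [Memory.setArr_arr, harr, h21, h22, h46, h47, h48, h50, hk]
  · omega

/-- As cores only shrink, array 16 stays correct on them and never has to be updated. -/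
lemma Routing.inCore_of_step {α : Type u} {r : Routing α} {u v : α} {i k z d k' z' : ℕ}
    (hz : r.InCore k z) (h : (r.step u v i k z d).InCore k' z') : r.InCore k' z' := by
  unfold Routing.step at h
  unfold Routing.InCore at *
  split_ifs at h <;> simp only [Routing.pos_reroute] at h <;> grind

/-- Core positions carry distinct edges of G. This bounds the number of reroutings by |E(G)|. -/
lemma Routing.Valid.size_le_ncard {α : Type u} {β : Type v} {G : Graph α β} {S : List α}
    {Q : α → α → List β} {c : ℕ → β} {p : ℕ → α} {m q : ℕ} {r : Routing α}
    (hr : r.Valid G S Q c p m q) (hG : E(G).Finite) : r.size m ≤ E(G).ncard := by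
  classical
  have h1 : r.size m = ((Finset.range m).sigma fun k =>
      Finset.Ico (r.pos (2 * k)) (r.pos (2 * k + 1))).card := by
    simp [Routing.size, Finset.card_sigma]
  rw [h1, ← Finset.card_image_of_injOn (f := fun x : Σ _ : ℕ, ℕ => c x.2), ← Set.ncard_coe_finset]
  · refine Set.ncard_le_ncard ?_ hG
    intro e he
    simp only [Finset.coe_image, Set.mem_image, Finset.mem_coe, Finset.mem_sigma,
      Finset.mem_range, Finset.mem_Ico] at he
    obtain ⟨⟨k, z⟩, ⟨hk, hz⟩, rfl⟩ := he
    exact (hr.link k hk z hz).edge_mem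
  · rintro ⟨k, z⟩ hx ⟨k', z'⟩ hx' heq
    simp only [Finset.mem_coe, Finset.mem_sigma, Finset.mem_range, Finset.mem_Ico] at hx hx'
    obtain ⟨rfl, rfl⟩ := hr.inj k hx.1 z hx.2 k' hx'.1 z' hx'.2 heq
    rfl

lemma Routing.pos_sub_le_size {α : Type u} (r : Routing α) {k m : ℕ} (hk : k < m) :
    r.pos (2 * k + 1) - r.pos (2 * k) ≤ r.size m :=
  Finset.single_le_sum (f := fun k => r.pos (2 * k + 1) - r.pos (2 * k))
    (fun _ _ => Nat.zero_le _) (Finset.mem_range.2 hk)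

/-- The arrays 10 to 15 contain all trails of a linkage. -/
structure IsTable (H : Graph ℕ ℕ) (S : List ℕ) (Q : ℕ → ℕ → List ℕ) (s : Memory) : Prop where
  mem : ∀ d < s.reg 7, s.arr 12 d ∈ S ∧ s.arr 13 d ∈ S ∧ s.arr 12 d ≠ s.arr 13 d
  isRow : ∀ d < s.reg 7, IsRow H s d (Q (s.arr 12 d) (s.arr 13 d))
  exists_row : ∀ u ∈ S, ∀ v ∈ S, u ≠ v → ∃ d < s.reg 7, s.arr 12 d = u ∧ s.arr 13 d = v

/-- Memory contents between two reroutings, `s₀` being the first one. -/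
structure IsRerouting (G : Graph ℕ ℕ) (S : List ℕ) (Q : ℕ → ℕ → List ℕ) (s₀ s : Memory) :
    Prop where
  reg : ∀ r < 20, s.reg r = s₀.reg r
  arr : ∀ a < 17, s.arr a = s₀.arr a
  valid : s.routing.Valid G S Q (s₀.arr 10) (s₀.arr 11) (s₀.reg 10) (s₀.reg 6)
  index : ∀ k < s₀.reg 10, ∀ z, s.routing.InCore k z → s₀.arr 16 (s₀.arr 10 z) = z

/-- Try to use row number `reg 20` of the table for rerouting. -/
def rerouteRow : Program :=
  .seq (.block [.setReg 21 (.entry 12 (.reg 20)), .setReg 22 (.entry 13 (.reg 20)),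
    .setReg 60 (.reg 21), .setReg 61 (.reg 22)])
  (.seq pairQuery
  (.ite (.and (.lt (.reg 62) (.reg 6)) (.eq (.reg 63) (.num 0)))
    (.seq rowScan (.ite (.eq (.reg 43) (.num 1)) (.seq rerouteStep (.setReg 23 (.num 1))) .skip))
    .skip))

/-- The trail from `u` to `v` cannot be used for rerouting. -/
def Routing.Useless (r : Routing ℕ) (Q : ℕ → ℕ → List ℕ) (c : ℕ → ℕ) (m q u v : ℕ) : Prop :=
  incidences r.root r.other (2 * m) u < q → ¬ Touched r.root r.other (2 * m) u v →
    ∀ e ∈ Q u v, ∀ k < m, ∀ z, r.InCore k z → c z ≠ e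

variable {G H : Graph ℕ ℕ} {S : List ℕ} {Q : ℕ → ℕ → List ℕ} {s₀ s : Memory} {Z : ℕ}

/-- Either the row is certified useless for the present routing, or the routing is replaced by a
smaller one. Z bounds the lengths of linking trails, hence of arms, and also the total size of the
cores. -/
lemma comp_rerouteRow (hGH : G ≤ H) (hQ : Linkage G S Q) (hT : IsTable H S Q s₀)
    (h9 : s₀.reg 9 = 2 * s₀.reg 10) (hQZ : ∀ u ∈ S, ∀ v ∈ S, u ≠ v → (Q u v).length ≤ Z)
    (hsZ : s.routing.size (s₀.reg 10) ≤ Z)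
    (hs : IsRerouting G S Q s₀ s) (h20 : s.reg 20 < s₀.reg 7) :
    Comp rerouteRow s (s₀.reg 10 * 200 + Z * (s₀.reg 10 * 100 + 160) + 300) fun s' =>
      IsRerouting G S Q s₀ s' ∧ s'.reg 20 = s.reg 20 ∧
      ((s'.reg 23 = s.reg 23 ∧ s'.routing = s.routing ∧
          s.routing.Useless Q (s₀.arr 10) (s₀.reg 10) (s₀.reg 6) (s₀.arr 12 (s.reg 20))
            (s₀.arr 13 (s.reg 20))) ∨
        (s'.reg 23 = 1 ∧ s'.routing.size (s₀.reg 10) < s.routing.size (s₀.reg 10))) := by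
  set u := s₀.arr 12 (s.reg 20) with hu
  set v := s₀.arr 13 (s.reg 20) with hv
  set m := s₀.reg 10 with hm
  obtain ⟨huS, hvS, huv⟩ := hT.mem _ h20
  have hrow := hT.isRow _ h20
  simp only [← hu, ← hv] at huS hvS huv hrow
  have hlen := hQZ u huS v hvS huv
  refine Comp.mono (Comp.seq (c₁ := 30) (mid := fun s' => s'.arr = s.arr ∧
      (∀ r, r < 60 → r ≠ 21 → r ≠ 22 → s'.reg r = s.reg r) ∧ s'.reg 21 = u ∧ s'.reg 22 = v ∧
      s'.reg 60 = u ∧ s'.reg 61 = v) (Comp.flat ?_) fun s₁ h₁ => Comp.seq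
      ((comp_pairQuery s₁).mono (c₂ := m * 200 + 20) ?_ fun _ h => h) fun s₂ h₂ =>
      Comp.ite (c := Z * (m * 100 + 160) + 230) (fun hb => ?_) fun hb => ?_) ?_ fun s' h => h
  · refine ⟨by simp, fun r hr h1 h2 => ?_, by simp [hs.arr, hu], by simp [hs.arr, hv],
      by simp [hs.arr, hu], by simp [hs.arr, hv]⟩
    simp; grind
  · rw [h₁.2.1 9 (by norm_num) (by norm_num) (by norm_num), hs.reg 9 (by norm_num), h9]
    omega
  · obtain ⟨a1, a2, a21, a22, a60, a61⟩ := h₁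
    obtain ⟨b1, b2, b62, b63⟩ := h₂
    have hr9 : s₁.reg 9 = 2 * m := by
      rw [a2 9 (by norm_num) (by norm_num) (by norm_num), hs.reg 9 (by norm_num), h9]
    have c1 : s₂.arr = s.arr := b1.trans a1
    have c2 : ∀ r < 60, r ≠ 21 → r ≠ 22 → s₂.reg r = s.reg r := fun r h h' h'' =>
      (b2 r (by omega)).trans (a2 r h h' h'')
    have c10 : s₂.reg 10 = m := by
      rw [c2 10 (by norm_num) (by norm_num) (by norm_num), hs.reg 10 (by norm_num)]
    have c20 : s₂.reg 20 = s.reg 20 := c2 20 (by norm_num) (by norm_num) (by norm_num)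
    have c3 : s₂.routing = s.routing := by simp [Memory.routing, c1]
    rw [hr9, a60, a1] at b62
    rw [hr9, a60, a61, a1] at b63
    simp only [Test.Holds, Expr.eval, b62] at hb
    rw [c2 6 (by norm_num) (by norm_num) (by norm_num), hs.reg 6 (by norm_num)] at hb
    obtain ⟨hcap, hunt⟩ := hb
    have hunt := b63.1 hunt
    have hrow2 : IsRow H s₂ (s₂.reg 20) (Q u v) := by
      rw [c20]
      refine hrow.congr ?_ ?_ ?_ ?_ ?_ <;> rw [c1] <;> simp [hs.arr]
    refine Comp.mono (Comp.seq ((comp_rowScan s₂ hrow2 ?_).mono (c₂ := Z * (m * 100 + 100) + 50)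
      ?_ fun _ h => h) fun s₃ h₃ => Comp.ite (c := Z * 60 + 160) (fun hb => ?_) fun hb => ?_) ?_
      fun _ h => h
    · intro k hk z hz
      rw [c10] at hk
      rw [c3] at hz
      rw [c1, hs.arr 16 (by norm_num), hs.arr 10 (by norm_num)]
      exact hs.index k hk z hz
    · rw [c10]
      have := Nat.mul_le_mul_right (m * 100 + 100) hlen
      omega
    · obtain ⟨d1, d2, d3⟩ := h₃
      simp only [Test.Holds, Expr.eval] at hb
      rcases d3 with ⟨d3, -⟩ | ⟨-, k, hk, z, i, hi, hz, hcz, hfirst, hw, d46, d47, d48⟩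
      · omega
      rw [c10] at hk
      rw [c3] at hz
      rw [c1, hs.arr 10 (by norm_num)] at hcz
      simp only [c1, hs.arr 10 (by norm_num : 10 < 17), c10, c3] at hfirst
      rw [c20, c1, hs.arr 12 (by norm_num), ← hu] at hw
      -- The vertices in the table were computed in H. The prefix is also a walk in G, and its end
      -- is unique.
      have hwG : IsWalk G u ((Q u v).take i) (s₃.reg 49) := by
        obtain ⟨w, hw'⟩ := (hQ.isTrail u huS v hvS huv).2.2.exists_take i
        rwa [← (hw'.mono hGH).right_unique hw]
      have e1 : s₃.arr = s.arr := d1.trans c1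
      have e3 : s₃.routing = s.routing := by simp [Memory.routing, e1]
      have hstep := hs.valid.step hQ (d := if s₀.arr 11 z = s₃.reg 49 then 1 else 0) hk huS hvS huv
        hcap hunt hi hwG hz hcz hfirst (by split_ifs with h <;> simp [h])
      refine Comp.mono (Comp.seq ((comp_rerouteStep (k := k)
        (d := if s₀.arr 11 z = s₃.reg 49 then 1 else 0) s₃ d47 ?_ ?_).mono
        (c₂ := Z * 60 + 150) ?_ fun _ h => h) fun s₄ h₄ => Comp.flat (c := 10) ?_) (by omega)
        fun _ h => h
      · rw [d46, e1]; exact hz.2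
      · rw [d46, e1, hs.arr 11 (by norm_num)]
        split_ifs with h <;> simp [h]
      · have h1 := s.routing.pos_sub_le_size hk
        have h2 : s.arr 20 (2 * k + 1) - z ≤ s.routing.pos (2 * k + 1) - s.routing.pos (2 * k) :=
          Nat.sub_le_sub_left hz.1 _
        have h3 : s.arr 19 (2 * k + 1) ≤ Z := by
          rcases hs.valid.len_valid (2 * k + 1) (by omega) with h | ⟨h, h', h''⟩
          · have : s.arr 19 (2 * k + 1) = 0 := h
            omega
          · exact h''.trans (hQZ _ (hs.valid.root_mem _ (by omega)) _ h h')
        rw [e1, d46, d48]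
        omega
      · obtain ⟨f1, f2, f3⟩ := h₄
        have g21 : s₃.reg 21 = u := by rw [d2 21 (by norm_num), b2 21 (by norm_num), a21]
        have g22 : s₃.reg 22 = v := by rw [d2 22 (by norm_num), b2 22 (by norm_num), a22]
        rw [g21, g22, d48, d46, e3] at f3
        have f4 : (Program.exec (.setReg 23 (.num 1)) s₄).routing = s.routing.step u v i k z
          (if s₀.arr 11 z = s₃.reg 49 then 1 else 0) := f3
        refine ⟨⟨fun r hr => ?_, fun a ha => ?_, ?_, fun k' hk' z' hz' => ?_⟩, ?_, Or.inr ⟨by simp, ?_⟩⟩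
        · have : r ≠ 23 := by omega
          simp only [Program.exec, Memory.setReg_reg, if_neg this]
          rw [f1 r (by omega), d2 r (by omega), c2 r (by omega) (by omega) (by omega), hs.reg r hr]
        · simp only [Program.exec, Memory.setReg_arr]
          rw [f2 a ha, e1, hs.arr a ha]
        · rw [f4]; exact hstep.1
        · rw [f4] at hz'
          exact hs.index k' hk' z' (Routing.inCore_of_step hz hz')
        · simp [f1 20 (by norm_num), d2 20 (by norm_num), c20]
        · rw [f4]; exact hstep.2
    · obtain ⟨d1, d2, d3⟩ := h₃
      simp only [Test.Holds, Expr.eval] at hb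
      have e1 : s₃.arr = s.arr := d1.trans c1
      have e3 : s₃.routing = s.routing := by simp [Memory.routing, e1]
      refine Comp.flat (c := Z * 60 + 160) ?_ rfl (by simp [Program.size])
      simp only [Program.exec]
      refine ⟨⟨fun r hr => ?_, fun a ha => ?_, ?_, ?_⟩, ?_, Or.inl ⟨?_, e3, fun _ _ => ?_⟩⟩
      · rw [d2 r (by omega), c2 r (by omega) (by omega) (by omega), hs.reg r hr]
      · rw [e1, hs.arr a ha]
      · rw [e3]; exact hs.valid
      · rw [e3]; exact hs.index
      · rw [d2 20 (by norm_num), c20]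
      · rw [d2 23 (by norm_num), c2 23 (by norm_num) (by norm_num) (by norm_num)]
      · rcases d3 with ⟨-, d3⟩ | ⟨d3, -⟩
        · simpa only [c1, hs.arr 10 (by norm_num : 10 < 17), c10, c3] using d3
        · exact absurd d3 hb
    · simp only [Test.cost, Expr.cost]
      have : Z * (m * 100 + 160) = Z * (m * 100 + 100) + Z * 60 := by ring
      omega
  · obtain ⟨a1, a2, a21, a22, a60, a61⟩ := h₁
    obtain ⟨b1, b2, b62, b63⟩ := h₂
    have hr9 : s₁.reg 9 = 2 * m := by
      rw [a2 9 (by norm_num) (by norm_num) (by norm_num), hs.reg 9 (by norm_num), h9]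
    have c1 : s₂.arr = s.arr := b1.trans a1
    have c2 : ∀ r < 60, r ≠ 21 → r ≠ 22 → s₂.reg r = s.reg r := fun r h h' h'' =>
      (b2 r (by omega)).trans (a2 r h h' h'')
    have c3 : s₂.routing = s.routing := by simp [Memory.routing, c1]
    rw [hr9, a60, a1] at b62
    rw [hr9, a60, a61, a1] at b63
    simp only [Test.Holds, Expr.eval, b62] at hb
    rw [c2 6 (by norm_num) (by norm_num) (by norm_num), hs.reg 6 (by norm_num)] at hb
    refine Comp.flat (c := Z * (m * 100 + 160) + 230) ?_ rfl (by simp [Program.size])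
    simp only [Program.exec]
    refine ⟨⟨fun r hr => ?_, fun a ha => ?_, ?_, ?_⟩, ?_,
      Or.inl ⟨?_, c3, fun h h' => absurd ⟨h, b63.2 h'⟩ hb⟩⟩
    · rw [c2 r (by omega) (by omega) (by omega), hs.reg r hr]
    · rw [c1, hs.arr a ha]
    · rw [c3]; exact hs.valid
    · rw [c3]; exact hs.index
    · exact c2 20 (by norm_num) (by norm_num) (by norm_num)
    · exact c2 23 (by norm_num) (by norm_num) (by norm_num)
  · simp only [Test.cost, Expr.cost]; omega

/-- Reroute as long as this is possible. -/
def rerouteAll : Program :=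
  .seq (.setReg 23 (.num 1)) (.loop (.eq (.reg 23) (.num 1))
    (.seq (.block [.setReg 23 (.num 0), .setReg 20 (.num 0)]) (.forLoop 20 7 rerouteRow)))

lemma IsRerouting.of_eq {s' : Memory} (hs : IsRerouting G S Q s₀ s)
    (h : ∀ r < 20, s'.reg r = s.reg r) (h' : s'.arr = s.arr) : IsRerouting G S Q s₀ s' := by
  have h3 : s'.routing = s.routing := by simp [Memory.routing, h']
  exact ⟨fun r hr => (h r hr).trans (hs.reg r hr), fun a ha => h' ▸ hs.arr a ha, h3 ▸ hs.valid,
    h3 ▸ hs.index⟩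

/-- A sweep that changes nothing certifies every linking trail as useless for the same routing,
which is terminality. Any other sweep shrinks the cores, so there are at most Z + 1 sweeps. Each
costs an amount linear in Z for fixed numbers of rows and cores, which makes this the quadratic
phase. -/
lemma comp_rerouteAll (hGH : G ≤ H) (hQ : Linkage G S Q) (hT : IsTable H S Q s)
    (h9 : s.reg 9 = 2 * s.reg 10) (hQZ : ∀ u ∈ S, ∀ v ∈ S, u ≠ v → (Q u v).length ≤ Z)
    (hsZ : s.routing.size (s.reg 10) ≤ Z) (hs : IsRerouting G S Q s s) :
    Comp rerouteAll s
      ((Z + 2) * (s.reg 7 * (s.reg 10 * 200 + Z * (s.reg 10 * 100 + 160) + 306) + 20)) fun s' =>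
        IsRerouting G S Q s s' ∧ s'.routing.Terminal S Q (s.arr 10) (s.reg 10) (s.reg 6) := by
  set c := s.reg 10 * 200 + Z * (s.reg 10 * 100 + 160) + 300 with hc
  -- While register 23 is 1, the measure n exceeds the size of the cores; once it is 0, the routing
  -- is terminal and n no longer matters.
  refine Comp.mono (Comp.flat_seq (c₁ := 3) (Comp.loop (c := 10 + (s.reg 7 * (c + 6) + 3))
    (fun n s' => IsRerouting G S Q s s' ∧
      ((s'.reg 23 = 1 ∧ s'.routing.size (s.reg 10) < n ∧ s'.routing.size (s.reg 10) ≤ Z) ∨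
      (s'.reg 23 = 0 ∧ s'.routing.Terminal S Q (s.arr 10) (s.reg 10) (s.reg 6)))) ?_
    (n := Z + 1) ⟨hs.of_eq (fun r hr => ?_) rfl, Or.inl ⟨by simp, ?_, hsZ⟩⟩ ?_)) ?_ fun _ h => h
  · rintro n s₁ ⟨hs₁, hcase⟩ hb
    simp only [Test.Holds, Expr.eval] at hb
    rcases hcase with ⟨-, hn, hnZ⟩ | ⟨h, -⟩
    swap
    · omega
    have h7 := hs₁.reg 7 (by norm_num)
    refine Comp.flat_seq (c₁ := 10) (Comp.forLoop (c := c) (fun k s' => IsRerouting G S Q s s' ∧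
      s'.reg 20 = k ∧ ((s'.reg 23 = 1 ∧
        s'.routing.size (s.reg 10) < s₁.routing.size (s.reg 10)) ∨
        (s'.reg 23 = 0 ∧ s'.routing = s₁.routing ∧ ∀ d < k,
          s₁.routing.Useless Q (s.arr 10) (s.reg 10) (s.reg 6) (s.arr 12 d) (s.arr 13 d))))
      0 (s.reg 7) (Nat.zero_le _) ?_ ?_ ?_ ?_)
    · rintro k s' ⟨h1, h2, -⟩
      exact ⟨h2, h1.reg 7 (by norm_num)⟩
    · refine ⟨hs₁.of_eq (fun r hr => ?_) rfl, by simp, Or.inr ⟨by simp, rfl, by simp⟩⟩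
      simp; grind
    · rintro k - hk s₂ ⟨h1, h2, h3⟩
      refine (comp_rerouteRow hGH hQ hT h9 hQZ ?_ h1 (h2 ▸ hk)).mono le_rfl ?_
      · rcases h3 with h3 | h3
        · omega
        · rw [h3.2.1]; exact hnZ
      · rintro s₃ ⟨i1, i2, i3⟩
        refine ⟨i1.of_eq (fun r hr => ?_) rfl, by simp [i2, h2], ?_⟩
        · have : r ≠ 20 := by omega
          simp [this]
        · have hrt : (s₃.setReg 20 (s₃.reg 20 + 1)).routing = s₃.routing := rfl
          simp only [hrt, Memory.setReg_reg]
          simp only [show ¬ (23 = 20) by norm_num, if_false]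
          rcases i3 with ⟨i3, i4, i5⟩ | ⟨i3, i4⟩
          · rw [i3, i4]
            rcases h3 with h3 | ⟨h3, h4, h5⟩
            · exact Or.inl h3
            -- The routing has not changed since the sweep began, so the verdicts on earlier rows
            -- still apply.
            · refine Or.inr ⟨h3, h4, fun d hd => ?_⟩
              rcases Nat.lt_succ_iff_lt_or_eq.1 hd with hd | rfl
              · exact h5 d hd
              · rwa [h4, h2] at i5
          · refine Or.inl ⟨i3, ?_⟩
            rcases h3 with h3 | h3
            · omega
            · rwa [h3.2.1] at i4
    · rintro s' ⟨h1, -, h3⟩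
      rcases h3 with h3 | ⟨h3, h4, h5⟩
      · exact ⟨s'.routing.size (s.reg 10) + 1, by omega, h1, Or.inl ⟨h3.1, by omega, by omega⟩⟩
      · refine ⟨0, by omega, h1, Or.inr ⟨h3, ?_⟩⟩
        intro u hu v hv huv
        obtain ⟨d, hd, rfl, rfl⟩ := hT.exists_row u hu v hv huv
        rw [h4]
        exact h5 d hd
  · have : r ≠ 23 := by omega
    simp [this]
  · exact Nat.lt_succ_of_le hsZ
  · rintro n s' ⟨h1, h2⟩ hb
    simp only [Test.Holds, Expr.eval] at hb
    rcases h2 with h2 | h2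
    · exact absurd h2.1 hb
    · exact ⟨h1, h2.2⟩
  · simp only [Test.cost, Expr.cost]
    have : s.reg 7 * (s.reg 10 * 200 + Z * (s.reg 10 * 100 + 160) + 306) = s.reg 7 * (c + 6) := by
      rw [hc]
    rw [this]
    ring_nf
    omega
end Reroute

/-! ### Multiplying and copying -/

section Copy

/-- Add the product of the registers `a` and `b` to register `d`. -/
def multiply (d a b : ℕ) : Program :=
  .seq (.setReg 30 (.num 0)) (.forLoop 30 a
    (.seq (.setReg 31 (.num 0)) (.forLoop 31 b (.setReg d (.succ (.reg d))))))

lemma comp_multiply {d a b : ℕ} (hd : d < 30) (ha : a < 30) (hb : b < 30) (had : a ≠ d)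
    (hbd : b ≠ d) (s : Memory) :
    Comp (multiply d a b) s (s.reg a * (s.reg b * 9 + 13) + 5) fun s' => s'.arr = s.arr ∧
      (∀ r < 30, r ≠ d → s'.reg r = s.reg r) ∧ s'.reg d = s.reg d + s.reg a * s.reg b := by
  refine Comp.mono (Comp.flat_seq (c₁ := 2) (Comp.forLoop (c := s.reg b * 9 + 7) (fun k s' =>
      s'.reg 30 = k ∧ s'.arr = s.arr ∧ (∀ r < 30, r ≠ d → s'.reg r = s.reg r) ∧
      s'.reg d = s.reg d + k * s.reg b) 0 (s.reg a) (Nat.zero_le _) ?_ ?_ ?_ fun s' h => h.2))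
    ?_ fun _ h => h
  · rintro k s' ⟨h1, -, h2, -⟩
    exact ⟨h1, h2 a ha had⟩
  · refine ⟨by simp, by simp, fun r hr _ => ?_, ?_⟩
    · have : r ≠ 30 := by omega
      simp [this]
    · have : d ≠ 30 := by omega
      simp [this]
  · rintro k - hk s₁ ⟨h1, h2, h3, h4⟩
    refine Comp.mono (Comp.flat_seq (c₁ := 2) (Comp.forLoop (c := 3) (fun l s' => s'.reg 31 = l ∧
      s'.reg 30 = k ∧ s'.arr = s.arr ∧ (∀ r < 30, r ≠ d → s'.reg r = s.reg r) ∧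
      s'.reg d = s.reg d + k * s.reg b + l) 0 (s.reg b) (Nat.zero_le _) ?_ ?_ ?_ ?_)) ?_ fun _ h => h
    · rintro l s' ⟨h1, -, -, h2, -⟩
      exact ⟨h1, h2 b hb hbd⟩
    · refine ⟨by simp, by simp [h1], by simp [h2], fun r hr hr' => ?_, ?_⟩
      · have : r ≠ 31 := by omega
        simp [this, h3 r hr hr']
      · have : d ≠ 31 := by omega
        simp [this, h4]
    · rintro l - hl s₂ ⟨i1, i2, i3, i4, i5⟩
      have h31 : 31 ≠ d := by omega
      have h30 : 30 ≠ d := by omega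
      refine Comp.flat ⟨by simp [h31, i1], by simp [h30, i2], by simp [i3], fun r hr hr' => ?_, ?_⟩
        rfl (by simp [Program.size, Expr.cost])
      · have : r ≠ 31 := by omega
        simp [this, hr', i4 r hr hr']
      · simp [h31.symm, i5]; omega
    · rintro s' ⟨-, i2, i3, i4, i5⟩
      refine ⟨by simp [i2], by simp [i3], fun r hr hr' => ?_, ?_⟩
      · have : r ≠ 30 := by omega
        simp [this, i4 r hr hr']
      · have : d ≠ 30 := by omega
        simp [this, i5]; ring
    · omega
  · have : s.reg b * 9 + 7 + 6 = s.reg b * 9 + 13 := rfl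
    rw [this, Nat.sub_zero]; omega

/-- Append a part of array `src` to array `dst`, in its order or (if `rev`) in reverse order. Walk
along its edges from the vertex in register 33 and store the vertices in array `vdst`. Register 34
becomes zero if this is not possible. -/
def copy (rev : Bool) (src dst vdst : ℕ) : Program :=
  .forLoop 30 31 (.block [
    .setReg 35 (.entry src (bif rev then .pred (.reg 32) else .reg 32)),
    .setArr dst (.reg 8) (.reg 35), .setArr vdst (.reg 8) (.reg 33),
    .ite (.eq (.entry 0 (.reg 35)) (.reg 33)) (.setReg 33 (.entry 1 (.reg 35)))
      (.ite (.eq (.entry 1 (.reg 35)) (.reg 33)) (.setReg 33 (.entry 0 (.reg 35)))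
        (.setReg 34 (.num 0))),
    .setReg 8 (.succ (.reg 8)),
    .setReg 32 (bif rev then .pred (.reg 32) else .succ (.reg 32))])

/-- The outcome of walking along `l`. -/
def WalkOutcome (H : Graph ℕ ℕ) (a o : ℕ) (l : List ℕ) (vs : ℕ → ℕ) (s' : Memory) : Prop :=
  (s'.reg 34 = 1 ∧ (∀ i < l.length, IsWalk H a (l.take i) (vs (o + i))) ∧ IsWalk H a l (s'.reg 33)) ∨
    (s'.reg 34 = 0 ∧ ∀ b, ¬ IsWalk H a l b)

/-- In reverse mode register 32 points one place beyond the edge to be read. The claim about walks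
is conditional and comes last, because copying to the output needs the edges only. -/
lemma comp_copy {rev : Bool} {src dst vdst : ℕ} (hsd : src ≠ dst) (hsv : src ≠ vdst)
    (hdv : dst ≠ vdst) (hd : 2 ≤ dst) (hv : 2 ≤ vdst) (s : Memory) (l : List ℕ)
    (h31 : s.reg 31 = s.reg 30 + l.length)
    (hl : ∀ i (h : i < l.length),
      s.arr src (bif rev then s.reg 32 - i - 1 else s.reg 32 + i) = l[i]) :
    Comp (copy rev src dst vdst) s (l.length * 66 + 3) fun s' =>
      (∀ r < 30, r ≠ 8 → s'.reg r = s.reg r) ∧ (∀ r, 36 ≤ r → s'.reg r = s.reg r) ∧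
      (∀ a, a ≠ dst → a ≠ vdst → s'.arr a = s.arr a) ∧
      s'.reg 8 = s.reg 8 + l.length ∧
      (∀ i (h : i < l.length), s'.arr dst (s.reg 8 + i) = l[i]) ∧
      (∀ i < s.reg 8, s'.arr dst i = s.arr dst i ∧ s'.arr vdst i = s.arr vdst i) ∧
      ∀ H : Graph ℕ ℕ, (∀ e ∈ l, H.IsLink e (s.arr 0 e) (s.arr 1 e)) → s.reg 33 ∈ V(H) →
        s.reg 34 = 1 → WalkOutcome H (s.reg 33) (s.reg 8) l (s'.arr vdst) s' := by
  refine Comp.mono (Comp.forLoop (c := 60) (fun y s' => ∃ n ≤ l.length, y = s.reg 30 + n ∧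
      s'.reg 30 = y ∧ s'.reg 31 = s.reg 31 ∧
      s'.reg 32 = (bif rev then s.reg 32 - n else s.reg 32 + n) ∧
      (∀ r < 30, r ≠ 8 → s'.reg r = s.reg r) ∧ (∀ r, 36 ≤ r → s'.reg r = s.reg r) ∧
      (∀ a, a ≠ dst → a ≠ vdst → s'.arr a = s.arr a) ∧
      s'.reg 8 = s.reg 8 + n ∧
      (∀ i (h : i < l.length), i < n → s'.arr dst (s.reg 8 + i) = l[i]) ∧
      (∀ i < s.reg 8, s'.arr dst i = s.arr dst i ∧ s'.arr vdst i = s.arr vdst i) ∧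
      ∀ H : Graph ℕ ℕ, (∀ e ∈ l, H.IsLink e (s.arr 0 e) (s.arr 1 e)) → s.reg 33 ∈ V(H) →
        s.reg 34 = 1 → WalkOutcome H (s.reg 33) (s.reg 8) (l.take n) (s'.arr vdst) s')
      (s.reg 30) (s.reg 31) (by omega) ?_ ?_ ?_ ?_) ?_ fun _ h => h
  · rintro k s' ⟨n, -, -, h1, h2, -⟩
    exact ⟨h1, h2⟩
  · refine ⟨0, Nat.zero_le _, rfl, rfl, rfl, by simp, fun _ _ _ => rfl, fun _ _ => rfl,
      fun _ _ _ => rfl, rfl, fun i _ h => by omega, fun _ _ => ⟨rfl, rfl⟩, fun H _ hV h34 => ?_⟩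
    exact Or.inl ⟨h34, by simp, by simpa [IsWalk] using hV⟩
  · rintro y - hy s₁ ⟨n, -, rfl, h30, h31', h32, hreg, hreg', harr, h8, hdst, hold, hwalk⟩
    have hn : n < l.length := by omega
    have hedge := hl n hn
    set e := l[n] with he
    have hv0 : s₁.arr 0 = s.arr 0 := harr 0 (by omega) (by omega)
    have hv1 : s₁.arr 1 = s.arr 1 := harr 1 (by omega) (by omega)
    have hsrc : s₁.arr src = s.arr src := harr src hsd hsv
    set s₂ := Program.exec (.block [
      .setReg 35 (.entry src (bif rev then .pred (.reg 32) else .reg 32)),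
      .setArr dst (.reg 8) (.reg 35), .setArr vdst (.reg 8) (.reg 33)]) s₁ with hs₂
    have g35 : s₂.reg 35 = e := by
      cases rev <;> simp_all [Nat.sub_sub]
    have gr : ∀ r, r ≠ 35 → s₂.reg r = s₁.reg r := by
      intro r hr
      simp [hs₂, hr]
    have ga : ∀ a i, s₂.arr a i = if a = vdst ∧ i = s₁.reg 8 then s₁.reg 33 else
        if a = dst ∧ i = s₁.reg 8 then e else s₁.arr a i := by
      intro a i
      have : s₁.arr src (Expr.eval s₁ (bif rev then .pred (.reg 32) else .reg 32)) = e := by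
        simpa [hs₂] using g35
      simp only [hs₂, Program.block, Program.exec, Memory.setArr_arr_apply]
      simp [this]
    have ga0 : s₂.arr 0 e = s.arr 0 e := by
      rw [ga, if_neg (by omega), if_neg (by omega), hv0]
    have ga1 : s₂.arr 1 e = s.arr 1 e := by
      rw [ga, if_neg (by omega), if_neg (by omega), hv1]
    -- the new vertex
    set s₃ := Program.exec (.ite (.eq (.entry 0 (.reg 35)) (.reg 33)) (.setReg 33 (.entry 1 (.reg 35)))
      (.ite (.eq (.entry 1 (.reg 35)) (.reg 33)) (.setReg 33 (.entry 0 (.reg 35)))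
        (.setReg 34 (.num 0)))) s₂ with hs₃
    have hs₃' : s₃.arr = s₂.arr ∧ (∀ r, r ≠ 33 → r ≠ 34 → s₃.reg r = s₂.reg r) ∧
        ((s.arr 0 e = s₁.reg 33 ∧ s₃.reg 33 = s.arr 1 e ∧ s₃.reg 34 = s₁.reg 34) ∨
         (s.arr 1 e = s₁.reg 33 ∧ s₃.reg 33 = s.arr 0 e ∧ s₃.reg 34 = s₁.reg 34) ∨
         (s.arr 0 e ≠ s₁.reg 33 ∧ s.arr 1 e ≠ s₁.reg 33 ∧ s₃.reg 34 = 0)) := by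
      have g33 := gr 33 (by norm_num)
      have g34 := gr 34 (by norm_num)
      simp only [Program.exec] at hs₃
      split_ifs at hs₃ with c1 c2 <;> simp only [Test.check_iff, Test.Holds, Expr.eval, g35, ga0,
        ga1, g33] at * <;> rw [hs₃]
      · exact ⟨rfl, fun r h h' => by simp [h], Or.inl ⟨c1, by simp, by simp [g34]⟩⟩
      · exact ⟨rfl, fun r h h' => by simp [h], Or.inr (Or.inl ⟨c2, by simp, by simp [g34]⟩)⟩
      · exact ⟨rfl, fun r h h' => by simp [h'], Or.inr (Or.inr ⟨c1, c2, by simp⟩)⟩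
    obtain ⟨g3a, g3r, g3⟩ := hs₃'
    refine Comp.mono (Comp.exec (by cases rev <;> rfl)) (by cases rev <;> simp [Program.size, Expr.cost, Test.cost]) ?_
    rintro s' rfl
    have hexec : Program.exec (.block [
        .setReg 35 (.entry src (bif rev then .pred (.reg 32) else .reg 32)),
        .setArr dst (.reg 8) (.reg 35), .setArr vdst (.reg 8) (.reg 33),
        .ite (.eq (.entry 0 (.reg 35)) (.reg 33)) (.setReg 33 (.entry 1 (.reg 35)))
          (.ite (.eq (.entry 1 (.reg 35)) (.reg 33)) (.setReg 33 (.entry 0 (.reg 35)))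
            (.setReg 34 (.num 0))),
        .setReg 8 (.succ (.reg 8)),
        .setReg 32 (bif rev then .pred (.reg 32) else .succ (.reg 32))]) s₁ =
        Program.exec (.seq (.setReg 8 (.succ (.reg 8)))
          (.setReg 32 (bif rev then .pred (.reg 32) else .succ (.reg 32)))) s₃ := rfl
    rw [hexec]
    have k8 : s₃.reg 8 = s.reg 8 + n := by
      rw [g3r 8 (by norm_num) (by norm_num), gr 8 (by norm_num), h8]
    have k30 : s₃.reg 30 = s.reg 30 + n := by
      rw [g3r 30 (by norm_num) (by norm_num), gr 30 (by norm_num), h30]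
    have k31 : s₃.reg 31 = s.reg 31 := by
      rw [g3r 31 (by norm_num) (by norm_num), gr 31 (by norm_num), h31']
    have k32 : s₃.reg 32 = (bif rev then s.reg 32 - n else s.reg 32 + n) := by
      rw [g3r 32 (by norm_num) (by norm_num), gr 32 (by norm_num), h32]
    refine ⟨n + 1, hn, rfl, by simp [k30, add_assoc], by simp [k31], ?_, fun r hr hr8 => ?_,
      fun r hr => ?_, fun a had hav => ?_, by simp [k8, add_assoc], fun i hi hin => ?_,
      fun i hi => ?_, fun H hH hV h34 => ?_⟩
    · cases rev <;> simp [k32] <;> omega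
    · have a1 : r ≠ 30 := by omega
      have a2 : r ≠ 32 := by omega
      simp only [Program.exec, Memory.setReg_reg, if_neg a1, if_neg a2, if_neg hr8]
      rw [g3r r (by omega) (by omega), gr r (by omega), hreg r hr hr8]
    · have a1 : r ≠ 30 := by omega
      have a2 : r ≠ 32 := by omega
      have a3 : r ≠ 8 := by omega
      simp only [Program.exec, Memory.setReg_reg, if_neg a1, if_neg a2, if_neg a3]
      rw [g3r r (by omega) (by omega), gr r (by omega), hreg' r hr]
    · funext i
      simp only [Program.exec, Memory.setReg_arr, g3a, ga]
      rw [if_neg (by tauto), if_neg (by tauto), harr a had hav]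
    · simp only [Program.exec, Memory.setReg_arr, g3a, ga, h8]
      rw [if_neg (by tauto)]
      rcases Nat.lt_succ_iff_lt_or_eq.1 hin with hin | rfl
      · rw [if_neg (by omega), hdst i hi hin]
      · rw [if_pos (by simp)]
    · simp only [Program.exec, Memory.setReg_arr, g3a, ga, h8]
      rw [if_neg (by omega), if_neg (by omega), if_neg (by omega), if_neg (by omega)]
      exact hold i hi
    · have hlink := hH e (List.getElem_mem hn)
      set s₄ := Memory.setReg _ 30 _ with hs₄
      have m34 : s₄.reg 34 = s₃.reg 34 := by simp [hs₄]
      have m33 : s₄.reg 33 = s₃.reg 33 := by simp [hs₄]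
      have mv : ∀ i, s₄.arr vdst i = if i = s.reg 8 + n then s₁.reg 33 else s₁.arr vdst i := by
        intro i
        simp only [hs₄, Program.exec, Memory.setReg_arr, g3a, ga, h8]
        by_cases hi : i = s.reg 8 + n <;> simp [hi, hdv.symm]
      -- If the walk has not failed so far, the next edge either has the current vertex as one of
      -- its two stored ends or makes the walk fail. A failure is permanent, as a prefix that is no
      -- walk has no extension that is one.
      rcases hwalk H hH hV h34 with ⟨w1, w2, w3⟩ | ⟨w1, w2⟩
      · have hpre : ∀ i < n + 1, IsWalk H (s.reg 33) ((l.take (n + 1)).take i)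
            (s₄.arr vdst (s.reg 8 + i)) := by
          intro i hi
          rw [mv, List.take_take, min_eq_left hi.le]
          rcases Nat.lt_succ_iff_lt_or_eq.1 hi with hi | rfl
          · rw [if_neg (by omega)]
            have := w2 i (by rw [List.length_take]; omega)
            rwa [List.take_take, min_eq_left hi.le] at this
          · rw [if_pos rfl]; exact w3
        have hlen : (l.take (n + 1)).length = n + 1 := by rw [List.length_take]; omega
        rcases g3 with ⟨g1, g2, g3⟩ | ⟨g1, g2, g3⟩ | ⟨g1, g2, g3⟩
        · refine Or.inl ⟨by rw [m34, g3, w1], by rwa [hlen], ?_⟩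
          rw [m33, g2]
          exact (isWalk_take_succ hn).2 ⟨_, w3, g1 ▸ hlink⟩
        · refine Or.inl ⟨by rw [m34, g3, w1], by rwa [hlen], ?_⟩
          rw [m33, g2]
          exact (isWalk_take_succ hn).2 ⟨_, w3, g1 ▸ hlink.symm⟩
        · refine Or.inr ⟨by rw [m34, g3], fun b hb => ?_⟩
          obtain ⟨b', hb1, hb2⟩ := (isWalk_take_succ hn).1 hb
          obtain rfl := w3.right_unique hb1
          rcases hb2.eq_and_eq_or_eq_and_eq hlink with ⟨h, -⟩ | ⟨h, -⟩
          · exact g1 h.symm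
          · exact g2 h.symm
      · refine Or.inr ⟨?_, fun b hb => ?_⟩
        · rw [m34]; omega
        · obtain ⟨b', hb1, hb2⟩ := (isWalk_take_succ hn).1 hb
          exact w2 b' hb1
  · rintro s' ⟨n, hn, hy, -, -, -, h1, h2, h3, h4, h5, h6, h7⟩
    obtain rfl : n = l.length := by omega
    refine ⟨h1, h2, h3, h4, fun i hi => h5 i hi hi, h6, ?_⟩
    rwa [List.take_length] at h7
  · rw [h31, Nat.add_sub_cancel_left]
end Copy

/-! ### Writing the table -/

section Table

/-- Array `a` contains the lists in `L`, one after the other, and array `b` their positions. -/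
def Memory.Stores (s : Memory) (a b : ℕ) (L : List (List ℕ)) : Prop :=
  ∀ p (h : p < L.length), s.arr b (p + 1) = s.arr b p + L[p].length ∧
    ∀ i (hi : i < L[p].length), s.arr a (s.arr b p + i) = L[p][i]

/-- The arrays 10 to 15 contain the walks `w` between `u` and `v`, for `(u, v, w) ∈ L`. -/
structure IsRows (H : Graph ℕ ℕ) (s : Memory) (L : List (ℕ × ℕ × List ℕ)) : Prop where
  length : s.reg 7 = L.length
  row : ∀ d (h : d < L.length), s.arr 12 d = L[d].1 ∧ s.arr 13 d = L[d].2.1 ∧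
    IsRow H s d L[d].2.2 ∧ s.arr 15 d < s.reg 8

lemma IsRows.of_eq {H : Graph ℕ ℕ} {s s' : Memory} {L : List (ℕ × ℕ × List ℕ)} (h : IsRows H s L)
    (h7 : s'.reg 7 = s.reg 7) (h8 : s'.reg 8 = s.reg 8)
    (ha : ∀ a, 10 ≤ a → a < 16 → s'.arr a = s.arr a) : IsRows H s' L := by
  have h10 := ha 10 (by norm_num) (by norm_num)
  have h11 := ha 11 (by norm_num) (by norm_num)
  have h12 := ha 12 (by norm_num) (by norm_num)
  have h13 := ha 13 (by norm_num) (by norm_num)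
  have h14 := ha 14 (by norm_num) (by norm_num)
  have h15 := ha 15 (by norm_num) (by norm_num)
  refine ⟨h7.trans h.length, fun d hd => ?_⟩
  rw [h12, h13, h15, h8]
  obtain ⟨r1, r2, r3, r4⟩ := h.row d hd
  exact ⟨r1, r2, r3.congr (by simp [h10]) (by simp [h11]) (by rw [h12]) (by rw [h14]) (by rw [h15]),
    r4⟩

open scoped Classical in
/-- Reverse the list if it is not a walk from `u` to `v`. -/
noncomputable def orient (H : Graph ℕ ℕ) (u v : ℕ) (l : List ℕ) : List ℕ :=
  if IsWalk H u l v then l else l.reverse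

/-- Append a walk from the vertex in register 14 to the vertex in register 15 to the table. Its list
of edges, or the reverse of that, is the list number `reg 13` in the arrays `src` and `off`. -/
def writeRow (src off : ℕ) : Program :=
  .seq (.block [.setArr 12 (.reg 7) (.reg 14), .setArr 13 (.reg 7) (.reg 15),
    .setArr 14 (.reg 7) (.reg 8), .setReg 16 (.reg 8), .setReg 30 (.entry off (.reg 13)),
    .setReg 31 (.entry off (.succ (.reg 13))), .setReg 32 (.reg 30), .setReg 33 (.reg 14),
    .setReg 34 (.num 1)])
  (.seq (copy false src 10 11)
  (.seq (.ite (.and (.eq (.reg 34) (.num 1)) (.eq (.reg 33) (.reg 15))) .skip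
    (.seq (.block [.setReg 8 (.reg 16), .setReg 30 (.entry off (.reg 13)),
      .setReg 31 (.entry off (.succ (.reg 13))), .setReg 32 (.reg 31), .setReg 33 (.reg 14),
      .setReg 34 (.num 1)]) (copy true src 10 11)))
  (.block [.setArr 11 (.reg 8) (.reg 33), .setArr 15 (.reg 7) (.reg 8),
    .setReg 8 (.succ (.reg 8)), .setReg 7 (.succ (.reg 7))])))

/-- The list `l` can be copied as a walk from `u` to `v`. -/
structure IsCopyable (H : Graph ℕ ℕ) (s : Memory) (Z u v : ℕ) (l : List ℕ) : Prop where
  mem : u ∈ V(H)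
  isLink : ∀ e ∈ l, H.IsLink e (s.arr 0 e) (s.arr 1 e)
  isWalk : IsWalk H u l v ∨ IsWalk H u l.reverse v
  length_le : l.length ≤ Z

lemma IsCopyable.congr {H : Graph ℕ ℕ} {s s' : Memory} {Z u v : ℕ} {l : List ℕ}
    (h : IsCopyable H s Z u v l) (h0 : s'.arr 0 = s.arr 0) (h1 : s'.arr 1 = s.arr 1) :
    IsCopyable H s' Z u v l :=
  ⟨h.mem, by rw [h0, h1]; exact h.isLink, h.isWalk, h.length_le⟩

/-- A branch trail may be listed from either end, so it is first read forwards from u. If that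
fails, or ends at the wrong vertex, the attempt is overwritten by reading the list backwards; both
attempts fill the same cells. A row has one more vertex than edges and thus takes up length plus one
cells. -/
lemma comp_writeRow {H : Graph ℕ ℕ} {src off Z u v : ℕ} (hsrc : src < 10) (hoff : off < 10)
    (s : Memory) {L : List (ℕ × ℕ × List ℕ)} {l : List ℕ} (hL : IsRows H s L)
    (h14 : s.reg 14 = u) (h15 : s.reg 15 = v)
    (hst : s.arr off (s.reg 13 + 1) = s.arr off (s.reg 13) + l.length ∧
      ∀ i (hi : i < l.length), s.arr src (s.arr off (s.reg 13) + i) = l[i])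
    (hl : IsCopyable H s Z u v l) :
    Comp (writeRow src off) s (Z * 132 + 150) fun s' =>
      (∀ r < 30, r ≠ 7 → r ≠ 8 → r ≠ 16 → s'.reg r = s.reg r) ∧
      (∀ a, a < 10 ∨ 15 < a → s'.arr a = s.arr a) ∧
      IsRows H s' (L ++ [(u, v, orient H u v l)]) := by
  set o := s.reg 8 with ho
  set d := s.reg 7 with hd
  set w := orient H u v l with hw
  have hwl : w.length = l.length := by rw [hw, orient]; split_ifs <;> simp
  have hZ := hl.length_le
  refine Comp.mono (Comp.seq (c₁ := 60) (mid := fun s' =>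
      (∀ r < 30, r ≠ 16 → s'.reg r = s.reg r) ∧ s'.reg 16 = o ∧
      (∀ a, a ≠ 12 → a ≠ 13 → a ≠ 14 → s'.arr a = s.arr a) ∧
      s'.arr 12 = Function.update (s.arr 12) d u ∧ s'.arr 13 = Function.update (s.arr 13) d v ∧
      s'.arr 14 = Function.update (s.arr 14) d o ∧ s'.reg 30 = s.arr off (s.reg 13) ∧
      s'.reg 31 = s.arr off (s.reg 13 + 1) ∧ s'.reg 32 = s.arr off (s.reg 13) ∧
      s'.reg 33 = u ∧ s'.reg 34 = 1) (Comp.flat ?_ rfl (by simp [Program.size, Expr.cost]))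
      fun s₁ h₁ => Comp.seq (c₁ := Z * 66 + 3) (c₂ := Z * 66 + 50 + 25) (mid := fun s' =>
        (∀ r < 30, r ≠ 8 → s'.reg r = s₁.reg r) ∧
        (∀ a, a ≠ 10 → a ≠ 11 → s'.arr a = s₁.arr a) ∧
        s'.reg 8 = o + l.length ∧
        (∀ i (h : i < l.length), s'.arr 10 (o + i) = l[i]) ∧
        (∀ i < o, s'.arr 10 i = s.arr 10 i ∧ s'.arr 11 i = s.arr 11 i) ∧
        WalkOutcome H u o l (s'.arr 11) s') ?_ fun s₂ h₂ =>
      Comp.seq (c₁ := Z * 66 + 50) (c₂ := 25) (mid := fun s' =>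
        (∀ r < 30, r ≠ 8 → r ≠ 16 → s'.reg r = s.reg r) ∧
        (∀ a, a ≠ 10 → a ≠ 11 → s'.arr a = s₁.arr a) ∧
        s'.reg 8 = o + l.length ∧
        (∀ i (h : i < w.length), s'.arr 10 (o + i) = w[i]) ∧
        (∀ i < o, s'.arr 10 i = s.arr 10 i ∧ s'.arr 11 i = s.arr 11 i) ∧
        (∀ i < l.length, IsWalk H u (w.take i) (s'.arr 11 (o + i))) ∧ IsWalk H u w (s'.reg 33))
        (Comp.mono (Comp.ite (c := Z * 66 + 43) (fun hb => ?_) fun hb => ?_)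
          (by simp [Test.cost, Expr.cost]; omega) fun _ h => h)
        fun s₃ h₃ => Comp.flat ?_) (by omega) fun _ h => h
  · have n1 : off ≠ 12 := by omega
    have n2 : off ≠ 13 := by omega
    have n3 : off ≠ 14 := by omega
    refine ⟨fun r hr hr' => ?_, by simp [ho], fun a h12 h13 h14 => ?_, ?_, ?_, ?_, ?_, ?_, ?_, ?_, ?_⟩
    · simp; grind
    · simp [Memory.setArr_arr, h12, h13, h14]
    all_goals simp [Memory.setArr_arr, n1, n2, n3, h14, h15, hd, ho]
  · obtain ⟨a1, a2, a3, a12, a13, a14, a30, a31, a32, a33, a34⟩ := h₁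
    refine (comp_copy (by omega) (by omega) (by norm_num) (by norm_num) (by norm_num) s₁ l
      (by rw [a31, a30, hst.1]) fun i hi => ?_).mono (by omega) ?_
    · rw [a3 src (by omega) (by omega) (by omega), a32]; exact hst.2 i hi
    · rintro s' ⟨b1, -, b3, b4, b5, b6, b7⟩
      have a8 : s₁.reg 8 = o := a1 8 (by norm_num) (by norm_num)
      rw [a8] at b4 b5 b6 b7
      rw [a3 10 (by norm_num) (by norm_num) (by norm_num),
        a3 11 (by norm_num) (by norm_num) (by norm_num)] at b6
      rw [a33] at b7
      refine ⟨b1, b3, b4, b5, b6, b7 H ?_ hl.mem a34⟩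
      rw [a3 0 (by norm_num) (by norm_num) (by norm_num),
        a3 1 (by norm_num) (by norm_num) (by norm_num)]
      exact hl.isLink
  · obtain ⟨a1, a2, a3, a12, a13, a14, a30, a31, a32, a33, a34⟩ := h₁
    obtain ⟨b1, b3, b4, b5, b6, b7⟩ := h₂
    simp only [Test.Holds, Expr.eval] at hb
    have h15' : s₂.reg 15 = v := by
      rw [b1 15 (by norm_num) (by norm_num), a1 15 (by norm_num) (by norm_num), h15]
    rcases b7 with ⟨-, b7, b8⟩ | ⟨b7, -⟩
    swap
    · omega
    have hwalk : IsWalk H u l v := by rw [← h15', ← hb.2]; exact b8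
    have hwe : w = l := by rw [hw, orient, if_pos hwalk]
    refine Comp.mono (c₁ := 1) (post := fun s' => s' = s₂) ⟨_, _, .skip _, le_rfl, rfl⟩
      (by omega) ?_
    rintro s' rfl
    rw [hwe]
    exact ⟨fun r hr h h' => (b1 r hr h).trans (a1 r hr h'), b3, b4, b5, b6, b7, b8⟩
  · obtain ⟨a1, a2, a3, a12, a13, a14, a30, a31, a32, a33, a34⟩ := h₁
    obtain ⟨b1, b3, b4, b5, b6, b7⟩ := h₂
    simp only [Test.Holds, Expr.eval] at hb
    have h15' : s₂.reg 15 = v := by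
      rw [b1 15 (by norm_num) (by norm_num), a1 15 (by norm_num) (by norm_num), h15]
    have h13' : s₂.reg 13 = s.reg 13 := by
      rw [b1 13 (by norm_num) (by norm_num), a1 13 (by norm_num) (by norm_num)]
    -- If the list were a walk from u to v, the first attempt would have ended at v, by uniqueness.
    have hnot : ¬ IsWalk H u l v := by
      rcases b7 with ⟨b7, -, b8⟩ | ⟨-, b7⟩
      · intro h
        exact hb ⟨b7, by rw [h15']; exact b8.right_unique h⟩
      · exact b7 v
    have hrev := hl.isWalk.resolve_left hnot
    have hwe : w = l.reverse := by rw [hw, orient, if_neg hnot]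
    have hs₂off : s₂.arr off = s.arr off := by
      rw [b3 off (by omega) (by omega), a3 off (by omega) (by omega) (by omega)]
    have hs₂src : s₂.arr src = s.arr src := by
      rw [b3 src (by omega) (by omega), a3 src (by omega) (by omega) (by omega)]
    refine Comp.mono (Comp.seq (c₁ := 38) (mid := fun s' =>
      (∀ r < 30, r ≠ 8 → s'.reg r = s₂.reg r) ∧ s'.reg 8 = o ∧ s'.arr = s₂.arr ∧
      s'.reg 30 = s.arr off (s.reg 13) ∧ s'.reg 31 = s.arr off (s.reg 13 + 1) ∧
      s'.reg 32 = s.arr off (s.reg 13 + 1) ∧ s'.reg 33 = u ∧ s'.reg 34 = 1)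
      (Comp.flat ?_ rfl (by simp [Program.size, Expr.cost])) fun s₃ h₃ => Comp.mono
        (comp_copy (by omega) (by omega) (by norm_num) (by norm_num) (by norm_num) s₃ l.reverse ?_
        fun i hi => ?_) (c₂ := Z * 66 + 3) ?_ ?_) (by omega) fun _ h => h
    · have h16 : s₂.reg 16 = o := by rw [b1 16 (by norm_num) (by norm_num), a2]
      have h14' : s₂.reg 14 = u := by
        rw [b1 14 (by norm_num) (by norm_num), a1 14 (by norm_num) (by norm_num), h14]
      refine ⟨fun r hr h8 => ?_, ?_, ?_, ?_, ?_, ?_, ?_, ?_⟩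
      · simp; grind
      all_goals simp [h16, hs₂off, h13', h14']
    · rw [h₃.2.2.2.2.1, h₃.2.2.2.1, hst.1, List.length_reverse]
    · rw [List.length_reverse] at hi
      rw [h₃.2.2.1, hs₂src, h₃.2.2.2.2.2.1, hst.1, List.getElem_reverse]
      simp only [cond_true]
      rw [← hst.2 _ (by omega)]
      congr 1; omega
    · rw [List.length_reverse]; omega
    · rintro s' ⟨d1, -, d3, d4, d5, d6, d7⟩
      obtain ⟨c1, c8, c3, c30, c31, c32, c33, c34⟩ := h₃
      rw [c8] at d4 d5 d6 d7
      rw [c33, c3] at d7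
      rw [c3] at d6 d3
      have hlen := List.length_reverse (as := l)
      rw [hwe]
      have d7 := d7 H (fun e he => by
        rw [b3 0 (by norm_num) (by norm_num), b3 1 (by norm_num) (by norm_num),
          a3 0 (by norm_num) (by norm_num) (by norm_num),
          a3 1 (by norm_num) (by norm_num) (by norm_num)]
        exact hl.isLink e (List.mem_reverse.1 he)) hl.mem c34
      rcases d7 with ⟨-, d7, d8⟩ | ⟨-, d7⟩
      swap
      · exact absurd hrev (d7 v)
      refine ⟨fun r hr h h' => ?_, fun a h h' => (d3 a h h').trans (b3 a h h'), by rw [d4, hlen],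
        d5, fun i hi => ?_, by rwa [hlen] at d7, d8⟩
      · rw [d1 r hr h, c1 r hr h, b1 r hr h, a1 r hr h']
      · rw [(d6 i hi).1, (d6 i hi).2]; exact b6 i hi
  · obtain ⟨a1, a2, a3, a12, a13, a14, a30, a31, a32, a33, a34⟩ := h₁
    obtain ⟨c1, c2, c3, c4, c5, c6, c7⟩ := h₃
    have h7 : s₃.reg 7 = d := c1 7 (by norm_num) (by norm_num) (by norm_num)
    set s₄ := Program.exec _ s₃ with hs₄
    have f7 : s₄.reg 7 = d + 1 := by simp [hs₄, h7]
    have f8 : s₄.reg 8 = o + l.length + 1 := by simp [hs₄, c3]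
    have f10 : s₄.arr 10 = s₃.arr 10 := by simp [hs₄, Memory.setArr_arr]
    have f11 : s₄.arr 11 = Function.update (s₃.arr 11) (o + l.length) (s₃.reg 33) := by
      simp [hs₄, Memory.setArr_arr, c3]
    have f12 : s₄.arr 12 = Function.update (s.arr 12) d u := by
      rw [← a12, ← c2 12 (by norm_num) (by norm_num)]; simp [hs₄, Memory.setArr_arr]
    have f13 : s₄.arr 13 = Function.update (s.arr 13) d v := by
      rw [← a13, ← c2 13 (by norm_num) (by norm_num)]; simp [hs₄, Memory.setArr_arr]
    have f14 : s₄.arr 14 = Function.update (s.arr 14) d o := by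
      rw [← a14, ← c2 14 (by norm_num) (by norm_num)]; simp [hs₄, Memory.setArr_arr]
    have f15 : s₄.arr 15 = Function.update (s.arr 15) d (o + l.length) := by
      rw [← a3 15 (by norm_num) (by norm_num) (by norm_num), ← c2 15 (by norm_num) (by norm_num)]
      simp [hs₄, Memory.setArr_arr, h7, c3]
    refine ⟨fun r hr h7 h8 h16 => ?_, fun a ha => ?_, ?_, fun d' hd' => ?_⟩
    · rw [← c1 r hr h8 h16]
      simp [hs₄, h7, h8]
    · rw [← a3 a (by omega) (by omega) (by omega), ← c2 a (by omega) (by omega)]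
      have n1 : a ≠ 11 := by omega
      have n2 : a ≠ 15 := by omega
      simp [hs₄, Memory.setArr_arr, n1, n2]
    · rw [f7, List.length_append, ← hL.length]; rfl
    · rw [List.length_append, List.length_singleton, ← hL.length] at hd'
      rcases Nat.lt_succ_iff_lt_or_eq.1 hd' with hlt | rfl
      · have hlt' : d' < L.length := hL.length ▸ hlt
        obtain ⟨r1, r2, r3, r4⟩ := hL.row d' hlt'
        have hne : d' ≠ d := hlt.ne
        simp only [List.getElem_append_left hlt']
        rw [f12, f13, f15, Function.update_of_ne hne, Function.update_of_ne hne,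
          Function.update_of_ne hne]
        refine ⟨r1, r2, r3.congr (fun i hi => ?_) (fun i hi => ?_) ?_ ?_ ?_, by omega⟩
        · rw [f10, (c5 i (by omega)).1]
        · rw [f11, Function.update_of_ne (by omega), (c5 i (by omega)).2]
        · rw [f12, Function.update_of_ne hne]
        · rw [f14, Function.update_of_ne hne]
        · rw [f15, Function.update_of_ne hne]
      · have hget : (L ++ [(u, v, w)])[d]'(by
            rw [List.length_append, List.length_singleton, ← hL.length]; omega) = (u, v, w) := by
          simp [hL.length, hd]
        have hrow : s₄.arr 12 d = u ∧ s₄.arr 13 d = v ∧ IsRow H s₄ d w ∧ s₄.arr 15 d < s₄.reg 8 := by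
          refine ⟨by simp [f12], by simp [f13], ⟨by simp [f15, f14, hwl], fun i hi => ?_,
            fun i hi => ?_⟩, by simp [f15, f8]⟩
          · rw [f14, f10, Function.update_self]
            exact c4 i hi
          · rw [f14, f11, f12, Function.update_self, Function.update_self]
            -- The copying loop stores the vertex before each edge; the last vertex was written
            -- separately.
            rcases Nat.lt_or_ge i l.length with h | h
            · rw [Function.update_of_ne (by omega)]
              exact c6 i h
            · obtain rfl : i = l.length := by omega
              rw [Function.update_self, ← hwl, List.take_length]
              exact c7
        rw [hget]; exact hrow

/-- Write all branch trails of the given immersion to the table, in both directions. -/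
def trailRows : Program :=
  .seq (.block [.setReg 7 (.num 0), .setReg 8 (.num 0), .setReg 13 (.num 0), .setReg 11 (.num 0)])
  (.forLoop 11 4 (.seq (.setReg 12 (.num 0)) (.forLoop 12 11
    (.seq (.block [.setReg 14 (.entry 2 (.reg 12)), .setReg 15 (.entry 2 (.reg 11))])
    (.seq (writeRow 3 4)
    (.seq (.block [.setReg 14 (.entry 2 (.reg 11)), .setReg 15 (.entry 2 (.reg 12))])
    (.seq (writeRow 3 4) (.setReg 13 (.succ (.reg 13))))))))))

/-- The rows for the trails between the vertices number `x.1` and `x.2`. -/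
def rowPair (b : ℕ → ℕ) (Q : ℕ → ℕ → List ℕ) (x : ℕ × ℕ) : List (ℕ × ℕ × List ℕ) :=
  [(b x.1, b x.2, Q (b x.1) (b x.2)), (b x.2, b x.1, Q (b x.2) (b x.1))]

lemma pairList_prefix {j n : ℕ} (h : j ≤ n) : pairList j <+: pairList n := by
  induction n, h using Nat.le_induction with
  | base => exact List.prefix_rfl
  | succ n _ ih => rw [pairList_succ]; exact ih.trans (List.prefix_append _ _)

/-- The pairs with second entry j follow the block of all smaller pairs. Thus a counter of the
trails read so far always points to the trail for i, j. -/
lemma pairList_getElem {i j n : ℕ} (hij : i < j) (hj : j < n) :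
    ∃ h : (pairList j).length + i < (pairList n).length,
      (pairList n)[(pairList j).length + i] = (i, j) := by
  have h1 : (pairList j).length + i < (pairList (j + 1)).length := by
    rw [pairList_succ]; simpa using hij
  have h2 := (pairList_prefix (Nat.succ_le_of_lt hj))
  refine ⟨h1.trans_le h2.length_le, ?_⟩
  rw [← h2.getElem h1]
  simp [pairList_succ]

variable {H : Graph ℕ ℕ}

/-- Both directions of every trail are stored, since rerouting reads a row from its first vertex and
tests the capacity of that vertex only. -/
lemma comp_trailRows {Z : ℕ} (s : Memory) {T : List (List ℕ)} {Q : ℕ → ℕ → List ℕ}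
    (hst : s.Stores 3 4 T)
    (hT : ∀ p (h : p < (pairList (s.reg 4)).length) u v,
      s(u, v) = s(s.arr 2 (pairList (s.reg 4))[p].1, s.arr 2 (pairList (s.reg 4))[p].2) →
      ∃ h' : p < T.length, IsCopyable H s Z u v T[p] ∧ orient H u v T[p] = Q u v) :
    Comp trailRows s (s.reg 4 * (s.reg 4 * (Z * 264 + 340) + 20) + 30) fun s' =>
      (∀ r < 30, r ≠ 7 → r ≠ 8 → r ≠ 11 → r ≠ 12 → r ≠ 13 → r ≠ 14 → r ≠ 15 → r ≠ 16 →
        s'.reg r = s.reg r) ∧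
      (∀ a, a < 10 ∨ 15 < a → s'.arr a = s.arr a) ∧
      IsRows H s' ((pairList (s.reg 4)).flatMap (rowPair (s.arr 2) Q)) := by
  set n := s.reg 4 with hn
  refine Comp.mono (Comp.flat_seq (c₁ := 10) (Comp.forLoop (c := n * (Z * 264 + 340) + 10)
    (fun j s' => s'.reg 11 = j ∧ s'.reg 13 = (pairList j).length ∧
      (∀ r < 30, r ≠ 7 → r ≠ 8 → r ≠ 11 → r ≠ 12 → r ≠ 13 → r ≠ 14 → r ≠ 15 → r ≠ 16 →
        s'.reg r = s.reg r) ∧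
      (∀ a, a < 10 ∨ 15 < a → s'.arr a = s.arr a) ∧
      IsRows H s' ((pairList j).flatMap (rowPair (s.arr 2) Q))) 0 n (Nat.zero_le _) ?_ ?_ ?_
      fun s' h => h.2.2)) ?_ fun _ h => h
  · rintro k s' ⟨h1, -, h2, -⟩
    exact ⟨h1, h2 4 (by norm_num) (by norm_num) (by norm_num) (by norm_num) (by norm_num)
      (by norm_num) (by norm_num) (by norm_num) (by norm_num)⟩
  · refine ⟨by simp, by simp [pairList], fun r hr _ _ _ _ _ _ _ _ => ?_, fun a _ => by simp,
      by simp [pairList], fun d hd => ?_⟩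
    · simp; grind
    · simp [pairList] at hd
  · rintro j - hj s₁ ⟨h11, h13, hreg, harr, hrows⟩
    refine Comp.mono (Comp.flat_seq (c₁ := 3) (Comp.forLoop (c := Z * 264 + 330)
      (fun i s' => s'.reg 12 = i ∧ s'.reg 11 = j ∧ s'.reg 13 = (pairList j).length + i ∧
      (∀ r < 30, r ≠ 7 → r ≠ 8 → r ≠ 11 → r ≠ 12 → r ≠ 13 → r ≠ 14 → r ≠ 15 → r ≠ 16 →
        s'.reg r = s.reg r) ∧
      (∀ a, a < 10 ∨ 15 < a → s'.arr a = s.arr a) ∧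
      IsRows H s' ((pairList j ++ (List.range i).map fun i => (i, j)).flatMap
        (rowPair (s.arr 2) Q))) 0 j (Nat.zero_le _) ?_ ?_ ?_ ?_)) ?_ fun _ h => h
    · rintro k s' ⟨h1, h2, -⟩
      exact ⟨h1, h2⟩
    · refine ⟨by simp, by simp [h11], by simp [h13], fun r hr h1 h2 h3 h4 h5 h6 h7 h8 => ?_,
        fun a ha => ?_, ?_⟩
      · simp [h4]; exact hreg r hr h1 h2 h3 h4 h5 h6 h7 h8
      · simpa using harr a ha
      · simp only [List.range_zero, List.map_nil, List.append_nil]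
        exact hrows.of_eq (by simp) (by simp) fun a _ _ => by simp
    · rintro i - hij s₂ ⟨i12, i11, i13, ireg, iarr, irows⟩
      obtain ⟨hp, hpe⟩ := pairList_getElem hij hj
      have hT' := hT _ hp
      rw [hpe] at hT'
      obtain ⟨hpT, hc1, ho1⟩ := hT' _ _ rfl
      obtain ⟨_, hc2, ho2⟩ := hT' _ _ Sym2.eq_swap
      have h0 := iarr 0 (by norm_num)
      have h1 := iarr 1 (by norm_num)
      have h2 := iarr 2 (by norm_num)
      have hst' : ∀ s' : Memory, s'.reg 13 = (pairList j).length + i →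
          (∀ a, a < 10 ∨ 15 < a → s'.arr a = s.arr a) → _ := fun s' h13 ha =>
        show s'.arr 4 (s'.reg 13 + 1) = s'.arr 4 (s'.reg 13) + T[(pairList j).length + i].length ∧
          ∀ z (hz : z < T[(pairList j).length + i].length),
            s'.arr 3 (s'.arr 4 (s'.reg 13) + z) = T[(pairList j).length + i][z] by
        rw [h13, ha 3 (by norm_num), ha 4 (by norm_num)]; exact hst _ hpT
      refine Comp.mono (Comp.flat_seq (c₁ := 10) (Comp.seq (comp_writeRow (by norm_num)
        (by norm_num) _ (L := (pairList j ++ (List.range i).map fun i => (i, j)).flatMap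
        (rowPair (s.arr 2) Q)) (u := s.arr 2 i) (v := s.arr 2 j) ?_ ?_ ?_
        (hst' _ (by simp [i13]) (by simpa using iarr)) (hc1.congr (by simp [h0]) (by simp [h1])))
        fun s₃ h₃ => Comp.flat_seq (c₁ := 10) (Comp.seq (comp_writeRow (by norm_num)
        (by norm_num) _ (L := (pairList j ++ (List.range i).map fun i => (i, j)).flatMap
        (rowPair (s.arr 2) Q) ++ [(s.arr 2 i, s.arr 2 j, Q (s.arr 2 i) (s.arr 2 j))])
        (u := s.arr 2 j) (v := s.arr 2 i) ?_ ?_ ?_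
        (hst' _ ?_ ?_) (hc2.congr ?_ ?_))
        fun s₄ h₄ => Comp.flat (c := 5) ?_))) (by omega) fun _ h => h
      · exact irows.of_eq (by simp) (by simp) fun a _ _ => by simp
      · simp [h2, i12]
      · simp [h2, i11]
      · rw [ho1] at h₃
        exact h₃.2.2.of_eq (by simp) (by simp) fun a _ _ => by simp
      all_goals obtain ⟨k1, k2, k3⟩ := h₃
      · have := k1 11 (by norm_num) (by norm_num) (by norm_num) (by norm_num)
        simp [this, k2 2 (by norm_num), h2, i11]
      · have := k1 12 (by norm_num) (by norm_num) (by norm_num) (by norm_num)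
        simp [this, k2 2 (by norm_num), h2, i12]
      · have := k1 13 (by norm_num) (by norm_num) (by norm_num) (by norm_num)
        simp [this, i13]
      · intro a ha
        simpa using (k2 a ha).trans (iarr a ha)
      · simpa using (k2 0 (by norm_num)).trans h0
      · simpa using (k2 1 (by norm_num)).trans h1
      · obtain ⟨l1, l2, l3⟩ := h₄
        rw [ho2] at l3
        have hr : ∀ r < 30, r ≠ 7 → r ≠ 8 → r ≠ 14 → r ≠ 15 → r ≠ 16 → s₄.reg r = s₂.reg r := by
          intro r hr h7 h8 h14 h15 h16
          have := k1 r hr h7 h8 h16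
          have := l1 r hr h7 h8 h16
          simp_all
        have g11 := hr 11 (by norm_num) (by norm_num) (by norm_num) (by norm_num) (by norm_num) (by norm_num)
        have g12 := hr 12 (by norm_num) (by norm_num) (by norm_num) (by norm_num) (by norm_num) (by norm_num)
        have g13 := hr 13 (by norm_num) (by norm_num) (by norm_num) (by norm_num) (by norm_num) (by norm_num)
        refine ⟨by simp [g12, i12], by simp [g11, i11], by simp [g13, i13, add_assoc],
          fun r hr' h7 h8 h11 h12 h13 h14 h15 h16 => ?_, fun a ha => ?_, ?_⟩
        · simp [h12, h13, hr r hr' h7 h8 h14 h15 h16, ireg r hr' h7 h8 h11 h12 h13 h14 h15 h16]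
        · have := l2 a ha
          have := k2 a ha
          have := iarr a ha
          simp_all
        · have hL : (pairList j ++ (List.range (i + 1)).map fun i => (i, j)).flatMap
              (rowPair (s.arr 2) Q) = (pairList j ++ (List.range i).map fun i => (i, j)).flatMap
              (rowPair (s.arr 2) Q) ++ [(s.arr 2 i, s.arr 2 j, Q (s.arr 2 i) (s.arr 2 j))] ++
              [(s.arr 2 j, s.arr 2 i, Q (s.arr 2 j) (s.arr 2 i))] := by
            simp [List.range_succ, rowPair]
          rw [hL]
          exact l3.of_eq (by simp) (by simp) fun a _ _ => by simp
    · rintro s' ⟨-, h2, h3, h4, h5, h6⟩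
      rw [← pairList_succ] at h6
      refine ⟨by simp [h2], by simp [h3, pairList_succ], fun r hr h7 h8 h11 h12 h13 h14 h15 h16 => ?_,
        fun a ha => ?_, ?_⟩
      · simp [h11, h4 r hr h7 h8 h11 h12 h13 h14 h15 h16]
      · simpa using h5 a ha
      · exact h6.of_eq (by simp) (by simp) fun a _ _ => by simp
    · have : j * (Z * 264 + 330 + 6) ≤ n * (Z * 264 + 340) := Nat.mul_le_mul hj.le (by omega)
      simp only [Nat.sub_zero]
      omega
  · simp only [Nat.sub_zero]
    have : n * (n * (Z * 264 + 340) + 10 + 6) ≤ n * (n * (Z * 264 + 340) + 20) :=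
      Nat.mul_le_mul_left _ (by omega)
    omega

end Table

/-! ### Storing the circuits, the initial routing and the constants -/

section Prepare

/-- Write the given circuits to the table. -/
def circuitRows : Program :=
  .seq (.block [.setReg 17 (.reg 7), .setReg 13 (.num 0)]) (.forLoop 13 10
    (.seq (.block [.setReg 14 (.reg 3), .setReg 15 (.reg 3)]) (writeRow 5 6)))

variable {G H : Graph ℕ ℕ}

/-- The circuits follow the linking trails in the same arrays, so arrays 10 and 11 can serve as the
sequences of edges and vertices of the routing. Register 17 keeps the number of linking rows. -/
lemma comp_circuitRows {Z x : ℕ} (s : Memory) {L : List (ℕ × ℕ × List ℕ)} {C : List (List ℕ)}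
    (hL : IsRows H s L) (h3 : s.reg 3 = x) (h10 : s.reg 10 = C.length) (hst : s.Stores 5 6 C)
    (hC : ∀ c ∈ C, IsCopyable H s Z x x c ∧ IsWalk H x c x) :
    Comp circuitRows s (C.length * (Z * 132 + 180) + 20) fun s' =>
      (∀ r < 30, r ≠ 7 → r ≠ 8 → r ≠ 13 → r ≠ 14 → r ≠ 15 → r ≠ 16 → r ≠ 17 →
        s'.reg r = s.reg r) ∧
      s'.reg 17 = L.length ∧ (∀ a, a < 10 ∨ 15 < a → s'.arr a = s.arr a) ∧
      IsRows H s' (L ++ C.map fun c => (x, x, c)) := by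
  refine Comp.mono (Comp.flat_seq (c₁ := 10) (Comp.forLoop (c := Z * 132 + 160)
    (fun k s' => s'.reg 13 = k ∧ (∀ r < 30, r ≠ 7 → r ≠ 8 → r ≠ 13 → r ≠ 14 → r ≠ 15 → r ≠ 16 →
        r ≠ 17 → s'.reg r = s.reg r) ∧
      s'.reg 17 = L.length ∧ (∀ a, a < 10 ∨ 15 < a → s'.arr a = s.arr a) ∧
      IsRows H s' (L ++ (C.take k).map fun c => (x, x, c))) 0 C.length (Nat.zero_le _) ?_ ?_ ?_ ?_))
    ?_ fun _ h => h
  · rintro k s' ⟨h1, h2, -⟩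
    exact ⟨h1, by rw [h2 10 (by norm_num) (by norm_num) (by norm_num) (by norm_num) (by norm_num)
      (by norm_num) (by norm_num) (by norm_num), h10]⟩
  · refine ⟨by simp, fun r hr _ _ h13 _ _ _ h17 => by simp [h13, h17], by simp [hL.length],
      fun _ _ => by simp, ?_⟩
    simp only [List.take_zero, List.map_nil, List.append_nil]
    exact hL.of_eq (by simp) (by simp) fun a _ _ => by simp
  · rintro k - hk s₁ ⟨h13, hreg, h17, harr, hrows⟩
    have hr3 := hreg 3 (by norm_num) (by norm_num) (by norm_num) (by norm_num) (by norm_num)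
      (by norm_num) (by norm_num) (by norm_num)
    obtain ⟨hc1, hc2⟩ := hC _ (List.getElem_mem hk)
    refine Comp.mono (Comp.flat_seq (c₁ := 10) (comp_writeRow (by norm_num) (by norm_num) _
      (hrows.of_eq (by simp) (by simp) fun a _ _ => by simp) (u := x) (v := x) (l := C[k])
      (by simp [hr3, h3]) (by simp [hr3, h3]) ?_ (hc1.congr ?_ ?_))) (by omega) ?_
    · simpa [h13, harr 5 (by norm_num), harr 6 (by norm_num)] using hst k hk
    · simp [harr 0 (by norm_num)]
    · simp [harr 1 (by norm_num)]
    · rintro s' ⟨k1, k2, k3⟩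
      have g13 := k1 13 (by norm_num) (by norm_num) (by norm_num) (by norm_num)
      have g17 := k1 17 (by norm_num) (by norm_num) (by norm_num) (by norm_num)
      refine ⟨by simp [g13, h13], fun r hr i7 i8 i13 i14 i15 i16 i17 => ?_, by simp [g17, h17],
        fun a ha => ?_, ?_⟩
      · have := k1 r hr i7 i8 i16
        simp only [Memory.setReg_reg, if_neg i13, this]
        simp [i14, i15, hreg r hr i7 i8 i13 i14 i15 i16 i17]
      · simpa using (k2 a ha).trans (harr a ha)
      · rw [orient, if_pos hc2] at k3
        rw [List.take_succ_eq_append_getElem hk, List.map_append, ← List.append_assoc]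
        exact k3.of_eq (by simp) (by simp) fun a _ _ => by simp
  · rintro s' ⟨-, h1, h2, h3, h4⟩
    rw [List.take_length] at h4
    exact ⟨h1, h2, h3, h4⟩
  · rw [Nat.sub_zero]
    have : C.length * (Z * 132 + 160 + 6) ≤ C.length * (Z * 132 + 180) :=
      Nat.mul_le_mul_left _ (by omega)
    omega

/-- Initialize the routing to the given circuits, and array 16 to the positions of their edges. -/
def initRouting : Program :=
  .seq (.block [.setReg 11 (.num 0), .setReg 12 (.reg 17), .setReg 13 (.num 0)]) (.forLoop 11 10
    (.seq (.block [.setArr 20 (.reg 13) (.succ (.entry 14 (.reg 12))),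
      .setArr 20 (.succ (.reg 13)) (.pred (.entry 15 (.reg 12))),
      .setArr 17 (.reg 13) (.entry 11 (.succ (.entry 14 (.reg 12)))),
      .setArr 17 (.succ (.reg 13)) (.entry 11 (.pred (.entry 15 (.reg 12)))),
      .setReg 30 (.entry 14 (.reg 12)), .setReg 31 (.entry 15 (.reg 12))])
    (.seq (.forLoop 30 31 (.setArr 16 (.entry 10 (.reg 30)) (.reg 30)))
    (.block [.setReg 12 (.succ (.reg 12)), .setReg 13 (.succ (.succ (.reg 13)))]))))

/-- The shifts by one drop the two edges at x. Edge-disjointness of the circuits, in the form of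
`hinj`, ensures that no entry of array 16 is overwritten with a different position. -/
lemma comp_initRouting {Z nd m : ℕ} (s : Memory) (h17 : s.reg 17 = nd) (h10 : s.reg 10 = m)
    (hle : ∀ k < m, s.arr 14 (nd + k) ≤ s.arr 15 (nd + k) ∧
      s.arr 15 (nd + k) ≤ s.arr 14 (nd + k) + Z)
    (hinj : ∀ k < m, ∀ z, s.arr 14 (nd + k) ≤ z → z < s.arr 15 (nd + k) →
      ∀ k' < m, ∀ z', s.arr 14 (nd + k') ≤ z' → z' < s.arr 15 (nd + k') →
        s.arr 10 z = s.arr 10 z' → z = z') :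
    Comp initRouting s (m * (Z * 10 + 100) + 20) fun s' =>
      (∀ r < 30, r ≠ 11 → r ≠ 12 → r ≠ 13 → s'.reg r = s.reg r) ∧
      (∀ a < 16, s'.arr a = s.arr a) ∧ s'.arr 19 = s.arr 19 ∧
      (∀ k < m, s'.arr 20 (2 * k) = s.arr 14 (nd + k) + 1 ∧
        s'.arr 20 (2 * k + 1) = s.arr 15 (nd + k) - 1) ∧
      (∀ σ < 2 * m, s'.arr 17 σ = s.arr 11 (s'.arr 20 σ)) ∧
      ∀ k < m, ∀ z, s.arr 14 (nd + k) ≤ z → z < s.arr 15 (nd + k) → s'.arr 16 (s.arr 10 z) = z := by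
  refine Comp.mono (Comp.flat_seq (c₁ := 10) (Comp.forLoop (c := Z * 10 + 90) (fun n s' =>
      s'.reg 11 = n ∧ s'.reg 12 = nd + n ∧ s'.reg 13 = 2 * n ∧
      (∀ r < 30, r ≠ 11 → r ≠ 12 → r ≠ 13 → s'.reg r = s.reg r) ∧
      (∀ a < 16, s'.arr a = s.arr a) ∧ s'.arr 19 = s.arr 19 ∧
      (∀ k < n, s'.arr 20 (2 * k) = s.arr 14 (nd + k) + 1 ∧
        s'.arr 20 (2 * k + 1) = s.arr 15 (nd + k) - 1) ∧
      (∀ σ < 2 * n, s'.arr 17 σ = s.arr 11 (s'.arr 20 σ)) ∧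
      ∀ k < n, ∀ z, s.arr 14 (nd + k) ≤ z → z < s.arr 15 (nd + k) → s'.arr 16 (s.arr 10 z) = z)
      0 m (Nat.zero_le _) ?_ ?_ ?_ fun s' h => h.2.2.2)) ?_ fun _ h => h
  · rintro k s' ⟨h1, -, -, h2, -⟩
    exact ⟨h1, by rw [h2 10 (by norm_num) (by norm_num) (by norm_num) (by norm_num), h10]⟩
  · refine ⟨by simp, by simp [h17], by simp, fun r hr h1 h2 h3 => by simp [h1, h2, h3],
      fun a _ => by simp, by simp, by simp, by simp, by simp⟩
  · rintro n - hn s₁ ⟨i11, i12, i13, ireg, iarr, i19, ipos, iroot, iidx⟩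
    have j10 := iarr 10 (by norm_num)
    have j11 := iarr 11 (by norm_num)
    have j14 := iarr 14 (by norm_num)
    have j15 := iarr 15 (by norm_num)
    obtain ⟨hle1, hle2⟩ := hle n hn
    refine Comp.mono (Comp.seq (c₁ := 60) (mid := fun s' => s'.reg 30 = s.arr 14 (nd + n) ∧
      s'.reg 31 = s.arr 15 (nd + n) ∧ (∀ r < 30, s'.reg r = s₁.reg r) ∧
      (∀ a, a ≠ 17 → a ≠ 20 → s'.arr a = s₁.arr a) ∧
      (∀ k < n + 1, s'.arr 20 (2 * k) = s.arr 14 (nd + k) + 1 ∧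
        s'.arr 20 (2 * k + 1) = s.arr 15 (nd + k) - 1) ∧
      (∀ σ < 2 * (n + 1), s'.arr 17 σ = s.arr 11 (s'.arr 20 σ))) (Comp.flat ?_)
      fun s₂ h₂ => Comp.seq (c₁ := Z * 10 + 3) (mid := fun s' =>
        (∀ r < 30, s'.reg r = s₁.reg r) ∧
        (∀ a, a ≠ 16 → s'.arr a = s₂.arr a) ∧
        ∀ k < n + 1, ∀ z, s.arr 14 (nd + k) ≤ z → z < s.arr 15 (nd + k) →
          s'.arr 16 (s.arr 10 z) = z) ?_ fun s₃ h₃ => Comp.flat (c := 20) ?_) (by omega) fun _ h => h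
    · set s' := Program.exec _ s₁ with hs'
      have e20 : ∀ σ, s'.arr 20 σ = if σ = 2 * n + 1 then s.arr 15 (nd + n) - 1 else
          if σ = 2 * n then s.arr 14 (nd + n) + 1 else s₁.arr 20 σ := by
        intro σ
        simp [hs', Memory.setArr_arr, Function.update_apply, i12, i13, j14, j15]
      have e17 : ∀ σ, s'.arr 17 σ = if σ = 2 * n + 1 then s.arr 11 (s.arr 15 (nd + n) - 1) else
          if σ = 2 * n then s.arr 11 (s.arr 14 (nd + n) + 1) else s₁.arr 17 σ := by
        intro σ
        simp [hs', Memory.setArr_arr, Function.update_apply, i12, i13, j14, j15, j11]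
      refine ⟨by simp [hs', Memory.setArr_arr, i12, j14], by simp [hs', Memory.setArr_arr, i12, j15],
        fun r hr => ?_, fun a h1 h2 => by simp [hs', Memory.setArr_arr, h1, h2], fun k hk => ?_,
        fun σ hσ => ?_⟩
      · have n1 : r ≠ 30 := by omega
        have n2 : r ≠ 31 := by omega
        simp [hs', n1, n2]
      · rw [e20, e20]
        rcases Nat.lt_succ_iff_lt_or_eq.1 hk with hk | rfl
        · rw [if_neg (by omega), if_neg (by omega), if_neg (by omega), if_neg (by omega)]
          exact ipos k hk
        · simp
      · rw [e17, e20]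
        split_ifs with c1 c2
        · rfl
        · rfl
        · exact iroot σ (by omega)
    · obtain ⟨k30, k31, kreg, karr, kpos, kroot⟩ := h₂
      have l10 : s₂.arr 10 = s.arr 10 := (karr 10 (by norm_num) (by norm_num)).trans j10
      refine Comp.mono (Comp.forLoop (c := 4) (fun y s' => s'.reg 30 = y ∧
        s'.reg 31 = s.arr 15 (nd + n) ∧ (∀ r < 30, s'.reg r = s₁.reg r) ∧
        (∀ a, a ≠ 16 → s'.arr a = s₂.arr a) ∧
        (∀ k < n, ∀ z, s.arr 14 (nd + k) ≤ z → z < s.arr 15 (nd + k) →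
          s'.arr 16 (s.arr 10 z) = z) ∧
        ∀ z, s.arr 14 (nd + n) ≤ z → z < y → s'.arr 16 (s.arr 10 z) = z)
        (s.arr 14 (nd + n)) (s.arr 15 (nd + n)) hle1 ?_ ?_ ?_ ?_) ?_ fun _ h => h
      · rintro y s' ⟨h1, h2, -⟩
        exact ⟨h1, h2⟩
      · refine ⟨k30, k31, kreg, fun _ _ => rfl, ?_, fun z h1 h2 => by omega⟩
        rw [karr 16 (by norm_num) (by norm_num)]
        exact iidx
      · rintro y hy1 hy2 s' ⟨h1, h2, h3, h4, h5, h6⟩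
        have h10' : s'.arr 10 = s.arr 10 := (h4 10 (by norm_num)).trans l10
        have e16 : ∀ e, (Program.exec (.setArr 16 (.entry 10 (.reg 30)) (.reg 30)) s').arr 16 e =
            if e = s.arr 10 y then y else s'.arr 16 e := by
          intro e
          simp [Memory.setArr_arr, Function.update_apply, h10', h1]
        refine Comp.flat ⟨by simp [h1], by simp [h2], fun r hr => ?_, fun a ha => ?_,
          fun k hk z hz1 hz2 => ?_, fun z hz1 hz2 => ?_⟩
        · have : r ≠ 30 := by omega
          simp [this, h3 r hr]
        · simp [Memory.setArr_arr, ha, h4 a ha]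
        · rw [Memory.setReg_arr, e16]
          split_ifs with heq
          · exact (hinj k (by omega) z hz1 hz2 n hn y hy1 hy2 heq).symm
          · exact h5 k hk z hz1 hz2
        · rw [Memory.setReg_arr, e16]
          rcases Nat.lt_succ_iff_lt_or_eq.1 hz2 with hz2 | rfl
          · split_ifs with heq
            · exact (hinj n hn z hz1 (by omega) n hn y hy1 hy2 heq).symm
            · exact h6 z hz1 hz2
          · simp
      · rintro s' ⟨-, -, h3, h4, h5, h6⟩
        refine ⟨h3, h4, fun k hk z hz1 hz2 => ?_⟩
        rcases Nat.lt_succ_iff_lt_or_eq.1 hk with hk | rfl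
        · exact h5 k hk z hz1 hz2
        · exact h6 z hz1 hz2
      · have : s.arr 15 (nd + n) - s.arr 14 (nd + n) ≤ Z := by omega
        have := Nat.mul_le_mul_right 10 this
        omega
    · obtain ⟨k30, k31, kreg, karr, kpos, kroot⟩ := h₂
      obtain ⟨l1, l2, l3⟩ := h₃
      have g11 := l1 11 (by norm_num)
      have g12 := l1 12 (by norm_num)
      have g13 := l1 13 (by norm_num)
      refine ⟨by simp [g11, i11], by simp [g12, i12, add_assoc], by simp [g13, i13]; ring,
        fun r hr h1 h2 h3 => by simp [h1, h2, h3, l1 r hr, ireg r hr h1 h2 h3], fun a ha => ?_, ?_,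
        ?_, ?_, ?_⟩
      · simp [l2 a (by omega), karr a (by omega) (by omega), iarr a ha]
      · simp [l2 19 (by norm_num), karr 19 (by norm_num) (by norm_num), i19]
      · simpa [l2 20 (by norm_num)] using kpos
      · simpa [l2 20 (by norm_num), l2 17 (by norm_num)] using kroot
      · simpa using l3
  · rw [Nat.sub_zero]
    have : m * (Z * 10 + 90 + 6) ≤ m * (Z * 10 + 100) := Nat.mul_le_mul_left _ (by omega)
    omega

/-- Compute the numbers that depend on `t`. -/
def constants : Program :=
  .seq (.block [.setReg 11 (.num 1400), .setReg 12 (.num 20), .setReg 13 (.num 3500),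
    .setReg 14 (.num 2)])
  (.seq (multiply 4 0 11) (.seq (multiply 6 0 12) (.seq (multiply 15 0 0)
    (.seq (multiply 10 15 13) (multiply 9 10 14)))))

/-- Products are formed by repeated increments of registers that are still zero. The time depends on
t alone. -/
lemma comp_constants (s : Memory) {t : ℕ} (h0 : s.reg 0 = t) (hz : ∀ r, 4 ≤ r → s.reg r = 0) :
    Comp constants s (t * t * 200000 + t * 20000 + 100) fun s' => s'.arr = s.arr ∧
      (∀ r < 4, s'.reg r = s.reg r) ∧ s'.reg 4 = 1400 * t ∧ s'.reg 6 = 20 * t ∧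
      s'.reg 10 = 3500 * t ^ 2 ∧ s'.reg 9 = 2 * s'.reg 10 := by
  refine Comp.mono (Comp.seq (c₁ := 20) (mid := fun s' => s'.arr = s.arr ∧
      (∀ r < 30, r ≠ 11 → r ≠ 12 → r ≠ 13 → r ≠ 14 → s'.reg r = s.reg r) ∧ s'.reg 11 = 1400 ∧
      s'.reg 12 = 20 ∧ s'.reg 13 = 3500 ∧ s'.reg 14 = 2) (Comp.flat ?_)
    fun s₁ h₁ => Comp.seq ((comp_multiply (by norm_num) (by norm_num) (by norm_num) (by norm_num)
      (by norm_num) s₁).mono (c₂ := t * (1400 * 9 + 13) + 5) ?_ fun _ h => h) fun s₂ h₂ =>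
      Comp.seq ((comp_multiply (by norm_num) (by norm_num) (by norm_num) (by norm_num)
      (by norm_num) s₂).mono (c₂ := t * (20 * 9 + 13) + 5) ?_ fun _ h => h) fun s₃ h₃ =>
      Comp.seq ((comp_multiply (by norm_num) (by norm_num) (by norm_num) (by norm_num)
      (by norm_num) s₃).mono (c₂ := t * (t * 9 + 13) + 5) ?_ fun _ h => h) fun s₄ h₄ =>
      Comp.seq ((comp_multiply (by norm_num) (by norm_num) (by norm_num) (by norm_num)
      (by norm_num) s₄).mono (c₂ := t * t * (3500 * 9 + 13) + 5) ?_ fun _ h => h) fun s₅ h₅ =>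
      (comp_multiply (by norm_num) (by norm_num) (by norm_num) (by norm_num)
      (by norm_num) s₅).mono (c₂ := t * t * 3500 * (2 * 9 + 13) + 5) ?_ ?_) ?_ fun _ h => h
  · refine ⟨by simp, fun r hr h1 h2 h3 h4 => by simp [h1, h2, h3, h4], by simp, by simp, by simp,
      by simp⟩
  all_goals try obtain ⟨a1, a2, a3, a4, a5, a6⟩ := h₁
  all_goals try obtain ⟨b1, b2, b3⟩ := h₂
  all_goals try obtain ⟨c1, c2, c3⟩ := h₃
  all_goals try obtain ⟨d1, d2, d3⟩ := h₄
  all_goals try obtain ⟨e1, e2, e3⟩ := h₅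
  · rw [a3, a2 0, h0] <;> norm_num
  · rw [b2 0, b2 12, a4, a2 0, h0] <;> norm_num
  · rw [c2 0, b2 0, a2 0, h0] <;> norm_num
  · have : s₄.reg 15 = t * t := by
      rw [d3, c2 15, b2 15, a2 15, hz 15, c2 0, b2 0, a2 0, h0] <;> norm_num
    have h13 : s₄.reg 13 = 3500 := by
      rw [d2 13, c2 13, b2 13, a5] <;> norm_num
    rw [this, h13]
  · have h15 : s₄.reg 15 = t * t := by
      rw [d3, c2 15, b2 15, a2 15, hz 15, c2 0, b2 0, a2 0, h0] <;> norm_num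
    have h13 : s₄.reg 13 = 3500 := by
      rw [d2 13, c2 13, b2 13, a5] <;> norm_num
    have h10 : s₅.reg 10 = t * t * 3500 := by
      rw [e3, d2 10, c2 10, b2 10, a2 10, hz 10, h15, h13, zero_add] <;> norm_num
    have h14 : s₅.reg 14 = 2 := by
      rw [e2 14, d2 14, c2 14, b2 14, a6] <;> norm_num
    rw [h10, h14]
  · have h15 : s₄.reg 15 = t * t := by
      rw [d3, c2 15, b2 15, a2 15, hz 15, c2 0, b2 0, a2 0, h0] <;> norm_num
    have h13 : s₄.reg 13 = 3500 := by
      rw [d2 13, c2 13, b2 13, a5] <;> norm_num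
    have h10 : s₅.reg 10 = t * t * 3500 := by
      rw [e3, d2 10, c2 10, b2 10, a2 10, hz 10, h15, h13, zero_add] <;> norm_num
    have h14 : s₅.reg 14 = 2 := by
      rw [e2 14, d2 14, c2 14, b2 14, a6] <;> norm_num
    have h9 : s₅.reg 9 = 0 := by
      rw [e2 9, d2 9, c2 9, b2 9, a2 9, hz 9] <;> norm_num
    rintro s' ⟨f1, f2, f3⟩
    refine ⟨by rw [f1, e1, d1, c1, b1, a1], fun r hr => ?_, ?_, ?_, ?_, ?_⟩
    · rw [f2 r, e2 r, d2 r, c2 r, b2 r, a2 r] <;> omega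
    · rw [f2 4, e2 4, d2 4, c2 4, b3, a3, a2 4, hz 4, a2 0, h0] <;> norm_num; ring
    · rw [f2 6, e2 6, d2 6, c3, b2 6, a2 6, hz 6, b2 0, a2 0, b2 12, a4, h0] <;> norm_num; ring
    · rw [f2 10, h10] <;> norm_num; ring
    · rw [f3, f2 10, h9, h14] <;> norm_num; ring
  · have : t * (t * 9 + 13) = t * t * 9 + t * 13 := by ring
    omega

end Prepare

/-! ### From the stored rows to a linkage table and a valid routing -/

section Prepare

variable {G H : Graph ℕ ℕ}

lemma length_flatMap_rowPair (b : ℕ → ℕ) (Q : ℕ → ℕ → List ℕ) (l : List (ℕ × ℕ)) :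
    (l.flatMap (rowPair b Q)).length = 2 * l.length := by
  induction l with
  | nil => rfl
  | cons x l ih => simp [ih, rowPair]; ring

lemma isTable_of_isRows {s s' : Memory} {S : List ℕ} {Q : ℕ → ℕ → List ℕ} {b : ℕ → ℕ} {n : ℕ}
    {R : List (ℕ × ℕ × List ℕ)} (h : IsRows H s ((pairList n).flatMap (rowPair b Q) ++ R))
    (h7 : s'.reg 7 = ((pairList n).flatMap (rowPair b Q)).length)
    (ha : ∀ a, 10 ≤ a → a < 16 → s'.arr a = s.arr a)
    (hS : ∀ u, u ∈ S ↔ ∃ i < n, b i = u) (hb : ∀ i < n, ∀ j < n, b i = b j → i = j) :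
    IsTable H S Q s' := by
  set L := (pairList n).flatMap (rowPair b Q) with hL
  have h10 := ha 10 (by norm_num) (by norm_num)
  have h11 := ha 11 (by norm_num) (by norm_num)
  have h12 := ha 12 (by norm_num) (by norm_num)
  have h13 := ha 13 (by norm_num) (by norm_num)
  have h14 := ha 14 (by norm_num) (by norm_num)
  have h15 := ha 15 (by norm_num) (by norm_num)
  have hrow : ∀ d (hd : d < L.length), s'.arr 12 d = L[d].1 ∧ s'.arr 13 d = L[d].2.1 ∧
      IsRow H s' d L[d].2.2 := by
    intro d hd
    obtain ⟨r1, r2, r3, r4⟩ := h.row d (by rw [List.length_append]; omega)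
    rw [List.getElem_append_left hd] at r1 r2 r3
    rw [h12, h13]
    exact ⟨r1, r2, r3.congr (by simp [h10]) (by simp [h11]) (by rw [h12]) (by rw [h14])
      (by rw [h15])⟩
  have hmem : ∀ y ∈ L, ∃ i < n, ∃ j < n, i ≠ j ∧ y = (b i, b j, Q (b i) (b j)) := by
    intro y hy
    obtain ⟨⟨i, j⟩, hx, hy⟩ := List.mem_flatMap.1 hy
    have := mem_pairList.1 hx
    simp only [rowPair, List.mem_cons, List.not_mem_nil, or_false] at hy
    rcases hy with rfl | rfl
    · exact ⟨i, by omega, j, by omega, by omega, rfl⟩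
    · exact ⟨j, by omega, i, by omega, by omega, rfl⟩
  refine ⟨fun d hd => ?_, fun d hd => ?_, fun u hu v hv huv => ?_⟩
  · rw [h7] at hd
    obtain ⟨r1, r2, -⟩ := hrow d hd
    obtain ⟨i, hi, j, hj, hij, he⟩ := hmem _ (List.getElem_mem hd)
    rw [r1, r2, he]
    exact ⟨(hS _).2 ⟨i, hi, rfl⟩, (hS _).2 ⟨j, hj, rfl⟩, fun h => hij (hb i hi j hj h)⟩
  · rw [h7] at hd
    obtain ⟨r1, r2, r3⟩ := hrow d hd
    obtain ⟨i, hi, j, hj, hij, he⟩ := hmem _ (List.getElem_mem hd)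
    rw [r1, r2]
    rw [he] at r3 ⊢
    exact r3
  · obtain ⟨i, hi, rfl⟩ := (hS u).1 hu
    obtain ⟨j, hj, rfl⟩ := (hS v).1 hv
    have hin : (b i, b j, Q (b i) (b j)) ∈ L := by
      rcases lt_trichotomy i j with h | rfl | h
      · exact List.mem_flatMap.2 ⟨(i, j), mem_pairList.2 ⟨h, hj⟩, by simp [rowPair]⟩
      · exact absurd rfl huv
      · exact List.mem_flatMap.2 ⟨(j, i), mem_pairList.2 ⟨h, hi⟩, by simp [rowPair]⟩
    obtain ⟨d, hd, he⟩ := List.mem_iff_getElem.1 hin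
    obtain ⟨r1, r2, -⟩ := hrow d hd
    exact ⟨d, h7 ▸ hd, by rw [r1, he], by rw [r2, he]⟩

/-- Write the table and initialize the routing. -/
def prepare : Program :=
  .seq constants (.seq trailRows (.seq circuitRows (.seq initRouting (.setReg 7 (.reg 17)))))

/-- At the end register 7 is reset to the number of linking rows, so that later searches ignore the
rows of the circuits, while these still carry the positions of the cores. Array 19 is never written
here; its initial zeros are the empty arms. -/
lemma comp_prepare {t x Z : ℕ} {S : List ℕ} {Q : ℕ → ℕ → List ℕ} {T C : List (List ℕ)}
    (s : Memory) (ht : 1 ≤ t) (h0 : s.reg 0 = t) (h3 : s.reg 3 = x) (hz : ∀ r, 4 ≤ r → s.reg r = 0)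
    (h19 : ∀ i, s.arr 19 i = 0) (hst : s.Stores 3 4 T) (hst' : s.Stores 5 6 C)
    (hT : ∀ p (h : p < (pairList (1400 * t)).length) u v,
      s(u, v) = s(s.arr 2 (pairList (1400 * t))[p].1, s.arr 2 (pairList (1400 * t))[p].2) →
      ∃ h' : p < T.length, IsCopyable H s Z u v T[p] ∧ orient H u v T[p] = Q u v)
    (hS : ∀ u, u ∈ S ↔ ∃ i < 1400 * t, s.arr 2 i = u)
    (hb : ∀ i < 1400 * t, ∀ j < 1400 * t, s.arr 2 i = s.arr 2 j → i = j)
    (hH : IsApexExtension G {s | s ∈ S} (20 * t) x H) (hSG : ∀ s ∈ S, s ∈ V(G))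
    (hC : IsOddCircuitPacking H x C) (hlen : C.length = 3500 * t ^ 2)
    (hcopy : ∀ c ∈ C, IsCopyable H s Z x x c) :
    Comp prepare s (t ^ 2 * (Z + 2) * 600000000) fun s' =>
      s'.reg 0 = t ∧ s'.reg 4 = 1400 * t ∧ s'.reg 6 = 20 * t ∧ s'.reg 10 = 3500 * t ^ 2 ∧
      s'.reg 9 = 2 * s'.reg 10 ∧ s'.reg 7 ≤ 2 * (1400 * t * (1400 * t)) ∧
      (∀ a < 10, s'.arr a = s.arr a) ∧ IsTable H S Q s' ∧ IsRerouting G S Q s' s' := by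
  have hcirc := fun c (hc : c ∈ C) => (hC.1 c hc).1.isWalk hH hSG (hC.1 c hc).2
  set L := (pairList (1400 * t)).flatMap (rowPair (s.arr 2) Q) with hL
  set R := C.map fun c => (x, x, c) with hR
  have hCR : ∀ s' : Memory, IsRows H s' (L ++ R) → ∀ k (hk : k < C.length),
      s'.arr 12 (L.length + k) = x ∧ IsRow H s' (L.length + k) C[k] := by
    intro s' hs' k hk
    obtain ⟨r1, -, r2, -⟩ := hs'.row (L.length + k) (by simp [hR, hk])
    rw [List.getElem_append_right (by omega)] at r1 r2
    simp only [hR, List.getElem_map, Nat.add_sub_cancel_left] at r1 r2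
    exact ⟨r1, r2⟩
  refine Comp.mono (Comp.seq (comp_constants s h0 hz) fun s₁ h₁ => Comp.seq
    ((comp_trailRows (H := H) (Z := Z) (T := T) (Q := Q) s₁ ?_ ?_).mono
      (c₂ := 1400 * t * (1400 * t * (Z * 264 + 340) + 20) + 30) ?_ fun _ h => h) fun s₂ h₂ =>
    Comp.seq (comp_circuitRows (H := H) (Z := Z) (x := x) (L := L) (C := C) s₂ ?_ ?_ ?_ ?_ ?_)
    fun s₃ h₃ => Comp.seq (comp_initRouting (Z := Z) (nd := L.length) (m := C.length) s₃ ?_ ?_ ?_ ?_)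
    fun s₄ h₄ => Comp.flat (c := 2) ?_) ?_ fun _ h => h
  · rw [Memory.Stores, h₁.1]; exact hst
  · rw [h₁.2.2.1, h₁.1]
    intro p hp u v huv
    obtain ⟨h', hc, ho⟩ := hT p hp u v huv
    exact ⟨h', hc.congr (by rw [h₁.1]) (by rw [h₁.1]), ho⟩
  · rw [h₁.2.2.1]
  · rw [← h₁.1, ← h₁.2.2.1] at hL
    rw [hL]; exact h₂.2.2
  · rw [h₂.1 3, h₁.2.1 3, h3] <;> norm_num
  · rw [h₂.1 10, h₁.2.2.2.2.1, hlen] <;> norm_num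
  · rw [Memory.Stores, h₂.2.1 5 (by norm_num), h₂.2.1 6 (by norm_num), h₁.1]; exact hst'
  · intro c hc
    refine ⟨(hcopy c hc).congr ?_ ?_, (hcirc c hc).2.2.1⟩
    · rw [h₂.2.1 0 (by norm_num), h₁.1]
    · rw [h₂.2.1 1 (by norm_num), h₁.1]
  · exact h₃.2.1
  · rw [h₃.1 10, h₂.1 10, h₁.2.2.2.2.1, hlen] <;> norm_num
  · intro k hk
    have := (hCR s₃ h₃.2.2.2 k hk).2.finish
    have := (hcopy _ (List.getElem_mem hk)).length_le
    omega
  · intro k hk z hz1 hz2 k' hk' z' hz1' hz2' heq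
    obtain ⟨-, hr⟩ := hCR s₃ h₃.2.2.2 k hk
    obtain ⟨-, hr'⟩ := hCR s₃ h₃.2.2.2 k' hk'
    have hf := hr.finish
    have hf' := hr'.finish
    obtain ⟨i, rfl⟩ := Nat.exists_eq_add_of_le hz1
    obtain ⟨i', rfl⟩ := Nat.exists_eq_add_of_le hz1'
    rw [hr.edge i (by omega), hr'.edge i' (by omega)] at heq
    have hP := List.pairwise_iff_getElem.1 hC.2
    rcases lt_trichotomy k k' with hlt | rfl | hlt
    · exact absurd (by rw [heq]; exact List.getElem_mem _)
        (hP k k' hk hk' hlt (List.getElem_mem (l := C[k]) (n := i) (by omega)))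
    · rw [((hcirc _ (List.getElem_mem hk)).2.1.getElem_inj_iff).1 heq]
    · exact absurd (by rw [← heq]; exact List.getElem_mem _)
        (hP k' k hk' hk hlt (List.getElem_mem (l := C[k']) (n := i') (by omega)))
  · obtain ⟨a1, a2, a4, a6, a10, a9⟩ := h₁
    obtain ⟨b1, b2, b3⟩ := h₂
    obtain ⟨c1, c2, c3, c4⟩ := h₃
    obtain ⟨d1, d2, d3, d4, d5, d6⟩ := h₄
    set s' := Program.exec _ s₄ with hs'
    have harr : s'.arr = s₄.arr := rfl
    have h7 : s'.reg 7 = L.length := by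
      rw [← c2, ← d1 17] <;> simp [hs']
    have hreg : ∀ r < 11, r ≠ 7 → r ≠ 8 → s'.reg r = s₁.reg r := by
      intro r hr h7 h8
      have : s'.reg r = s₄.reg r := by simp [hs', h7]
      rw [this, d1 r, c1 r, b1 r] <;> omega
    have h10 : s'.reg 10 = C.length := by
      rw [hreg 10 (by norm_num) (by norm_num) (by norm_num), a10, hlen]
    refine ⟨?_, ?_, ?_, ?_, ?_, ?_, fun a ha => ?_, ?_, ⟨fun _ _ => rfl, fun _ _ => rfl, ?_, ?_⟩⟩
    · rw [hreg 0, a2 0, h0] <;> norm_num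
    · rw [hreg 4, a4] <;> norm_num
    · rw [hreg 6, a6] <;> norm_num
    · rw [h10, hlen]
    · rw [hreg 10 (by norm_num) (by norm_num) (by norm_num),
        hreg 9 (by norm_num) (by norm_num) (by norm_num), a9]
    · rw [h7, hL, length_flatMap_rowPair]
      exact Nat.mul_le_mul_left _ (length_pairList_le _)
    · rw [harr, d2 a (by omega), c3 a (by omega), b2 a (by omega), a1]
    · exact isTable_of_isRows c4 h7 (fun a _ ha => by rw [harr, d2 a ha]) hS hb
    · rw [h10]
      have h6 : s'.reg 6 = 20 * t := by rw [hreg 6, a6] <;> norm_num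
      rw [h6, harr, d2 10 (by norm_num), d2 11 (by norm_num)]
      refine Routing.valid_of_packing (off := fun k => s₃.arr 14 (L.length + k)) hH hSG hC
        (fun k hk i hi => ?_) (fun k hk i hi => ?_) (fun k hk => ?_) (fun σ hσ => ?_)
        (fun σ hσ => ?_)
      · exact (hCR s₃ c4 k hk).2.edge i hi
      · have := (hCR s₃ c4 k hk).2.isWalk i hi
        rwa [(hCR s₃ c4 k hk).1] at this
      · obtain ⟨e1, e2⟩ := d4 k hk
        have hf := (hCR s₃ c4 k hk).2.finish
        have := (hcirc _ (List.getElem_mem hk)).1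
        refine ⟨e1, e2.trans ?_⟩
        omega
      · exact d5 σ hσ
      · change s₄.arr 19 σ = 0
        rw [d3, c3 19 (by norm_num), b2 19 (by norm_num), a1, h19]
    · rw [h10, harr, d2 10 (by norm_num)]
      rintro k hk z ⟨hz1, hz2⟩
      obtain ⟨e1, e2⟩ := d4 k hk
      have e1' : s'.routing.pos (2 * k) = s₃.arr 14 (L.length + k) + 1 := e1
      have e2' : s'.routing.pos (2 * k + 1) = s₃.arr 15 (L.length + k) - 1 := e2
      exact d6 k hk z (by omega) (by omega)
  · rw [hlen]
    -- After expansion the coefficient of t²Z is below 600000000, and the remaining terms are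
    -- absorbed by 1200000000t² because t ≤ t².
    have h1 : t ≤ t ^ 2 := by nlinarith
    have h2 : 1400 * t * (1400 * t * (Z * 264 + 340) + 20) + 30 + (3500 * t ^ 2 * (Z * 132 + 180) +
        20 + (3500 * t ^ 2 * (Z * 10 + 100) + 20 + 2)) =
        517937000 * (t ^ 2 * Z) + 667380000 * t ^ 2 + 28000 * t + 72 := by ring
    have h3 : t * t * 200000 = 200000 * t ^ 2 := by ring
    have h4 : t ^ 2 * (Z + 2) * 600000000 = 600000000 * (t ^ 2 * Z) + 1200000000 * t ^ 2 := by ring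
    rw [h2, h3, h4]
    omega

end Prepare

/-! ### Selecting the branch vertices and the parts of the branch trails -/

section Select

/-- Besides those of a routing, the arrays 17 and 18 contain the pairs in `E`. -/
structure IsMarked (r : Routing ℕ) (m : ℕ) (E : List (ℕ × ℕ)) (s : Memory) : Prop where
  reg : s.reg 9 = 2 * m + E.length
  pair : ∀ σ < 2 * m, s.arr 17 σ = r.root σ ∧ s.arr 18 σ = r.other σ
  mark : ∀ i (h : i < E.length), s.arr 17 (2 * m + i) = E[i].1 ∧ s.arr 18 (2 * m + i) = E[i].2

variable {r : Routing ℕ} {m : ℕ} {E : List (ℕ × ℕ)} {s : Memory}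

lemma IsMarked.touched_iff (h : IsMarked r m E s) {u v : ℕ} :
    Touched (s.arr 17) (s.arr 18) (s.reg 9) u v ↔
      Touched r.root r.other (2 * m) u v ∨ ∃ y ∈ E, s(y.1, y.2) = s(u, v) := by
  rw [h.reg]
  constructor
  · rintro ⟨σ, hσ, he⟩
    rcases Nat.lt_or_ge σ (2 * m) with h1 | h1
    · rw [(h.pair σ h1).1, (h.pair σ h1).2] at he
      exact Or.inl ⟨σ, h1, he⟩
    · obtain ⟨i, rfl⟩ := Nat.exists_eq_add_of_le h1
      have hi : i < E.length := by omega
      rw [(h.mark i hi).1, (h.mark i hi).2] at he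
      exact Or.inr ⟨_, List.getElem_mem hi, he⟩
  · rintro (⟨σ, hσ, he⟩ | ⟨y, hy, he⟩)
    · exact ⟨σ, by omega, by rw [(h.pair σ hσ).1, (h.pair σ hσ).2]; exact he⟩
    · obtain ⟨i, hi, rfl⟩ := List.mem_iff_getElem.1 hy
      exact ⟨2 * m + i, by omega, by rw [(h.mark i hi).1, (h.mark i hi).2]; exact he⟩

lemma IsMarked.of_eq {s' : Memory} (h : IsMarked r m E s) (h9 : s'.reg 9 = s.reg 9)
    (h17 : s'.arr 17 = s.arr 17) (h18 : s'.arr 18 = s.arr 18) : IsMarked r m E s' :=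
  ⟨h9.trans h.reg, by rw [h17, h18]; exact h.pair, by rw [h17, h18]; exact h.mark⟩

lemma IsMarked.push {s' : Memory} {a b : ℕ} (h : IsMarked r m E s) (h9 : s'.reg 9 = s.reg 9 + 1)
    (h17 : s'.arr 17 = Function.update (s.arr 17) (s.reg 9) a)
    (h18 : s'.arr 18 = Function.update (s.arr 18) (s.reg 9) b) :
    IsMarked r m (E ++ [(a, b)]) s' := by
  have := h.reg
  refine ⟨by simp [h9, h.reg, add_assoc], fun σ hσ => ?_, fun i hi => ?_⟩
  · rw [h17, h18, Function.update_of_ne (by omega), Function.update_of_ne (by omega)]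
    exact h.pair σ hσ
  · rw [List.length_append, List.length_singleton] at hi
    rw [h17, h18]
    rcases Nat.lt_succ_iff_lt_or_eq.1 hi with hi | rfl
    · rw [Function.update_of_ne (by omega), Function.update_of_ne (by omega),
        List.getElem_append_left hi]
      exact h.mark i hi
    · simp [h.reg]

/-- Write the vertices that are contained in few pairs to array 7. -/
def selectVertices : Program :=
  .seq (.block [.setReg 11 (.num 0), .setReg 12 (.num 0)]) (.forLoop 11 4
    (.seq (.setReg 60 (.entry 2 (.reg 11))) (.seq pairQuery
    (.ite (.lt (.reg 62) (.reg 6)) (.block [.setArr 7 (.reg 12) (.reg 60),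
      .setReg 12 (.succ (.reg 12))]) .skip))))

-- All vertices of small incidence are written to array 7; only the first t of them will serve as
-- branch vertices.
open scoped Classical in
lemma comp_selectVertices (s : Memory) {S : List ℕ} (hS : S.length = s.reg 4)
    (hSi : ∀ i (h : i < S.length), s.arr 2 i = S[i]) :
    Comp selectVertices s (s.reg 4 * (s.reg 9 * 100 + 60) + 20) fun s' =>
      (∀ r < 60, r ≠ 11 → r ≠ 12 → s'.reg r = s.reg r) ∧
      (∀ a, a ≠ 7 → s'.arr a = s.arr a) ∧
      ∀ i (h : i < (S.filter fun v => incidences (s.arr 17) (s.arr 18) (s.reg 9) v <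
        s.reg 6).length), s'.arr 7 i = (S.filter fun v => incidences (s.arr 17) (s.arr 18)
          (s.reg 9) v < s.reg 6)[i] := by
  refine Comp.mono (Comp.flat_seq (c₁ := 10) (Comp.forLoop (c := s.reg 9 * 100 + 50) (fun n s' =>
      s'.reg 11 = n ∧ (∀ r < 60, r ≠ 11 → r ≠ 12 → s'.reg r = s.reg r) ∧
      (∀ a, a ≠ 7 → s'.arr a = s.arr a) ∧
      s'.reg 12 = ((S.take n).filter fun v => incidences (s.arr 17) (s.arr 18) (s.reg 9) v <
        s.reg 6).length ∧
      ∀ i (h : i < ((S.take n).filter fun v => incidences (s.arr 17) (s.arr 18) (s.reg 9) v <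
        s.reg 6).length), s'.arr 7 i = ((S.take n).filter fun v => incidences (s.arr 17) (s.arr 18)
          (s.reg 9) v < s.reg 6)[i]) 0 (s.reg 4) (Nat.zero_le _) ?_ ?_ ?_ ?_)) ?_ fun _ h => h
  · rintro k s' ⟨h1, h2, -⟩
    exact ⟨h1, h2 4 (by norm_num) (by norm_num) (by norm_num)⟩
  · exact ⟨by simp, fun r _ h1 h2 => by simp [h1, h2], fun a _ => by simp, by simp, by simp⟩
  · rintro n - hn s₁ ⟨i11, ireg, iarr, i12, i7⟩
    have hn' : n < S.length := hS ▸ hn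
    have h9 := ireg 9 (by norm_num) (by norm_num) (by norm_num)
    refine Comp.mono (Comp.flat_seq (c₁ := 5) (Comp.seq ((comp_pairQuery _).mono
      (c₂ := s.reg 9 * 100 + 20) ?_ fun _ h => h) fun s₂ h₂ => Comp.flat (c := 20) ?_)) (by omega)
      fun _ h => h
    · simp [h9]
    · obtain ⟨a1, a2, a3, -⟩ := h₂
      have b1 : s₂.arr = s₁.arr := by simpa using a1
      have b60 : s₂.reg 60 = S[n] := by
        rw [a2 60 (by norm_num)]
        simp [iarr 2 (by norm_num), i11, hSi n hn']
      have b62 : s₂.reg 62 = incidences (s.arr 17) (s.arr 18) (s.reg 9) S[n] := by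
        rw [a3]
        simp [iarr 2 (by norm_num), iarr 17 (by norm_num), iarr 18 (by norm_num), i11, hSi n hn', h9]
      have breg : ∀ r < 60, s₂.reg r = s₁.reg r := by
        intro r hr
        have : r ≠ 60 := by omega
        rw [a2 r (by omega)]; simp [this]
      have b6 : s₂.reg 6 = s.reg 6 := by
        rw [breg 6 (by norm_num), ireg 6 (by norm_num) (by norm_num) (by norm_num)]
      have b11 := (breg 11 (by norm_num)).trans i11
      have b12 := (breg 12 (by norm_num)).trans i12
      rw [List.take_succ_eq_append_getElem hn', List.filter_append]
      simp only [Program.block, Program.exec]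
      split_ifs with hc <;> simp only [Test.check_iff, Test.Holds, Expr.eval, b62, b6] at hc
      · have hf : [S[n]].filter (fun v => incidences (s.arr 17) (s.arr 18) (s.reg 9) v <
            s.reg 6) = [S[n]] := by simp [hc]
        rw [hf]
        refine ⟨by simp [b11], fun r hr h1 h2 => ?_, fun a ha => ?_, by simp [b12], fun i hi => ?_⟩
        · simp [h1, h2, breg r hr, ireg r hr h1 h2]
        · simp [Memory.setArr_arr, ha, b1, iarr a ha]
        · rw [List.length_append, List.length_singleton] at hi
          simp only [Memory.setReg_arr, Memory.setArr_arr, Expr.eval, b12, b1, b60, if_true]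
          rcases Nat.lt_succ_iff_lt_or_eq.1 hi with hi | rfl
          · rw [Function.update_of_ne (by omega), List.getElem_append_left hi]
            exact i7 i hi
          · simp
      · have hf : [S[n]].filter (fun v => incidences (s.arr 17) (s.arr 18) (s.reg 9) v <
            s.reg 6) = [] := by simpa using hc
        rw [hf, List.append_nil]
        refine ⟨by simp [b11], fun r hr h1 h2 => ?_, fun a ha => ?_, by simp [b12], fun i hi => ?_⟩
        · simp [h1, breg r hr, ireg r hr h1 h2]
        · simp [b1, iarr a ha]
        · simpa [b1] using i7 i hi
  · rintro s' ⟨-, h1, h2, -, h3⟩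
    rw [List.take_of_length_le hS.le] at h3
    exact ⟨h1, h2, h3⟩
  · rw [Nat.sub_zero]
    have : s.reg 4 * (s.reg 9 * 100 + 50 + 6) ≤ s.reg 4 * (s.reg 9 * 100 + 60) :=
      Nat.mul_le_mul_left _ (by omega)
    omega

/-- Mark all pairs of branch vertices. -/
def markVertices : Program :=
  .seq (.setReg 11 (.num 0)) (.forLoop 11 0 (.seq (.setReg 12 (.num 0)) (.forLoop 12 0
    (.block [.setArr 17 (.reg 9) (.entry 7 (.reg 11)), .setArr 18 (.reg 9) (.entry 7 (.reg 12)),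
      .setReg 9 (.succ (.reg 9))]))))

/-- All pairs of branch vertices. -/
def vertexPairs (B : ℕ → ℕ) (t : ℕ) : List (ℕ × ℕ) :=
  (List.range t).flatMap fun i => (List.range t).map fun j => (B i, B j)

/-- With every pair of branch vertices in the list, including the diagonal ones, a root that is
itself a branch vertex is rejected by the ordinary query for assigned pairs. -/
lemma comp_markVertices (s : Memory) (hs : IsMarked r m [] s) :
    Comp markVertices s (s.reg 0 * (s.reg 0 * 36 + 20) + 10) fun s' =>
      (∀ r < 60, r ≠ 9 → r ≠ 11 → r ≠ 12 → s'.reg r = s.reg r) ∧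
      (∀ a, a ≠ 17 → a ≠ 18 → s'.arr a = s.arr a) ∧
      IsMarked r m (vertexPairs (s.arr 7) (s.reg 0)) s' := by
  set t := s.reg 0 with ht
  refine Comp.mono (Comp.flat_seq (c₁ := 5) (Comp.forLoop (c := t * 36 + 10) (fun i s' =>
      s'.reg 11 = i ∧ (∀ r < 60, r ≠ 9 → r ≠ 11 → r ≠ 12 → s'.reg r = s.reg r) ∧
      (∀ a, a ≠ 17 → a ≠ 18 → s'.arr a = s.arr a) ∧
      IsMarked r m ((List.range i).flatMap fun i => (List.range t).map fun j =>
        (s.arr 7 i, s.arr 7 j)) s') 0 t (Nat.zero_le _) ?_ ?_ ?_ fun s' h => h.2)) ?_ fun _ h => h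
  · rintro k s' ⟨h1, h2, -⟩
    exact ⟨h1, h2 0 (by norm_num) (by norm_num) (by norm_num) (by norm_num)⟩
  · exact ⟨by simp, fun r _ _ h1 _ => by simp [h1], fun a _ _ => by simp,
      by simpa using hs.of_eq (by simp) (by simp) (by simp)⟩
  · rintro i - hi s₁ ⟨i11, ireg, iarr, imark⟩
    refine Comp.mono (Comp.flat_seq (c₁ := 3) (Comp.forLoop (c := 30) (fun j s' =>
      s'.reg 12 = j ∧ s'.reg 11 = i ∧
      (∀ r < 60, r ≠ 9 → r ≠ 11 → r ≠ 12 → s'.reg r = s.reg r) ∧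
      (∀ a, a ≠ 17 → a ≠ 18 → s'.arr a = s.arr a) ∧
      IsMarked r m (((List.range i).flatMap fun i => (List.range t).map fun j =>
        (s.arr 7 i, s.arr 7 j)) ++ (List.range j).map fun j => (s.arr 7 i, s.arr 7 j)) s') 0 t
        (Nat.zero_le _) ?_ ?_ ?_ ?_)) ?_ fun _ h => h
    · rintro k s' ⟨h1, -, h2, -⟩
      exact ⟨h1, h2 0 (by norm_num) (by norm_num) (by norm_num) (by norm_num)⟩
    · exact ⟨by simp, by simp [i11], fun r hr h1 h2 h3 => by simp [h3, ireg r hr h1 h2 h3],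
        fun a h1 h2 => by simp [iarr a h1 h2], by simpa using imark.of_eq (by simp) (by simp) (by simp)⟩
    · rintro j - hj s₂ ⟨j12, j11, jreg, jarr, jmark⟩
      refine Comp.flat ⟨by simp [j12], by simp [j11], fun r hr h1 h2 h3 => by
        simp [h1, h3, jreg r hr h1 h2 h3], fun a h1 h2 => by
        simp [Memory.setArr_arr, h1, h2, jarr a h1 h2], ?_⟩
      rw [List.range_succ (n := j), List.map_append, ← List.append_assoc]
      exact jmark.push (by simp) (by simp [Memory.setArr_arr, j11, jarr 7])
        (by simp [Memory.setArr_arr, j12, jarr 7])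
    · rintro s' ⟨-, h1, h2, h3, h4⟩
      refine ⟨by simp [h1], fun r hr i1 i2 i3 => by simp [i2, h2 r hr i1 i2 i3],
        fun a i1 i2 => by simp [h3 a i1 i2], ?_⟩
      rw [List.range_succ, List.flatMap_append]
      simpa using h4.of_eq (by simp) (by simp) (by simp)
    · omega
  · rw [Nat.sub_zero]
    have : t * (t * 36 + 10 + 6) ≤ t * (t * 36 + 20) := Nat.mul_le_mul_left _ (by omega)
    omega

/-- Find an odd trail for the branch trail between the branch vertices with the numbers in the
registers 12 and 11. -/
def chooseTrail : Program :=
  .seq (.block [.setReg 14 (.num 0), .setReg 15 (.num 0)]) (.forLoop 14 10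
    (.seq (.block [.setReg 60 (.entry 7 (.reg 12)), .setReg 61 (.entry 17 (.reg 15))])
    (.seq pairQuery
    (.seq (.block [.setReg 18 (.reg 63), .setReg 60 (.entry 7 (.reg 11)),
      .setReg 61 (.entry 17 (.succ (.reg 15)))])
    (.seq pairQuery (.block [
      .ite (.and (.eq (.reg 18) (.num 0)) (.and (.eq (.reg 63) (.num 0))
        (.eq (.entry 21 (.reg 14)) (.num 0))))
        (.block [.setReg 16 (.reg 14), .setReg 17 (.reg 15)]) .skip,
      .setReg 15 (.succ (.succ (.reg 15)))]))))))

/-- Trail `k` can be used for the branch trail between `b` and `b'`. -/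
def Memory.Usable (s : Memory) (b b' k : ℕ) : Prop :=
  ¬ Touched (s.arr 17) (s.arr 18) (s.reg 9) b (s.arr 17 (2 * k)) ∧
    ¬ Touched (s.arr 17) (s.arr 18) (s.reg 9) b' (s.arr 17 (2 * k + 1)) ∧ s.arr 21 k = 0

/-- Exhaustive search over the odd trails. That some trail is usable is supplied later by the
counting argument. -/
lemma comp_chooseTrail (s : Memory)
    (hs : ∃ k < s.reg 10, s.Usable (s.arr 7 (s.reg 12)) (s.arr 7 (s.reg 11)) k) :
    Comp chooseTrail s (s.reg 10 * (s.reg 9 * 200 + 150) + 20) fun s' =>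
      s'.arr = s.arr ∧ (∀ r < 14, s'.reg r = s.reg r) ∧ s'.reg 19 = s.reg 19 ∧
      s'.reg 16 < s.reg 10 ∧ s'.reg 17 = 2 * s'.reg 16 ∧
      s.Usable (s.arr 7 (s.reg 12)) (s.arr 7 (s.reg 11)) (s'.reg 16) := by
  refine Comp.mono (Comp.flat_seq (c₁ := 10) (Comp.forLoop (c := s.reg 9 * 200 + 140) (fun n s' =>
      s'.reg 14 = n ∧ s'.reg 15 = 2 * n ∧ s'.arr = s.arr ∧ (∀ r < 14, s'.reg r = s.reg r) ∧
      s'.reg 19 = s.reg 19 ∧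
      ((∃ k < n, s.Usable (s.arr 7 (s.reg 12)) (s.arr 7 (s.reg 11)) k) →
        s'.reg 16 < n ∧ s'.reg 17 = 2 * s'.reg 16 ∧
        s.Usable (s.arr 7 (s.reg 12)) (s.arr 7 (s.reg 11)) (s'.reg 16))) 0 (s.reg 10)
      (Nat.zero_le _) ?_ ?_ ?_ fun s' h => ⟨h.2.2.1, h.2.2.2.1, h.2.2.2.2.1, h.2.2.2.2.2 hs⟩)) ?_
      fun _ h => h
  · rintro k s' ⟨h1, -, -, h2, -⟩
    exact ⟨h1, h2 10 (by norm_num)⟩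
  · refine ⟨by simp, by simp, by simp, fun r hr => ?_, by simp, by simp⟩
    simp; grind
  · rintro n - hn s₁ ⟨i14, i15, iarr, ireg, i19, iuse⟩
    refine Comp.mono (Comp.flat_seq (c₁ := 10) (Comp.seq ((comp_pairQuery _).mono
      (c₂ := s.reg 9 * 100 + 20) ?_ fun _ h => h) fun s₂ h₂ => Comp.flat_seq (c₁ := 15)
      (Comp.seq ((comp_pairQuery _).mono (c₂ := s.reg 9 * 100 + 20) ?_ fun _ h => h)
      fun s₃ h₃ => Comp.flat (c := 40) ?_))) (by omega) fun _ h => h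
    · simp [ireg 9]
    · have := h₂.2.1 9 (by norm_num)
      simp [ireg 9] at this
      simp [this]
    · obtain ⟨a1, a2, -, a3⟩ := h₂
      obtain ⟨b1, b2, -, b3⟩ := h₃
      have c1 : s₂.arr = s.arr := by simpa [iarr] using a1
      have c2 : ∀ r < 60, s₂.reg r = s₁.reg r := by
        intro r hr
        have n1 : r ≠ 60 := by omega
        have n2 : r ≠ 61 := by omega
        rw [a2 r (by omega)]; simp [n1, n2]
      have d1 : s₃.arr = s.arr := by simpa [c1] using b1
      have d2 : ∀ r < 60, r ≠ 18 → s₃.reg r = s₁.reg r := by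
        intro r hr h18
        have n1 : r ≠ 60 := by omega
        have n2 : r ≠ 61 := by omega
        rw [b2 r (by omega)]; simp [n1, n2, h18, c2 r hr]
      have d18 : s₃.reg 18 = s₂.reg 63 := by
        rw [b2 18 (by norm_num)]; simp
      simp [iarr, ireg, i15] at a3
      simp [c1, c2 9, c2 11, c2 15, ireg, i15] at b3
      have hU : (s₃.reg 18 = 0 ∧ s₃.reg 63 = 0 ∧ s₃.arr 21 (s₃.reg 14) = 0) ↔
          s.Usable (s.arr 7 (s.reg 12)) (s.arr 7 (s.reg 11)) n := by
        rw [d18, a3, b3, d1, d2 14 (by norm_num) (by norm_num), i14]; rfl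
      have e14 := (d2 14 (by norm_num) (by norm_num)).trans i14
      have e15 := (d2 15 (by norm_num) (by norm_num)).trans i15
      have e16 := (d2 16 (by norm_num) (by norm_num))
      have e17 := (d2 17 (by norm_num) (by norm_num))
      have e19 := (d2 19 (by norm_num) (by norm_num)).trans i19
      have ereg : ∀ r < 14, s₃.reg r = s.reg r := fun r hr =>
        (d2 r (by omega) (by omega)).trans (ireg r hr)
      simp only [Program.block, Program.exec]
      split_ifs with hc <;> simp only [Test.check_iff, Test.Holds, Expr.eval, hU] at hc
      · refine ⟨by simp [e14], by simp [e15]; ring, by simp [d1], fun r hr => ?_, by simp [e19],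
          fun _ => ⟨by simp [e14], by simp [e14, e15], by simpa [e14] using hc⟩⟩
        rw [← ereg r hr]; simp; grind
      · refine ⟨by simp [e14], by simp [e15]; ring, by simp [d1], fun r hr => ?_, by simp [e19],
          ?_⟩
        · rw [← ereg r hr]; simp; grind
        · rintro ⟨k, hk, hku⟩
          have hkn : k < n := by
            rcases Nat.lt_succ_iff_lt_or_eq.1 hk with h | rfl
            · exact h
            · exact absurd hku hc
          obtain ⟨u1, u2, u3⟩ := iuse ⟨k, hkn, hku⟩
          refine ⟨by simp [e16]; omega, by simp [e16, e17, u2], by simpa [e16] using u3⟩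
  · rw [Nat.sub_zero]
    have : s.reg 10 * (s.reg 9 * 200 + 140 + 6) ≤ s.reg 10 * (s.reg 9 * 200 + 150) :=
      Nat.mul_le_mul_left _ (by omega)
    omega

end Select

/-! ### Writing the branch trails -/

section Emit

/-- The list `l` has been appended to array 8. -/
structure IsAppended (l : List ℕ) (s s' : Memory) : Prop where
  reg : ∀ r < 24, r ≠ 8 → s'.reg r = s.reg r
  arr : ∀ a, a ≠ 8 → a ≠ 22 → s'.arr a = s.arr a
  pointer : s'.reg 8 = s.reg 8 + l.length
  new : ∀ i (h : i < l.length), s'.arr 8 (s.reg 8 + i) = l[i]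
  old : ∀ i < s.reg 8, s'.arr 8 i = s.arr 8 i

lemma IsAppended.trans {l l' : List ℕ} {s s' s'' : Memory} (h : IsAppended l s s')
    (h' : IsAppended l' s' s'') : IsAppended (l ++ l') s s'' := by
  have h8 := h.pointer
  refine ⟨fun r hr h8 => (h'.reg r hr h8).trans (h.reg r hr h8), fun a h1 h2 =>
    (h'.arr a h1 h2).trans (h.arr a h1 h2), by rw [h'.pointer, h8, List.length_append, add_assoc],
    fun i hi => ?_, fun i hi => (h'.old i (by omega)).trans (h.old i hi)⟩
  rcases Nat.lt_or_ge i l.length with hi' | hi'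
  · rw [List.getElem_append_left hi', h'.old _ (by omega), h.new i hi']
  · rw [List.getElem_append_right hi', ← h'.new _ (by rw [List.length_append] at hi; omega), h8]
    congr 1; omega

lemma IsAppended.of_eq {l : List ℕ} {s s₁ s' : Memory} (h : IsAppended l s₁ s')
    (hreg : ∀ r < 24, s₁.reg r = s.reg r) (harr : s₁.arr = s.arr) : IsAppended l s s' := by
  have h8 := hreg 8 (by norm_num)
  refine ⟨fun r hr hr8 => (h.reg r hr hr8).trans (hreg r hr), fun a h1 h2 => by
    rw [h.arr a h1 h2, harr], by rw [h.pointer, h8], ?_, ?_⟩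
  · rw [← h8]; exact h.new
  · rw [← h8, ← harr]; exact h.old

lemma comp_copy_output {rev : Bool} (s : Memory) (l : List ℕ) {Z : ℕ}
    (h31 : s.reg 31 = s.reg 30 + l.length) (hZ : l.length ≤ Z)
    (hl : ∀ i (h : i < l.length),
      s.arr 10 (bif rev then s.reg 32 - i - 1 else s.reg 32 + i) = l[i]) :
    Comp (copy rev 10 8 22) s (Z * 66 + 3) (IsAppended l s) :=
  (comp_copy (by norm_num) (by norm_num) (by norm_num) (by norm_num) (by norm_num) s l h31 hl).mono
    (by omega) fun _ ⟨h1, _, h3, h4, h5, h6, _⟩ =>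
    ⟨fun r hr => h1 r (by omega), h3, h4, h5, fun i hi => (h6 i hi).1⟩

/-- Append the trail of the linkage between the vertices in the registers 26 and 27. -/
def emitRow : Program :=
  .seq rowQuery (.seq (.block [.setReg 30 (.entry 14 (.reg 28)), .setReg 31 (.entry 15 (.reg 28)),
    .setReg 32 (.reg 30)]) (copy false 10 8 22))

/-- Append an initial segment of the trail of the linkage between the vertices in the registers 26
and 27; its length is in register 25. -/
def emitArm : Program :=
  .seq rowQuery (.seq (.block [.setReg 30 (.num 0), .setReg 31 (.reg 25),
    .setReg 32 (.entry 14 (.reg 28))]) (copy false 10 8 22))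

/-- Append the reverse of an initial segment of the trail of the linkage between the vertices in the
registers 26 and 27; its length is in register 25. -/
def emitArmReverse : Program :=
  .seq rowQuery (.seq (.block [.setReg 30 (.num 0), .setReg 31 (.reg 25),
    .setReg 32 (.entry 14 (.reg 28))])
  (.seq (.forLoop 30 31 (.setReg 32 (.succ (.reg 32))))
  (.seq (.setReg 30 (.num 0)) (copy true 10 8 22))))

/-- Append the part of array 10 between the positions in the registers 26 and 27. -/
def emitCore : Program :=
  .seq (.block [.setReg 30 (.reg 26), .setReg 31 (.reg 27), .setReg 32 (.reg 26)])
    (copy false 10 8 22)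

variable {G H : Graph ℕ ℕ} {S : List ℕ} {Q : ℕ → ℕ → List ℕ} {s : Memory} {Z : ℕ}

lemma IsTable.of_eq {s' : Memory} (h : IsTable H S Q s) (h7 : s'.reg 7 = s.reg 7)
    (ha : ∀ a, 10 ≤ a → a < 16 → s'.arr a = s.arr a) : IsTable H S Q s' := by
  have h10 := ha 10 (by norm_num) (by norm_num)
  have h11 := ha 11 (by norm_num) (by norm_num)
  have h12 := ha 12 (by norm_num) (by norm_num)
  have h13 := ha 13 (by norm_num) (by norm_num)
  have h14 := ha 14 (by norm_num) (by norm_num)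
  have h15 := ha 15 (by norm_num) (by norm_num)
  refine ⟨?_, ?_, ?_⟩ <;> rw [h7, h12, h13]
  · exact h.mem
  · exact fun d hd => (h.isRow d hd).congr (by simp [h10]) (by simp [h11]) (by rw [h12])
      (by rw [h14]) (by rw [h15])
  · exact h.exists_row

lemma comp_rowQuery_table (hT : IsTable H S Q s) :
    Comp rowQuery s (s.reg 7 * 100 + 20) fun s' => s'.arr = s.arr ∧
      (∀ r, r ≠ 28 → r ≠ 29 → s'.reg r = s.reg r) ∧
      (s.reg 26 ∈ S → s.reg 27 ∈ S → s.reg 26 ≠ s.reg 27 →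
        IsRow H s (s'.reg 28) (Q (s.reg 26) (s.reg 27))) := by
  refine (comp_rowQuery s).mono le_rfl fun s' ⟨h1, h2, h3⟩ => ⟨h1, h2, fun hu hv huv => ?_⟩
  obtain ⟨h4, h5, h6⟩ := h3 (hT.exists_row _ hu _ hv huv)
  have := hT.isRow _ h4
  rwa [h5, h6] at this

lemma comp_emitRow (hT : IsTable H S Q s) {u v : ℕ} (h26 : s.reg 26 = u) (h27 : s.reg 27 = v)
    (hu : u ∈ S) (hv : v ∈ S) (huv : u ≠ v) (hZ : (Q u v).length ≤ Z) :
    Comp emitRow s (s.reg 7 * 100 + Z * 66 + 50) (IsAppended (Q u v) s) := by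
  subst h26 h27
  refine Comp.mono ((comp_rowQuery_table hT).seq fun s₁ ⟨h1, h2, h3⟩ => Comp.flat_seq (c₁ := 20)
    (Comp.mono (comp_copy_output _ (Q (s.reg 26) (s.reg 27)) ?_ hZ fun i hi => ?_) le_rfl
    fun s' h => h.of_eq (fun r hr => ?_) ?_)) (by omega) fun _ h => h
  · have := (h3 hu hv huv).finish
    simpa [h1] using this
  · have := (h3 hu hv huv).edge i hi
    simpa [h1] using this
  · rw [← h2 r (by omega) (by omega)]
    simp; grind
  · simp [h1]

lemma comp_emitArm (hT : IsTable H S Q s) {u v n : ℕ} (h26 : s.reg 26 = u) (h27 : s.reg 27 = v)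
    (h25 : s.reg 25 = n) (h : n = 0 ∨ u ∈ S ∧ v ∈ S ∧ u ≠ v ∧ n ≤ (Q u v).length) (hZ : n ≤ Z) :
    Comp emitArm s (s.reg 7 * 100 + Z * 66 + 50) (IsAppended ((Q u v).take n) s) := by
  subst h26 h27 h25
  have hlen : s.reg 25 ≠ 0 → ((Q (s.reg 26) (s.reg 27)).take (s.reg 25)).length = s.reg 25 := by
    intro h0
    rw [List.length_take]; omega
  refine Comp.mono ((comp_rowQuery_table hT).seq fun s₁ ⟨h1, h2, h3⟩ => Comp.flat_seq (c₁ := 20)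
    (Comp.mono (comp_copy_output (Z := Z) _ ((Q (s.reg 26) (s.reg 27)).take (s.reg 25)) ?_ ?_
    fun i hi => ?_) le_rfl fun s' h => h.of_eq (fun r hr => ?_) ?_)) (by omega) fun _ h => h
  · by_cases h0 : s.reg 25 = 0
    · simp [h2 25, h0]
    · have := hlen h0
      simp only [Program.block, Program.exec, Memory.setReg_reg, Expr.eval]
      simp only [this]
      simp [h2 25]
  · exact (List.length_take_le _ _).trans hZ
  · rw [List.length_take, lt_inf_iff] at hi
    have h0 : s.reg 25 ≠ 0 := by omega
    obtain ⟨hu, hv, huv, -⟩ := h.resolve_left h0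
    have := (h3 hu hv huv).edge i hi.2
    simpa [h1] using this
  · rw [← h2 r (by omega) (by omega)]
    simp; grind
  · simp [h1]

lemma comp_emitArmReverse (hT : IsTable H S Q s) {u v n : ℕ} (h26 : s.reg 26 = u)
    (h27 : s.reg 27 = v) (h25 : s.reg 25 = n)
    (h : n = 0 ∨ u ∈ S ∧ v ∈ S ∧ u ≠ v ∧ n ≤ (Q u v).length) (hZ : n ≤ Z) :
    Comp emitArmReverse s (s.reg 7 * 100 + Z * 75 + 60)
      (IsAppended ((Q u v).take n).reverse s) := by
  subst h26 h27 h25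
  have hlen : ((Q (s.reg 26) (s.reg 27)).take (s.reg 25)).length = s.reg 25 := by
    rw [List.length_take]; omega
  refine Comp.mono ((comp_rowQuery_table hT).seq fun s₁ ⟨h1, h2, h3⟩ => Comp.flat_seq (c₁ := 20)
    (Comp.seq (c₁ := Z * 9 + 3) (mid := fun s' => s'.arr = s.arr ∧
      (∀ r < 28, s'.reg r = s.reg r) ∧ s'.reg 31 = s.reg 25 ∧
      s'.reg 32 = s.arr 14 (s₁.reg 28) + s.reg 25) ?_ fun s₂ ⟨k1, k2, k31, k32⟩ =>
    Comp.flat_seq (c₁ := 2)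
    (Comp.mono (comp_copy_output (Z := Z) _ ((Q (s.reg 26) (s.reg 27)).take (s.reg 25)).reverse ?_
    ?_ fun i hi => ?_) le_rfl fun s' h => h.of_eq (fun r hr => ?_) ?_))) (by omega) fun _ h => h
  · refine Comp.mono (Comp.forLoop (c := 3) (fun n s' => s'.reg 30 = n ∧ s'.arr = s.arr ∧
      (∀ r < 28, s'.reg r = s.reg r) ∧ s'.reg 31 = s.reg 25 ∧
      s'.reg 32 = s.arr 14 (s₁.reg 28) + n) 0 (s.reg 25) (Nat.zero_le _) ?_ ?_ ?_
      fun s' h => h.2) (by omega) fun _ h => h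
    · rintro k s' ⟨i1, -, -, i2, -⟩
      exact ⟨i1, i2⟩
    · refine ⟨by simp, by simp [h1], fun r hr => ?_, by simp [h2 25], by simp [h1]⟩
      rw [← h2 r (by omega) (by omega)]
      simp; grind
    · rintro n - hn s' ⟨i1, i2, i3, i4, i5⟩
      refine Comp.flat ⟨by simp [i1], by simp [i2], fun r hr => ?_, by simp [i4],
        by simp [i5, add_assoc]⟩
      rw [← i3 r hr]
      simp; grind
  · rw [List.length_reverse, hlen]
    simp [k31]
  · rw [List.length_reverse, hlen]; exact hZ
  · rw [List.length_reverse, hlen] at hi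
    obtain ⟨hu, hv, huv, hle⟩ := h.resolve_left (by omega)
    have := (h3 hu hv huv).edge (s.reg 25 - 1 - i) (by omega)
    rw [List.getElem_reverse, List.getElem_take]
    simp only [hlen]
    rw [← this]
    simp only [cond_true, Program.exec, Memory.setReg_arr, k1, Memory.setReg_reg]
    simp only [show ¬ (32 = 30) by norm_num, if_false, k32]
    congr 1; omega
  · rw [← k2 r (by omega)]
    have : r ≠ 30 := by omega
    simp [this]
  · simp [k1]

lemma comp_emitCore {a b : ℕ} (h26 : s.reg 26 = a) (h27 : s.reg 27 = b) (hab : a ≤ b)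
    (hZ : b - a ≤ Z) : Comp emitCore s (Z * 66 + 20) (IsAppended (segment (s.arr 10) a b) s) := by
  refine Comp.mono (Comp.flat_seq (c₁ := 10) (Comp.mono (comp_copy_output (Z := Z) _
    (segment (s.arr 10) a b) ?_ ?_ fun i hi => ?_) le_rfl fun s' h => h.of_eq (fun r hr => ?_) ?_))
    (by omega) fun _ h => h
  · rw [length_segment]
    simp [h26, h27]; omega
  · rwa [length_segment]
  · simp [segment, h26]
  · simp; grind
  · simp

/-- Append the branch trail between the branch vertices with the numbers in the registers 12 and 11
that uses the odd trail in register 17 (the register contains twice its number). -/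
def emitTrail : Program :=
  .seq (.block [.setReg 26 (.entry 7 (.reg 12)), .setReg 27 (.entry 17 (.reg 17))])
  (.seq emitRow
  (.seq (.block [.setReg 26 (.entry 17 (.reg 17)), .setReg 27 (.entry 18 (.reg 17)),
    .setReg 25 (.entry 19 (.reg 17))])
  (.seq emitArm
  (.seq (.block [.setReg 26 (.entry 20 (.reg 17)), .setReg 27 (.entry 20 (.succ (.reg 17)))])
  (.seq emitCore
  (.seq (.block [.setReg 26 (.entry 17 (.succ (.reg 17))), .setReg 27 (.entry 18 (.succ (.reg 17))),
    .setReg 25 (.entry 19 (.succ (.reg 17)))])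
  (.seq emitArmReverse
  (.seq (.block [.setReg 26 (.entry 17 (.succ (.reg 17))), .setReg 27 (.entry 7 (.reg 11))])
  emitRow))))))))

lemma Comp.block_appended {p : Program} {b : Program} {c c' : ℕ} {l l' : List ℕ} {s s₁ : Memory}
    (h : IsAppended l s s₁) (hflat : b.IsFlat = true) (hc : b.size ≤ c)
    (hreg : ∀ r < 24, (b.exec s₁).reg r = s₁.reg r) (harr : (b.exec s₁).arr = s₁.arr)
    (hp : IsAppended l s (b.exec s₁) → Comp p (b.exec s₁) c' (IsAppended l' (b.exec s₁))) :
    Comp (.seq b p) s₁ (c + c') (IsAppended (l ++ l') s) := by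
  have h' : IsAppended l s (b.exec s₁) := by
    have := h.trans (IsAppended.of_eq (l := []) (s := s₁) (s₁ := b.exec s₁) (s' := b.exec s₁)
      ⟨fun _ _ _ => rfl, fun _ _ _ => rfl, rfl, by simp, fun _ _ => rfl⟩ hreg harr)
    rwa [List.append_nil] at this
  exact Comp.flat_seq ((hp h').mono le_rfl fun _ h'' => h'.trans h'') hflat hc

lemma Comp.block_appended_seq {p q b : Program} {c₁ c₂ c₃ : ℕ} {l l' : List ℕ} {s s₁ : Memory}
    {post : Memory → Prop} (h : IsAppended l s s₁) (hflat : b.IsFlat = true) (hc : b.size ≤ c₁)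
    (hreg : ∀ r < 24, (b.exec s₁).reg r = s₁.reg r) (harr : (b.exec s₁).arr = s₁.arr)
    (hp : IsAppended l s (b.exec s₁) → Comp p (b.exec s₁) c₂ (IsAppended l' (b.exec s₁)))
    (hq : ∀ s₂, IsAppended (l ++ l') s s₂ → Comp q s₂ c₃ post) :
    Comp (.seq b (.seq p q)) s₁ (c₁ + (c₂ + c₃)) post := by
  obtain ⟨s', n, h1, h2, h3⟩ := Comp.block_appended h hflat hc hreg harr hp
  obtain ⟨s'', n', h4, h5, h6⟩ := hq s' h3
  -- The program brackets the sequence the other way, so the run is taken apart and put together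
  -- again.
  cases h1 with
  | seq h1 h1' => exact ⟨s'', _, .seq h1 (.seq h1' h4), by omega, h6⟩

/-- A branch trail is emitted in five pieces: link, arm, core, reversed arm, link. Each piece uses
only registers from 24 onwards as scratch space, apart from the output pointer, so the indices and
the description of the routing survive. -/
lemma comp_emitTrail {r : Routing ℕ} {m q t : ℕ} {c p : ℕ → ℕ} (hT : IsTable H S Q s)
    (hr : r.Valid G S Q c p m q) (hc : s.arr 10 = c) (h17 : ∀ σ < 2 * m, s.arr 17 σ = r.root σ)
    (h18 : ∀ σ < 2 * m, s.arr 18 σ = r.other σ) (h19 : s.arr 19 = r.len) (h20 : s.arr 20 = r.pos)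
    (hQZ : ∀ u ∈ S, ∀ v ∈ S, u ≠ v → (Q u v).length ≤ Z) (hsize : r.size m ≤ Z)
    (hBS : ∀ i < t, s.arr 7 i ∈ S) {i j k : ℕ} (hx : r.Admissible m t (s.arr 7) ((i, j), k))
    (hi : s.reg 12 = i) (hj : s.reg 11 = j) (hk : s.reg 17 = 2 * k) :
    Comp emitTrail s (s.reg 7 * 400 + Z * 400 + 500)
      (IsAppended (r.branchTrail Q c (s.arr 7) ((i, j), k)) s) := by
  have hkm : k < m := hx.lt
  have h0 : 2 * k < 2 * m := by omega
  have h1 : 2 * k + 1 < 2 * m := by omega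
  have hlen : ∀ σ < 2 * m, r.len σ ≤ Z := by
    intro σ hσ
    rcases hr.len_valid σ hσ with h | ⟨h, h', h''⟩
    · omega
    · exact h''.trans (hQZ _ (hr.root_mem _ hσ) _ h h')
  have harm : ∀ σ < 2 * m, r.len σ = 0 ∨ r.root σ ∈ S ∧ r.other σ ∈ S ∧ r.root σ ≠ r.other σ ∧
      r.len σ ≤ (Q (r.root σ) (r.other σ)).length := by
    intro σ hσ
    rcases hr.len_valid σ hσ with h | ⟨h, h', h''⟩
    · exact Or.inl h
    · exact Or.inr ⟨hr.root_mem _ hσ, h, h', h''⟩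
  have hb : r.branchTrail Q c (s.arr 7) ((i, j), k) = [] ++ Q (s.arr 7 i) (r.root (2 * k)) ++
      r.arm Q (2 * k) ++ segment c (r.pos (2 * k)) (r.pos (2 * k + 1)) ++
      (r.arm Q (2 * k + 1)).reverse ++ Q (r.root (2 * k + 1)) (s.arr 7 j) := by
    simp [Routing.branchTrail, Routing.middle]
  rw [hb]
  have hframe : ∀ {l : List ℕ} {s' : Memory}, IsAppended l s s' → IsTable H S Q s' ∧
      s'.reg 7 = s.reg 7 ∧ s'.reg 11 = j ∧ s'.reg 12 = i ∧ s'.reg 17 = 2 * k ∧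
      s'.arr 7 = s.arr 7 ∧ s'.arr 10 = c ∧ s'.arr 17 = s.arr 17 ∧ s'.arr 18 = s.arr 18 ∧
      s'.arr 19 = r.len ∧ s'.arr 20 = r.pos := by
    intro l s' h
    have h7 := h.reg 7 (by norm_num) (by norm_num)
    refine ⟨hT.of_eq h7 fun a h1 h2 => h.arr a (by omega) (by omega), h7, ?_, ?_, ?_, ?_, ?_, ?_, ?_,
      ?_, ?_⟩
    · rw [h.reg 11 (by norm_num) (by norm_num), hj]
    · rw [h.reg 12 (by norm_num) (by norm_num), hi]
    · rw [h.reg 17 (by norm_num) (by norm_num), hk]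
    · exact h.arr 7 (by norm_num) (by norm_num)
    · rw [h.arr 10 (by norm_num) (by norm_num), hc]
    · exact h.arr 17 (by norm_num) (by norm_num)
    · exact h.arr 18 (by norm_num) (by norm_num)
    · rw [h.arr 19 (by norm_num) (by norm_num), h19]
    · rw [h.arr 20 (by norm_num) (by norm_num), h20]
  have hnil : IsAppended [] s s :=
    ⟨fun _ _ _ => rfl, fun _ _ _ => rfl, rfl, by simp, fun _ _ => rfl⟩
  refine Comp.mono (c₁ := 10 + ((s.reg 7 * 100 + Z * 66 + 50) + (20 + ((s.reg 7 * 100 + Z * 66 +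
     50) + (20 + ((Z * 66 + 20) + (20 + ((s.reg 7 * 100 + Z * 75 + 60) + (20 + (s.reg 7 * 100 + Z * 66 + 50)))))))))) ?_ (by omega) fun _ h => h
  refine Comp.block_appended_seq hnil rfl (by decide) (fun r hr => by simp; grind) (by simp)
    (fun h => ?_) fun s₁ h₁ => Comp.block_appended_seq h₁ rfl (by decide)
    (fun r hr => by simp; grind) (by simp) (fun h => ?_) fun s₂ h₂ =>
    Comp.block_appended_seq h₂ rfl (by decide) (fun r hr => by simp; grind) (by simp)
    (fun h => ?_) fun s₃ h₃ => Comp.block_appended_seq h₃ rfl (by decide)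
    (fun r hr => by simp; grind) (by simp) (fun h => ?_) fun s₄ h₄ =>
    Comp.block_appended h₄ rfl (by decide) (fun r hr => by simp; grind) (by simp) (fun h => ?_)
  · obtain ⟨k0, k7, -⟩ := hframe h
    rw [← k7]
    refine comp_emitRow k0 ?_ ?_ (hBS i hx.fst_lt) (hr.root_mem _ h0) (hx.fst_ne i hx.fst_lt)
      (hQZ _ (hBS i hx.fst_lt) _ (hr.root_mem _ h0) (hx.fst_ne i hx.fst_lt))
    · simp [hi]
    · simp [hk, h17 _ h0]
  · obtain ⟨-, -, -, -, g17, -, -, e17, e18, e19, -⟩ := hframe h₁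
    obtain ⟨k0, k7, -⟩ := hframe h
    rw [← k7]
    refine comp_emitArm k0 ?_ ?_ ?_ (harm _ h0) (hlen _ h0)
    · simp [g17, e17, h17 _ h0]
    · simp [g17, e18, h18 _ h0]
    · simp [g17, e19]
  · obtain ⟨-, -, -, -, g17, -, e10, -, -, -, e20⟩ := hframe h₂
    obtain ⟨-, -, -, -, -, -, k10, -⟩ := hframe h
    rw [← k10]
    refine comp_emitCore ?_ ?_ (hr.pos_le k hkm) ((r.pos_sub_le_size hkm).trans hsize)
    · simp [g17, e20]
    · simp [g17, e20]
  · obtain ⟨-, -, -, -, g17, -, -, e17, e18, e19, -⟩ := hframe h₃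
    obtain ⟨k0, k7, -⟩ := hframe h
    rw [← k7]
    refine comp_emitArmReverse k0 ?_ ?_ ?_ (harm _ h1) (hlen _ h1)
    · simp [g17, e17, h17 _ h1]
    · simp [g17, e18, h18 _ h1]
    · simp [g17, e19]
  · obtain ⟨-, -, g11, -, g17, e7, -, e17, -⟩ := hframe h₄
    obtain ⟨k0, k7, -⟩ := hframe h
    rw [← k7]
    have hne := (hx.snd_ne j hx.snd_lt).symm
    refine comp_emitRow k0 ?_ ?_ (hr.root_mem _ h1) (hBS j hx.snd_lt) hne
      (hQZ _ (hr.root_mem _ h1) _ (hBS j hx.snd_lt) hne)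
    · simp [g17, e17, h17 _ h1]
    · simp [g11, e7]

end Emit

/-! ### Greedy choice and output of all branch trails -/

section EmitAll

/-- The pairs of vertices whose linking trails are used completely in the branch trail `x`. -/
def Routing.links (r : Routing ℕ) (B : ℕ → ℕ) (x : (ℕ × ℕ) × ℕ) : List (ℕ × ℕ) :=
  [(B x.1.1, r.root (2 * x.2)), (B x.1.2, r.root (2 * x.2 + 1))]

lemma mem_vertexPairs {B : ℕ → ℕ} {t : ℕ} {y : ℕ × ℕ} :
    y ∈ vertexPairs B t ↔ ∃ i < t, ∃ j < t, y = (B i, B j) := by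
  simp only [vertexPairs, List.mem_flatMap, List.mem_range, List.mem_map]
  constructor
  · rintro ⟨i, hi, j, hj, rfl⟩; exact ⟨i, hi, j, hj, rfl⟩
  · rintro ⟨i, hi, j, hj, rfl⟩; exact ⟨i, hi, j, hj, rfl⟩

lemma length_vertexPairs (B : ℕ → ℕ) (t : ℕ) : (vertexPairs B t).length = t * t := by
  simp [vertexPairs]

lemma length_flatMap_links (r : Routing ℕ) (B : ℕ → ℕ) (sel : List ((ℕ × ℕ) × ℕ)) :
    (sel.flatMap (r.links B)).length = 2 * sel.length := by
  induction sel with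
  | nil => rfl
  | cons x l ih => simp [ih, Routing.links]; ring

/-- The stored list consists of the pairs of the routing, all pairs of branch vertices and the links
used so far. A pair absent from it is unassigned, contains no second branch vertex and differs from
all earlier links; together with the flags in array 21 this is admissibility and compatibility. -/
lemma usable_iff {r : Routing ℕ} {m t : ℕ} {B : ℕ → ℕ} {sel : List ((ℕ × ℕ) × ℕ)} {s : Memory}
    (h : IsMarked r m (vertexPairs B t ++ sel.flatMap (r.links B)) s)
    (h21 : ∀ k < m, s.arr 21 k = 0 ↔ k ∉ sel.map Prod.snd) {i j k : ℕ} (hi : i < t) (hj : j < t)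
    (hk : k < m) : s.Usable (B i) (B j) k ↔
      r.Admissible m t B ((i, j), k) ∧ ∀ x ∈ sel, r.Compatible B x ((i, j), k) := by
  have hmem : ∀ (P : ℕ × ℕ → Prop), (∃ y ∈ vertexPairs B t ++ sel.flatMap (r.links B), P y) ↔
      (∃ i < t, ∃ j < t, P (B i, B j)) ∨ ∃ x ∈ sel, P (B x.1.1, r.root (2 * x.2)) ∨
        P (B x.1.2, r.root (2 * x.2 + 1)) := by
    intro P
    simp only [List.mem_append, mem_vertexPairs, List.mem_flatMap, Routing.links, List.mem_cons,
      List.not_mem_nil, or_false]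
    constructor
    · rintro ⟨y, ⟨i, hi, j, hj, rfl⟩ | ⟨x, hx, rfl | rfl⟩, hy⟩
      · exact Or.inl ⟨i, hi, j, hj, hy⟩
      · exact Or.inr ⟨x, hx, Or.inl hy⟩
      · exact Or.inr ⟨x, hx, Or.inr hy⟩
    · rintro (⟨i, hi, j, hj, hy⟩ | ⟨x, hx, hy | hy⟩)
      · exact ⟨_, Or.inl ⟨i, hi, j, hj, rfl⟩, hy⟩
      · exact ⟨_, Or.inr ⟨x, hx, Or.inl rfl⟩, hy⟩
      · exact ⟨_, Or.inr ⟨x, hx, Or.inr rfl⟩, hy⟩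
  rw [Memory.Usable, h.touched_iff, h.touched_iff, h21 k hk, hmem, hmem,
    (h.pair (2 * k) (by omega)).1, (h.pair (2 * k + 1) (by omega)).1]
  constructor
  · rintro ⟨h1, h2, h3⟩
    simp only [not_or, not_exists, not_and] at h1 h2
    refine ⟨⟨hi, hj, hk, fun i' hi' heq => ?_, fun i' hi' heq => ?_, h1.1, h2.1⟩, fun x hx =>
      ⟨fun heq => h3 (List.mem_map.2 ⟨x, hx, heq⟩), (h1.2.2 x hx).1, (h1.2.2 x hx).2,
        (h2.2.2 x hx).1, (h2.2.2 x hx).2⟩⟩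
    · exact h1.2.1 i hi i' hi' (by simp only [heq])
    · exact h2.2.1 j hj i' hi' (by simp only [heq])
  · rintro ⟨h1, h2⟩
    refine ⟨?_, ?_, fun hk' => ?_⟩
    · rintro (h | ⟨i', hi', j', hj', h⟩ | ⟨x, hx, h | h⟩)
      · exact h1.fst_untouched h
      · rcases Sym2.eq_iff.1 h with ⟨-, h⟩ | ⟨h, -⟩
        · exact h1.fst_ne _ hj' h
        · exact h1.fst_ne _ hi' h
      · exact (h2 x hx).fst_fst h
      · exact (h2 x hx).snd_fst h
    · rintro (h | ⟨i', hi', j', hj', h⟩ | ⟨x, hx, h | h⟩)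
      · exact h1.snd_untouched h
      · rcases Sym2.eq_iff.1 h with ⟨-, h⟩ | ⟨h, -⟩
        · exact h1.snd_ne _ hj' h
        · exact h1.snd_ne _ hi' h
      · exact (h2 x hx).fst_snd h
      · exact (h2 x hx).snd_snd h
    · obtain ⟨x, hx, rfl⟩ := List.mem_map.1 hk'
      exact (h2 x hx).ne rfl

/-- Choose a branch trail, and write it to the output. -/
def emitNext : Program :=
  .seq chooseTrail (.seq emitTrail (.block [.setArr 21 (.reg 16) (.num 1),
    .setArr 17 (.reg 9) (.entry 7 (.reg 12)), .setArr 18 (.reg 9) (.entry 17 (.reg 17)),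
    .setReg 9 (.succ (.reg 9)), .setArr 17 (.reg 9) (.entry 7 (.reg 11)),
    .setArr 18 (.reg 9) (.entry 17 (.succ (.reg 17))), .setReg 9 (.succ (.reg 9)),
    .setReg 19 (.succ (.reg 19)), .setArr 9 (.reg 19) (.reg 8)]))

/-- The branch trails in `sel` have been written to the output, `s₀` being the memory content before
that. -/
structure IsEmitted (r : Routing ℕ) (Q : ℕ → ℕ → List ℕ) (m t : ℕ) (s₀ : Memory)
    (sel : List ((ℕ × ℕ) × ℕ)) (s : Memory) : Prop where
  reg : ∀ r < 11, r ≠ 8 → r ≠ 9 → s.reg r = s₀.reg r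
  arr : ∀ a, a ≠ 8 → a ≠ 9 → a ≠ 17 → a ≠ 18 → a ≠ 21 → a ≠ 22 → s.arr a = s₀.arr a
  selection : r.Selection m t (s₀.arr 7) sel
  marked : IsMarked r m (vertexPairs (s₀.arr 7) t ++ sel.flatMap (r.links (s₀.arr 7))) s
  used : ∀ k < m, s.arr 21 k = 0 ↔ k ∉ sel.map Prod.snd
  pointer : s.reg 8 = (sel.map (r.branchTrail Q (s₀.arr 10) (s₀.arr 7))).flatten.length
  holds : s.Holds 8 (sel.map (r.branchTrail Q (s₀.arr 10) (s₀.arr 7))).flatten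
  length : s.reg 19 = sel.length
  offset : ∀ p ≤ sel.length,
    s.arr 9 p = ((sel.map (r.branchTrail Q (s₀.arr 10) (s₀.arr 7))).take p).flatten.length

variable {G H : Graph ℕ ℕ} {S : List ℕ} {Q : ℕ → ℕ → List ℕ} {s₀ s : Memory} {Z : ℕ}

lemma IsEmitted.of_eq {r : Routing ℕ} {m t : ℕ} {sel : List ((ℕ × ℕ) × ℕ)} {s' : Memory}
    (h : IsEmitted r Q m t s₀ sel s) (hreg : ∀ r < 11, s'.reg r = s.reg r)
    (h19 : s'.reg 19 = s.reg 19) (harr : s'.arr = s.arr) : IsEmitted r Q m t s₀ sel s' := by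
  have h8 := hreg 8 (by norm_num)
  refine ⟨fun r hr h8 h9 => (hreg r hr).trans (h.reg r hr h8 h9), by rw [harr]; exact h.arr,
    h.selection, h.marked.of_eq (hreg 9 (by norm_num)) (by rw [harr]) (by rw [harr]),
    by rw [harr]; exact h.used, h8.trans h.pointer, ?_, h19.trans h.length,
    by rw [harr]; exact h.offset⟩
  unfold Memory.Holds
  rw [harr]; exact h.holds

/-- The two links are appended to the list of pairs and the odd trail is flagged, so that the next
search sees them as used. Only entries beyond the first 2m pairs are added, hence the routing itself
is unaffected. -/
lemma comp_emitNext {r : Routing ℕ} {m t i j : ℕ} {p : ℕ → ℕ} {sel : List ((ℕ × ℕ) × ℕ)}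
    (hT : IsTable H S Q s₀) (hr : r.Valid G S Q (s₀.arr 10) p m (20 * t))
    (hm : m = 3500 * t ^ 2) (h10 : s₀.reg 10 = m) (h19 : s₀.arr 19 = r.len)
    (h20 : s₀.arr 20 = r.pos) (hQZ : ∀ u ∈ S, ∀ v ∈ S, u ≠ v → (Q u v).length ≤ Z)
    (hsize : r.size m ≤ Z) (hBS : ∀ i < t, s₀.arr 7 i ∈ S)
    (hB : ∀ i < t, ∀ j < t, s₀.arr 7 i = s₀.arr 7 j → i = j)
    (hdeg : ∀ i < t, incidences r.root r.other (2 * m) (s₀.arr 7 i) ≤ 20 * t)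
    (hs : IsEmitted r Q m t s₀ sel s) (hi : s.reg 12 = i) (hj : s.reg 11 = j) (hit : i < t)
    (hjt : j < t) (hkeys : (sel.map Prod.fst).Nodup) (hlen : sel.length ≤ t ^ 2) :
    Comp emitNext s (m * ((2 * m + 3 * t ^ 2) * 200 + 150) + (s₀.reg 7 * 400 + Z * 400) + 600)
      fun s' => s'.reg 11 = j ∧ s'.reg 12 = i ∧
        ∃ k, IsEmitted r Q m t s₀ (sel ++ [((i, j), k)]) s' := by
  set B := s₀.arr 7 with hBdef
  set c := s₀.arr 10 with hcdef
  have h7 : s.arr 7 = B := hs.arr 7 (by norm_num) (by norm_num) (by norm_num) (by norm_num)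
    (by norm_num) (by norm_num)
  have hs10 : s.reg 10 = m := by
    rw [hs.reg 10 (by norm_num) (by norm_num) (by norm_num), h10]
  -- There are 2m pairs of the routing, t² pairs of branch vertices and two links for each of at
  -- most t² branch trails.
  have h9 : s.reg 9 ≤ 2 * m + 3 * t ^ 2 := by
    rw [hs.marked.reg, List.length_append, length_vertexPairs, length_flatMap_links, sq]
    rw [sq] at hlen
    omega
  obtain ⟨k₀, hk₀, hk₀'⟩ := Routing.exists_admissible hr.count_le hm hB hs.selection hdeg hkeys hlen
    hit hjt
  have huse := fun k (hk : k < m) => usable_iff hs.marked hs.used hit hjt hk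
  refine Comp.mono (Comp.seq (comp_chooseTrail s ⟨k₀, hs10 ▸ hk₀.lt, by
    rw [h7, hi, hj]; exact (huse k₀ hk₀.lt).2 ⟨hk₀, hk₀'⟩⟩) fun s₁ ⟨a1, a2, a19, a16, a17, a3⟩ =>
    Comp.seq (c₁ := s₀.reg 7 * 400 + Z * 400 + 500) (c₂ := 60)
      (mid := IsAppended (r.branchTrail Q c B ((i, j), s₁.reg 16)) s₁) ?_ fun s₂ h₂ =>
    Comp.flat ?_) ?_ fun _ h => h
  · rw [hs10] at a16
    rw [h7, hi, hj] at a3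
    obtain ⟨hadm, -⟩ := (huse _ a16).1 a3
    have b7 : s₁.reg 7 = s₀.reg 7 := by
      rw [a2 7 (by norm_num), hs.reg 7 (by norm_num) (by norm_num) (by norm_num)]
    have barr : ∀ a, a ≠ 8 → a ≠ 9 → a ≠ 17 → a ≠ 18 → a ≠ 21 → a ≠ 22 → s₁.arr a = s₀.arr a := by
      rw [a1]; exact hs.arr
    have b7' : s₁.arr 7 = B := by rw [a1, h7]
    have := comp_emitTrail (Z := Z) (s := s₁) (t := t) (i := i) (j := j) (k := s₁.reg 16) (hT.of_eq b7
      fun a h1 h2 => barr a (by omega) (by omega) (by omega) (by omega) (by omega) (by omega)) hr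
      (barr 10 (by norm_num) (by norm_num) (by norm_num) (by norm_num) (by norm_num) (by norm_num))
      (fun σ hσ => by rw [a1]; exact (hs.marked.pair σ hσ).1)
      (fun σ hσ => by rw [a1]; exact (hs.marked.pair σ hσ).2)
      ((barr 19 (by norm_num) (by norm_num) (by norm_num) (by norm_num) (by norm_num)
        (by norm_num)).trans h19)
      ((barr 20 (by norm_num) (by norm_num) (by norm_num) (by norm_num) (by norm_num)
        (by norm_num)).trans h20) hQZ hsize (by rw [b7']; exact hBS) (by rw [b7']; exact hadm)
      ((a2 12 (by norm_num)).trans hi) ((a2 11 (by norm_num)).trans hj) a17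
    rw [b7, b7'] at this
    exact this
  · rw [hs10] at a16
    rw [h7, hi, hj] at a3
    obtain ⟨hadm, hcomp⟩ := (huse _ a16).1 a3
    set k := s₁.reg 16 with hk
    set w := r.branchTrail Q c B ((i, j), k) with hw
    have breg : ∀ r < 14, r ≠ 8 → s₂.reg r = s.reg r := fun r hr h8 =>
      (h₂.reg r (by omega) h8).trans (a2 r hr)
    have b16 : s₂.reg 16 = k := h₂.reg 16 (by norm_num) (by norm_num)
    have b17 : s₂.reg 17 = 2 * k := (h₂.reg 17 (by norm_num) (by norm_num)).trans a17
    have b19 : s₂.reg 19 = sel.length := by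
      rw [h₂.reg 19 (by norm_num) (by norm_num), a19, hs.length]
    have b8 : s₂.reg 8 = s.reg 8 + w.length := by rw [h₂.pointer, a2 8 (by norm_num)]
    have barr : ∀ a, a ≠ 8 → a ≠ 22 → s₂.arr a = s.arr a := fun a h1 h2 => by
      rw [h₂.arr a h1 h2, a1]
    have b7 : s₂.arr 7 = B := (barr 7 (by norm_num) (by norm_num)).trans h7
    have b9 := breg 9 (by norm_num) (by norm_num)
    have b11 := (breg 11 (by norm_num) (by norm_num)).trans hj
    have b12 := (breg 12 (by norm_num) (by norm_num)).trans hi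
    have hmark₂ := hs.marked.of_eq b9 (barr 17 (by norm_num) (by norm_num))
      (barr 18 (by norm_num) (by norm_num))
    have hk2 : 2 * k < s₂.reg 9 := by rw [hmark₂.reg]; omega
    have hk21 : 2 * k + 1 < s₂.reg 9 := by rw [hmark₂.reg]; omega
    set s₃ := Program.exec _ s₂ with hs₃
    have c17 : s₃.arr 17 = Function.update (Function.update (s₂.arr 17) (s₂.reg 9) (B i))
        (s₂.reg 9 + 1) (B j) := by
      simp [hs₃, Memory.setArr_arr, b7, b11, b12]
    have c18 : s₃.arr 18 = Function.update (Function.update (s₂.arr 18) (s₂.reg 9)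
        (r.root (2 * k))) (s₂.reg 9 + 1) (r.root (2 * k + 1)) := by
      have e1 : 2 * k ≠ s₂.reg 9 := by omega
      have e2 : 2 * k + 1 ≠ s₂.reg 9 := by omega
      simp [hs₃, Memory.setArr_arr, b17, Function.update_of_ne, e1, e2,
        (hmark₂.pair (2 * k) (by omega)).1, (hmark₂.pair (2 * k + 1) (by omega)).1]
    have c21 : s₃.arr 21 = Function.update (s.arr 21) k 1 := by
      simp [hs₃, Memory.setArr_arr, b16, barr 21]
    have c8 : s₃.arr 8 = s₂.arr 8 := by simp [hs₃, Memory.setArr_arr]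
    have c9 : s₃.arr 9 = Function.update (s.arr 9) (sel.length + 1) (s.reg 8 + w.length) := by
      simp [hs₃, Memory.setArr_arr, b19, barr 9, b8]
    have creg : ∀ r, r ≠ 9 → r ≠ 19 → s₃.reg r = s₂.reg r := fun r h1 h2 => by
      simp [hs₃, h1, h2]
    have cr9 : s₃.reg 9 = s₂.reg 9 + 1 + 1 := by simp [hs₃]
    have cr19 : s₃.reg 19 = sel.length + 1 := by simp [hs₃, b19]
    have hmap : (sel ++ [((i, j), k)]).map (r.branchTrail Q c B) =
        sel.map (r.branchTrail Q c B) ++ [w] := by simp [hw]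
    refine ⟨by rw [creg 11 (by norm_num) (by norm_num), b11],
      by rw [creg 12 (by norm_num) (by norm_num), b12], k,
      ⟨fun r hr h8 h9 => ?_, fun a n8 n9 n17 n18 n21 n22 => ?_, hs.selection.concat hadm hcomp, ?_,
      fun k' hk' => ?_, ?_, fun z hz => ?_, ?_, fun p hp => ?_⟩⟩
    · rw [creg r h9 (by omega), breg r (by omega) h8, hs.reg r hr h8 h9]
    · rw [← hs.arr a n8 n9 n17 n18 n21 n22, ← barr a n8 n22]
      simp [hs₃, Memory.setArr_arr, n9, n17, n18, n21]
    · have h1 := (hmark₂.push (s' := ⟨fun _ => s₂.reg 9 + 1, fun a => if a = 17 then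
        Function.update (s₂.arr 17) (s₂.reg 9) (B i) else
        Function.update (s₂.arr 18) (s₂.reg 9) (r.root (2 * k))⟩) (a := B i) (b := r.root (2 * k))
        rfl rfl rfl).push (s' := s₃) (a := B j) (b := r.root (2 * k + 1)) cr9 c17 c18
      simpa [Routing.links, ← hBdef] using h1
    · rw [c21, List.map_append, List.mem_append, not_or, ← hs.used k' hk']
      by_cases hkk : k' = k
      · subst hkk; simp
      · simp [hkk]
    · rw [creg 8 (by norm_num) (by norm_num), b8, hmap, hs.pointer]
      simp [hBdef, hcdef]
    · simp only [c8, ← hBdef, ← hcdef, hmap, List.flatten_append, List.flatten_singleton] at hz ⊢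
      rcases Nat.lt_or_ge z (sel.map (r.branchTrail Q c B)).flatten.length with hz' | hz'
      · rw [List.getElem_append_left hz', h₂.old z (by rw [a2 8 (by norm_num), hs.pointer]; exact hz'),
          a1]
        exact hs.holds z hz'
      · rw [List.getElem_append_right hz']
        rw [List.length_append] at hz
        rw [← h₂.new _ (by omega), a2 8 (by norm_num), hs.pointer]
        congr 1
        simp only [← hBdef, ← hcdef]
        omega
    · rw [cr19]; simp
    · rw [c9, ← hBdef, ← hcdef, hmap]
      rcases Nat.lt_or_ge sel.length p with hp' | hp'
      · obtain rfl : p = sel.length + 1 := by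
          rw [List.length_append, List.length_singleton] at hp; omega
        rw [Function.update_self, List.take_of_length_le (by simp), hs.pointer]
        simp [hBdef, hcdef]
      · rw [Function.update_of_ne (by omega), hs.offset p hp', List.take_append_of_le_length
          (by simpa using hp')]
  · rw [hs10]
    have h1 := Nat.mul_le_mul_left m
      (Nat.add_le_add_right (Nat.mul_le_mul_right 200 h9) 150)
    have h2 : ∀ y z a : ℕ, z ≤ y → z + 20 + (a + 500 + 60) ≤ y + a + 600 := by omega
    exact h2 _ _ _ h1

/-- Write all branch trails to the output. -/
def emitAll : Program :=
  .seq (.block [.setReg 8 (.num 0), .setReg 19 (.num 0), .setArr 9 (.num 0) (.num 0),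
    .setReg 11 (.num 0)])
  (.forLoop 11 0 (.seq (.setReg 12 (.num 0)) (.forLoop 12 11 emitNext)))

lemma comp_emitAll {r : Routing ℕ} {m t : ℕ} {p : ℕ → ℕ}
    (hT : IsTable H S Q s) (hr : r.Valid G S Q (s.arr 10) p m (20 * t))
    (hm : m = 3500 * t ^ 2) (h0 : s.reg 0 = t) (h10 : s.reg 10 = m) (h19 : s.arr 19 = r.len)
    (h20 : s.arr 20 = r.pos) (hQZ : ∀ u ∈ S, ∀ v ∈ S, u ≠ v → (Q u v).length ≤ Z)
    (hsize : r.size m ≤ Z) (hBS : ∀ i < t, s.arr 7 i ∈ S)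
    (hB : ∀ i < t, ∀ j < t, s.arr 7 i = s.arr 7 j → i = j)
    (hdeg : ∀ i < t, incidences r.root r.other (2 * m) (s.arr 7 i) ≤ 20 * t)
    (hmark : IsMarked r m (vertexPairs (s.arr 7) t) s) (h21 : ∀ k < m, s.arr 21 k = 0) :
    Comp emitAll s (t * (t * (m * ((2 * m + 3 * t ^ 2) * 200 + 150) +
        (s.reg 7 * 400 + Z * 400) + 606) + 20) + 30)
      fun s' => ∃ sel, sel.map Prod.fst = pairList t ∧ IsEmitted r Q m t s sel s' := by
  set W := m * ((2 * m + 3 * t ^ 2) * 200 + 150) + (s.reg 7 * 400 + Z * 400) + 600 with hW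
  refine Comp.mono (Comp.flat_seq (c₁ := 15) (Comp.forLoop (c := t * (W + 6) + 10) (fun j s' =>
      s'.reg 11 = j ∧ ∃ sel, sel.map Prod.fst = pairList j ∧ IsEmitted r Q m t s sel s') 0 t
      (Nat.zero_le _) ?_ ?_ ?_ fun s' h => h.2)) ?_ fun _ h => h
  · rintro k s' ⟨h1, sel, -, h2⟩
    exact ⟨h1, by rw [h2.reg 0 (by norm_num) (by norm_num) (by norm_num), h0]⟩
  · refine ⟨by simp, [], by simp [pairList], fun r hr h8 h9 => ?_, fun a h8 h9 _ _ _ _ => ?_,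
      ⟨by simp, by simp⟩, ?_, fun k hk => by simp [Memory.setArr_arr, h21 k hk], by simp, fun z hz => by simp at hz,
      by simp, fun p hp => ?_⟩
    · simp; grind
    · simp [Memory.setArr_arr, h9]
    · exact IsMarked.of_eq (s := s) (by simpa using hmark) (by simp) (by simp [Memory.setArr_arr])
        (by simp [Memory.setArr_arr])
    · obtain rfl : p = 0 := by simpa using hp
      simp [Memory.setArr_arr]
  · rintro j - hj s₁ ⟨i11, sel, hsel, hem⟩
    refine Comp.mono (Comp.flat_seq (c₁ := 3) (Comp.forLoop (c := W) (fun i s' =>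
      s'.reg 12 = i ∧ s'.reg 11 = j ∧ ∃ sel, sel.map Prod.fst =
        pairList j ++ (List.range i).map (fun i => (i, j)) ∧ IsEmitted r Q m t s sel s') 0 j
      (Nat.zero_le _) ?_ ?_ ?_ ?_)) ?_ fun _ h => h
    · rintro k s' ⟨h1, h2, -⟩
      exact ⟨h1, h2⟩
    · refine ⟨by simp, by simp [i11], sel, by simpa using hsel, hem.of_eq (fun r hr => ?_) ?_ rfl⟩
      · simp; grind
      · simp
    · rintro i - hi s₂ ⟨j12, j11, sel, hsel, hem⟩
      have hkeys : (sel.map Prod.fst) <+: pairList t := by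
        refine List.IsPrefix.trans ?_ (pairList_prefix (Nat.succ_le_of_lt hj))
        rw [hsel, pairList_succ, List.prefix_append_right_inj]
        exact List.IsPrefix.map _ (by
          rw [List.prefix_iff_eq_take, List.length_range, List.take_range, min_eq_left hi.le])
      refine (comp_emitNext hT hr hm h10 h19 h20 hQZ hsize hBS hB hdeg hem j12 j11 (hi.trans hj) hj
        ((nodup_pairList t).sublist hkeys.sublist) ?_).mono le_rfl ?_
      · rw [← List.length_map (f := Prod.fst), sq]
        exact hkeys.length_le.trans (length_pairList_le t)
      · rintro s' ⟨k11, k12, k, hem'⟩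
        refine ⟨by simp [k12], by simp [k11], _, ?_, hem'.of_eq (fun r hr => ?_) ?_ rfl⟩
        · simp [hsel, List.range_succ]
        · have : r ≠ 12 := by omega
          simp [this]
        · simp
    · rintro s' ⟨-, k11, sel, hsel, hem⟩
      rw [← pairList_succ] at hsel
      refine ⟨by simp [k11], sel, hsel, hem.of_eq (fun r hr => ?_) ?_ rfl⟩
      · have : r ≠ 11 := by omega
        simp [this]
      · simp
    · have := Nat.mul_le_mul_right (W + 6) hj.le
      rw [Nat.sub_zero]
      omega
  · have h1 : t * (t * (W + 6) + 10 + 6) ≤ t * (t * (W + 6) + 20) := Nat.mul_le_mul_left _ (by omega)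
    have h2 : m * ((2 * m + 3 * t ^ 2) * 200 + 150) + (s.reg 7 * 400 + Z * 400) + 606 = W + 6 := by
      rw [hW]
    rw [h2, Nat.sub_zero]
    omega

end EmitAll

/-! ### The complete program and its running time -/

section Solve

/-- Set the entries of array 21 to zero. -/
def clearUsed : Program :=
  .seq (.setReg 11 (.num 0)) (.forLoop 11 10 (.setArr 21 (.reg 11) (.num 0)))

lemma comp_clearUsed (s : Memory) :
    Comp clearUsed s (s.reg 10 * 9 + 10) fun s' => (∀ r, r ≠ 11 → s'.reg r = s.reg r) ∧
      (∀ a, a ≠ 21 → s'.arr a = s.arr a) ∧ ∀ k < s.reg 10, s'.arr 21 k = 0 := by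
  refine Comp.mono (Comp.flat_seq (c₁ := 3) (Comp.forLoop (c := 3) (fun n s' =>
    s'.reg 11 = n ∧ (∀ r, r ≠ 11 → s'.reg r = s.reg r) ∧ (∀ a, a ≠ 21 → s'.arr a = s.arr a) ∧
      ∀ k < n, s'.arr 21 k = 0) 0 (s.reg 10) (Nat.zero_le _) ?_ ?_ ?_ fun s' h => h.2)) ?_
    fun _ h => h
  · exact fun k s' h => ⟨h.1, h.2.1 10 (by norm_num)⟩
  · exact ⟨by simp, fun r hr => by simp [hr], fun a _ => by simp, by simp⟩
  · rintro k - - s₁ ⟨h1, h2, h3, h4⟩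
    refine Comp.flat ⟨by simp [h1], fun r hr => by simp [hr, h2 r hr],
      fun a ha => by simp [Memory.setArr_arr, ha, h3 a ha], fun i hi => ?_⟩
    rcases Nat.lt_succ_iff_lt_or_eq.1 hi with hi | rfl
    · simp [Memory.setArr_arr, h1, Function.update_of_ne hi.ne, h4 i hi]
    · simp [Memory.setArr_arr, h1]
  · omega

/-- Find a totally odd immersion. -/
def solve : Program :=
  .seq prepare (.seq rerouteAll (.seq selectVertices (.seq markVertices (.seq clearUsed emitAll))))

/-- A bound for the running time if trails have length at most `Z`. -/
def solveCost (t Z : ℕ) : ℕ :=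
  t ^ 2 * (Z + 2) * 600000000 +
  ((Z + 2) * (2 * (1400 * t * (1400 * t)) * (3500 * t ^ 2 * 200 +
    Z * (3500 * t ^ 2 * 100 + 160) + 306) + 20) +
  (1400 * t * (2 * (3500 * t ^ 2) * 100 + 60) + 20 +
  (t * (t * 36 + 20) + 10 +
  (3500 * t ^ 2 * 9 + 10 +
  (t * (t * (3500 * t ^ 2 * ((2 * (3500 * t ^ 2) + 3 * t ^ 2) * 200 + 150) +
        (2 * (1400 * t * (1400 * t)) * 400 + Z * 400) + 606) + 20) + 30)))))

lemma isOutput_of_isEmitted {G : Graph ℕ ℕ} {t : ℕ} {ψ : Immersion (completeK t) G}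
    {r : Routing ℕ} {Q : ℕ → ℕ → List ℕ} {m : ℕ} {s₀ s : Memory} {sel : List ((ℕ × ℕ) × ℕ)}
    (hs : IsEmitted r Q m t s₀ sel s) (hv : ∀ i, ψ.vertexMap i = s₀.arr 7 i)
    (hψ : (pairs t).map ψ.edgeMap = sel.map (r.branchTrail Q (s₀.arr 10) (s₀.arr 7))) :
    IsOutput s ψ := by
  refine ⟨fun i hi => ?_, ?_, fun i hi => ?_⟩
  · rw [hs.arr 7 (by norm_num) (by norm_num) (by norm_num) (by norm_num) (by norm_num)
      (by norm_num)]
    simp [Immersion.vertexList, hv]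
  · rw [Immersion.trailList, hψ]
    exact hs.holds
  · simp only [offsets, Immersion.trailList, hψ, List.length_map, List.length_range] at hi
    rw [hs.offset i (by omega)]
    simp only [offsets, Immersion.trailList, hψ, List.getElem_map, List.getElem_range]

/-- The phases are chained on actual memory contents. The routing and the selection found by the
program need not be those of the abstract proof, but `Routing.exists_totallyOdd` applies to any
terminal routing with any full selection. -/
lemma comp_solve {G H : Graph ℕ ℕ} {t x Z : ℕ} {S : List ℕ} {Q : ℕ → ℕ → List ℕ}
    {T C : List (List ℕ)} (s : Memory) (ht : 1 ≤ t) (h0 : s.reg 0 = t) (h3 : s.reg 3 = x)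
    (hz : ∀ r, 4 ≤ r → s.reg r = 0) (h19 : ∀ i, s.arr 19 i = 0) (hst : s.Stores 3 4 T)
    (hst' : s.Stores 5 6 C)
    (hT : ∀ p (h : p < (pairList (1400 * t)).length) u v,
      s(u, v) = s(s.arr 2 (pairList (1400 * t))[p].1, s.arr 2 (pairList (1400 * t))[p].2) →
      ∃ h' : p < T.length, IsCopyable H s Z u v T[p] ∧ orient H u v T[p] = Q u v)
    (hSn : S.Nodup) (hSl : S.length = 1400 * t) (hSi : ∀ i (h : i < S.length), s.arr 2 i = S[i])
    (hH : IsApexExtension G {s | s ∈ S} (20 * t) x H) (hSG : ∀ s ∈ S, s ∈ V(G))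
    (hC : IsOddCircuitPacking H x C) (hlen : C.length = 3500 * t ^ 2)
    (hcopy : ∀ c ∈ C, IsCopyable H s Z x x c) (hQ : Linkage G S Q)
    (hQZ : ∀ u ∈ S, ∀ v ∈ S, u ≠ v → (Q u v).length ≤ Z) (hG : E(G).Finite)
    (hZ : E(G).ncard ≤ Z) :
    Comp solve s (solveCost t Z) fun s' =>
      ∃ ψ : Immersion (completeK t) G, ψ.TotallyOdd ∧ IsOutput s' ψ := by
  classical
  refine Comp.seq (comp_prepare s ht h0 h3 hz h19 hst hst' hT ?_ ?_ hH hSG hC hlen hcopy)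
    fun s₁ ⟨a0, a4, a6, a10, a9, a7, aarr, hT₁, hr₁⟩ => ?_
  · intro u
    rw [List.mem_iff_getElem, hSl.symm]
    exact ⟨fun ⟨i, hi, h⟩ => ⟨i, hi, (hSi i hi).trans h⟩,
      fun ⟨i, hi, h⟩ => ⟨i, hi, (hSi i hi).symm.trans h⟩⟩
  · intro i hi j hj hij
    rw [← hSl] at hi hj
    rw [hSi i hi, hSi j hj] at hij
    exact hSn.getElem_inj_iff.1 hij
  rw [a10] at a9
  set m := 3500 * t ^ 2 with hm
  -- The cores have at most |E(G)| positions, which bounds the number of sweeps by means of Z.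
  refine Comp.seq (Comp.mono (comp_rerouteAll hH.le hQ hT₁ (by rw [a9, a10]) hQZ
    ((hr₁.valid.size_le_ncard hG).trans hZ) hr₁) ?_ fun _ h => h) fun s₂ ⟨hr₂, hterm⟩ => ?_
  · rw [a10]
    gcongr
  have hvalid := hr₂.valid
  rw [a10, a6] at hterm hvalid
  set r := s₂.routing with hr
  have b : ∀ k < 20, s₂.reg k = s₁.reg k := hr₂.reg
  have b9 : s₂.reg 9 = 2 * m := (b 9 (by norm_num)).trans a9
  have b6 : s₂.reg 6 = 20 * t := (b 6 (by norm_num)).trans a6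
  refine Comp.seq (Comp.mono (comp_selectVertices s₂ (S := S)
    (by rw [hSl, b 4 (by norm_num), a4]) fun i hi => ?_) ?_ fun _ h => h) fun s₃ ⟨c1, c2, c3⟩ => ?_
  · rw [hr₂.arr 2 (by norm_num), aarr 2 (by norm_num), hSi i hi]
  · rw [b 4 (by norm_num), a4, b9]
  have hmark : IsMarked r m [] s₃ := by
    have : IsMarked r m [] s₂ := ⟨by simpa using b9, fun _ _ => ⟨rfl, rfl⟩, by simp⟩
    exact this.of_eq (c1 9 (by norm_num) (by norm_num) (by norm_num)) (c2 17 (by norm_num))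
      (c2 18 (by norm_num))
  have d0 : s₃.reg 0 = t := by
    rw [c1 0 (by norm_num) (by norm_num) (by norm_num), b 0 (by norm_num), a0]
  refine Comp.seq (Comp.mono (comp_markVertices s₃ hmark) (by rw [d0]) fun _ h => h)
    fun s₄ ⟨e1, e2, e3⟩ => ?_
  have e10 : s₄.reg 10 = m := by
    rw [e1 10 (by norm_num) (by norm_num) (by norm_num) (by norm_num),
      c1 10 (by norm_num) (by norm_num) (by norm_num), b 10 (by norm_num), a10]
  refine Comp.seq (Comp.mono (comp_clearUsed s₄) (by rw [e10]) fun _ h => h)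
    fun s₅ ⟨f1, f2, f3⟩ => ?_
  have greg : ∀ k < 11, k ≠ 9 → s₅.reg k = s₁.reg k := fun k hk h9 => by
    rw [f1 k (by omega), e1 k (by omega) h9 (by omega) (by omega), c1 k (by omega) (by omega)
      (by omega), b k (by omega)]
  have garr : ∀ a, a ≠ 7 → a ≠ 17 → a ≠ 18 → a ≠ 21 → s₅.arr a = s₂.arr a := fun a h1 h2 h3 h4 => by
    rw [f2 a h4, e2 a h2 h3, c2 a h1]
  have g10 : s₅.arr 10 = s₁.arr 10 := by
    rw [garr 10 (by norm_num) (by norm_num) (by norm_num) (by norm_num), hr₂.arr 10 (by norm_num)]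
  have g7 : s₅.arr 7 = s₃.arr 7 := by
    rw [f2 7 (by norm_num), e2 7 (by norm_num) (by norm_num)]
  rw [b9, b6] at c3
  have hF := Routing.le_length_filter_incidences (t := t) (S := S) r.root r.other (N := 2 * m)
    hSn hSl (by rw [hm]; ring)
  have hBF : ∀ i (hi : i < t), s₅.arr 7 i =
      (S.filter fun v => incidences r.root r.other (2 * m) v < 20 * t)[i]'(hi.trans_le hF) :=
    fun i hi => by rw [g7]; exact c3 i (hi.trans_le hF)
  have hB : ∀ i < t, s₅.arr 7 i ∈ S ∧ incidences r.root r.other (2 * m) (s₅.arr 7 i) < 20 * t := by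
    intro i hi
    have := List.getElem_mem (hi.trans_le hF)
    rwa [← hBF i hi, List.mem_filter, decide_eq_true_eq] at this
  have hBinj : ∀ i < t, ∀ j < t, s₅.arr 7 i = s₅.arr 7 j → i = j := by
    intro i hi j hj hij
    rw [hBF i hi, hBF j hj] at hij
    exact (hSn.filter _).getElem_inj_iff.1 hij
  rw [d0] at e3
  rw [← g10] at hterm hvalid
  refine Comp.mono (comp_emitAll (s := s₅) (Z := Z) (hT₁.of_eq (greg 7 (by norm_num) (by norm_num))
    fun a h1 h2 => ?_) hvalid hm ((greg 0 (by norm_num) (by norm_num)).trans a0)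
    ((greg 10 (by norm_num) (by norm_num)).trans a10)
    (garr 19 (by norm_num) (by norm_num) (by norm_num) (by norm_num))
    (garr 20 (by norm_num) (by norm_num) (by norm_num) (by norm_num)) hQZ
    ((hvalid.size_le_ncard hG).trans hZ) (fun i hi => (hB i hi).1) hBinj
    (fun i hi => (hB i hi).2.le) ?_ (by rw [← e10]; exact f3)) ?_ fun s₆ ⟨sel, hsel, hem⟩ => ?_
  · rw [garr a (by omega) (by omega) (by omega) (by omega), hr₂.arr a (by omega)]
  · rw [f2 7 (by norm_num), e2 7 (by norm_num) (by norm_num)]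
    exact e3.of_eq (f1 9 (by norm_num)) (f2 17 (by norm_num)) (f2 18 (by norm_num))
  · rw [greg 7 (by norm_num) (by norm_num)]
    gcongr
  · obtain ⟨ψ, h1, h2, h3⟩ := Routing.exists_totallyOdd hQ hvalid hterm hSG (fun i hi => (hB i hi).1)
      hBinj (fun i hi => (hB i hi).2) hem.selection hsel
    exact ⟨ψ, h1, isOutput_of_isEmitted hem h2 h3⟩

/-- For fixed t the cost is a polynomial in Z of degree two with nonnegative coefficients. For Z at
least 1 every monomial is at most Z² times its value at 1. -/
lemma solveCost_le (t Z : ℕ) (hZ : 1 ≤ Z) : solveCost t Z ≤ solveCost t 1 * Z ^ 2 := by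
  have h1 : ∀ a, a ≤ a * Z := fun a => Nat.le_mul_of_pos_right _ hZ
  have h2 : ∀ a, a ≤ a * Z ^ 2 := fun a => Nat.le_mul_of_pos_right _ (by positivity)
  have h3 : Z + 2 ≤ 3 * Z := by omega
  have h4 : Z ≤ Z ^ 2 := Nat.le_self_pow two_ne_zero Z
  unfold solveCost
  have h5 : ∀ {a b a' b'}, a ≤ a' * Z ^ 2 → b ≤ b' * Z ^ 2 → a + b ≤ (a' + b') * Z ^ 2 :=
    fun h h' => (add_le_add h h').trans_eq (Nat.add_mul _ _ _).symm
  have h6 : ∀ R a b, (Z + 2) * (R * (a + Z * b + 306) + 20) ≤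
      (1 + 2) * (R * (a + 1 * b + 306) + 20) * Z ^ 2 := fun R a b =>
    calc (Z + 2) * (R * (a + Z * b + 306) + 20)
        ≤ (3 * Z) * (R * (a * Z + Z * b + 306 * Z) + 20 * Z) := by
          gcongr
          all_goals exact h1 _
      _ = _ := by ring
  have h7 : ∀ y d, t * (t * (y + (d + Z * 400) + 606) + 20) + 30 ≤
      (t * (t * (y + (d + 1 * 400) + 606) + 20) + 30) * Z ^ 2 := fun y d =>
    calc t * (t * (y + (d + Z * 400) + 606) + 20) + 30
        ≤ t * (t * (y * Z ^ 2 + (d * Z ^ 2 + Z ^ 2 * 400) + 606 * Z ^ 2) + 20 * Z ^ 2) +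
          30 * Z ^ 2 := by
          gcongr
          all_goals exact h2 _
      _ = _ := by ring
  refine h5 ?_ (h5 (h6 _ _ _) (h5 (h2 _) (h5 (h2 _) (h5 (h2 _) (h7 _ _)))))
  calc t ^ 2 * (Z + 2) * 600000000 ≤ t ^ 2 * (3 * Z ^ 2) * 600000000 := by
        gcongr; omega
    _ = _ := by ring

end Solve

/-! ### From the input format to the running time in terms of |E(G)| -/

section Input

lemma Memory.stores_of_holds {s : Memory} {a b : ℕ} {L : List (List ℕ)} (ha : s.Holds a L.flatten)
    (hb : s.Holds b (offsets L)) : s.Stores a b L := by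
  have hoff : ∀ p ≤ L.length, s.arr b p = (L.take p).flatten.length := by
    intro p hp
    rw [hb p (by simp [offsets]; omega)]
    simp [offsets]
  intro p hp
  have htake : (L.take (p + 1)).flatten = (L.take p).flatten ++ L[p] := by
    rw [List.take_succ_eq_append_getElem hp, List.flatten_append, List.flatten_singleton]
  have hsplit : L.flatten = (L.take p).flatten ++ (L[p] ++ (L.drop (p + 1)).flatten) := by
    conv_lhs => rw [← List.take_append_drop (p + 1) L, List.flatten_append, htake,
      List.append_assoc]
  rw [hoff p hp.le, hoff (p + 1) hp, htake]
  refine ⟨List.length_append, fun i hi => ?_⟩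
  have hlt : (L.take p).flatten.length + i < L.flatten.length := by
    rw [hsplit, List.length_append, List.length_append]; omega
  rw [ha _ hlt, List.getElem_of_eq hsplit, List.getElem_append_right (by omega)]
  simp only [Nat.add_sub_cancel_left]
  rw [List.getElem_append_left hi]

lemma Memory.holds_ofLists {regs : List ℕ} {arrs : List (List ℕ)} {a : ℕ} {l : List ℕ}
    (h : arrs.getD a [] = l) : (Memory.ofLists regs arrs).Holds a l := by
  intro i hi
  subst h
  exact List.getD_eq_getElem _ _ hi

lemma length_le_ncard {β : Type v} {A : Set β} (hA : A.Finite) {l : List β} (hl : l.Nodup)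
    (h : ∀ e ∈ l, e ∈ A) : l.length ≤ A.ncard := by
  classical
  rw [← List.toFinset_card_of_nodup hl, ← Set.ncard_coe_finset]
  exact Set.ncard_le_ncard (by simpa [Set.subset_def] using h) hA

/-- All edges except the first and the last one are internal, avoid x and therefore belong to G. -/
lemma IsCircuitAt.length_le {α : Type u} {β : Type v} {G H : Graph α β} {S : Set α} {q : ℕ} {x : α}
    (h : IsApexExtension G S q x H) (hG : E(G).Finite) {c : List β} (hc : IsCircuitAt H x c) :
    c.length ≤ E(G).ncard + 2 := by
  obtain ⟨⟨a, hne, hnd, hw⟩, -, hint⟩ := hc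
  have hsub : c.tail.dropLast.Sublist c := (List.dropLast_sublist _).trans (List.tail_sublist _)
  have := length_le_ncard hG (hnd.sublist hsub) fun e he => by
    by_contra heG
    obtain ⟨s, -, hs⟩ := h.new_edge e (hw.edge_mem (hsub.subset he)) heG
    exact hint e he hs.inc_left
  simp only [List.length_dropLast, List.length_tail] at this
  omega

/-- The program decides orientation by walking in H, the linkage by walking in G. The decisions
agree because all edges of a branch trail lie in G. -/
lemma Immersion.isCopyable_orient {G H : Graph ℕ ℕ} {n Z : ℕ} {s : Memory}
    (φ : Immersion (completeK n) G) (hGH : G ≤ H) (hG : E(G).Finite) (hZ : E(G).ncard ≤ Z)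
    (hlink : ∀ e ∈ E(H), H.IsLink e (s.arr 0 e) (s.arr 1 e)) {i j : Fin n} (hij : i ≠ j) :
    IsCopyable H s Z (φ.vertexMap i) (φ.vertexMap j) (φ.edgeMap s(i, j)) ∧
      orient H (φ.vertexMap i) (φ.vertexMap j) (φ.edgeMap s(i, j)) =
        φ.orientedTrail (φ.vertexMap i) (φ.vertexMap j) := by
  have hmem : φ.vertexMap i ∈ V(G) := φ.mapsTo (by simp [completeK])
  have hedge : ∀ e ∈ φ.edgeMap s(i, j), e ∈ E(G) := fun e he => by
    rcases φ.isTrail_or hij with h | h <;> exact h.2.2.edge_mem he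
  refine ⟨⟨hGH.vertexSet_mono hmem, fun e he => hlink e (hGH.edgeSet_mono (hedge e he)), ?_,
    (length_le_ncard hG ?_ hedge).trans hZ⟩, ?_⟩
  · rcases φ.isTrail_or hij with h | h
    · exact Or.inl (h.2.2.mono hGH)
    · exact Or.inr (h.2.2.mono hGH).reverse
  · rcases φ.isTrail_or hij with h | h <;> exact h.2.1
  · rw [orientedTrail_vertexMap, orient]
    have : IsWalk H (φ.vertexMap i) (φ.edgeMap s(i, j)) (φ.vertexMap j) ↔
        IsWalk G (φ.vertexMap i) (φ.edgeMap s(i, j)) (φ.vertexMap j) :=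
      ⟨IsWalk.of_le hGH hmem hedge, IsWalk.mono hGH⟩
    by_cases h : IsWalk G (φ.vertexMap i) (φ.edgeMap s(i, j)) (φ.vertexMap j)
    · rw [if_pos (this.2 h), if_pos h]
    · rw [if_neg (mt this.1 h), if_neg h]

lemma IsEdgeList.isLink_inputMemory {G H : Graph ℕ ℕ} {k t N x : ℕ} {ends : List (ℕ × ℕ)}
    (h : IsEdgeList H N ends) (φ : Immersion (completeK k) G) (C : List (List ℕ)) :
    ∀ e ∈ E(H), H.IsLink e ((inputMemory t N x ends φ C).arr 0 e)
      ((inputMemory t N x ends φ C).arr 1 e) := by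
  intro e he
  rw [h.edgeSet_eq, Set.mem_Iio] at he
  have := h.isLink e he
  simpa [inputMemory, Memory.ofLists, he] using this

/-- The length bound is Z = |E(G)| + 2, which covers both branch trails and circuits. As |E(G)| is
positive, Z is at most 3|E(G)|, which accounts for the factor 9. -/
theorem exists_runs_solve {t N x : ℕ} {G H : Graph ℕ ℕ} {ends : List (ℕ × ℕ)}
    {C : List (List ℕ)} (φ : Immersion (completeK (1400 * t)) G) (ht : 49 ≤ t)
    (hφ : φ.TotallyEven) (hH : IsApexExtension G φ.branchVertices (20 * t) x H)
    (hC : IsOddCircuitPacking H x C) (hlen : C.length = 3500 * t ^ 2)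
    (hends : IsEdgeList H N ends) :
    ∃ (s : Memory) (n : ℕ) (ψ : Immersion (completeK t) G),
      Runs solve (inputMemory t N x ends φ C) s n ∧
      n ≤ solveCost t 1 * 9 * E(G).ncard ^ 2 ∧ ψ.TotallyOdd ∧ IsOutput s ψ := by
  have hG : E(G).Finite := (hends.edgeSet_eq ▸ Set.finite_Iio ends.length).subset
    hH.le.edgeSet_mono
  have hlink := hends.isLink_inputMemory (t := t) (x := x) φ C
  have hQ := φ.linkage hφ
  have hbranch : ∀ i (hi : i < 1400 * t),
      (inputMemory t N x ends φ C).arr 2 i = φ.vertexMap ⟨i, hi⟩ := by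
    intro i hi
    simp [inputMemory, Memory.ofLists, Immersion.vertexList, hi]
  -- The given immersion has at least one branch trail, and trails are non-empty.
  have hpos : 0 < E(G).ncard := by
    have h01 : (⟨0, by omega⟩ : Fin (1400 * t)) ≠ ⟨1, by omega⟩ := by simp
    rw [Set.ncard_pos hG]
    rcases φ.isTrail_or h01 with h | h <;>
    · obtain ⟨e, he⟩ := List.exists_mem_of_ne_nil _ h.1
      exact ⟨e, h.2.2.edge_mem he⟩
  have hH' := φ.branchVertices_eq ▸ hH
  have hL := φ.mem_vertexSet_of_mem_branchList
  have key := comp_solve (x := x) (S := φ.branchList) (Q := φ.orientedTrail) (T := φ.trailList)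
    (C := C) (Z := E(G).ncard + 2) (inputMemory t N x ends φ C) (by omega : 1 ≤ t) rfl rfl ?_ ?_
    (Memory.stores_of_holds (Memory.holds_ofLists rfl) (Memory.holds_ofLists rfl))
    (Memory.stores_of_holds (Memory.holds_ofLists rfl) (Memory.holds_ofLists rfl)) ?_
    φ.nodup_branchList (by simp [Immersion.branchList]) ?_ hH' hL hC hlen ?_ hQ ?_ hG (by omega)
  · obtain ⟨s, n, h1, h2, ψ, h3, h4⟩ := key
    refine ⟨s, n, ψ, h1, h2.trans ?_, h3, h4⟩
    calc solveCost t (E(G).ncard + 2) ≤ solveCost t 1 * (E(G).ncard + 2) ^ 2 :=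
          solveCost_le _ _ (by omega)
      _ ≤ solveCost t 1 * (3 * E(G).ncard) ^ 2 := by gcongr; omega
      _ = _ := by ring
  · intro r hr
    exact List.getD_eq_default _ _ (by simpa using hr)
  · intro i
    simp [inputMemory, Memory.ofLists]
  · intro p hp u v huv
    have h1 := mem_pairList.1 (List.getElem_mem hp)
    have hp' : p < (pairs (1400 * t)).length := by rwa [length_pairs]
    rw [hbranch _ (h1.1.trans h1.2), hbranch _ h1.2] at huv
    refine ⟨by simpa [Immersion.trailList] using hp', ?_⟩
    have hij : (⟨_, h1.1.trans h1.2⟩ : Fin (1400 * t)) ≠ ⟨_, h1.2⟩ := by simpa using h1.1.ne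
    simp only [Immersion.trailList, List.getElem_map]
    rw [pairs_getElem (i := ⟨_, h1.1.trans h1.2⟩) (j := ⟨_, h1.2⟩) hp' hp rfl rfl]
    rcases Sym2.eq_iff.1 huv with ⟨rfl, rfl⟩ | ⟨rfl, rfl⟩
    · exact φ.isCopyable_orient hH.le hG (by omega) hlink hij
    · rw [Sym2.eq_swap]
      exact φ.isCopyable_orient hH.le hG (by omega) hlink hij.symm
  · intro i hi
    rw [hbranch i (by simpa [Immersion.branchList] using hi)]
    simp [Immersion.branchList]
  · intro c hc
    obtain ⟨h1, h2⟩ := hC.1 c hc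
    have hw := h1.isWalk hH' hL h2
    exact ⟨hw.2.2.1.left_mem, fun e he => hlink e (hw.2.2.1.edge_mem he), Or.inl hw.2.2.1,
      h1.length_le hH hG⟩
  · intro u hu v hv huv
    have h := hQ.isTrail u hu v hv huv
    exact (length_le_ncard hG h.2.1 fun e he => h.2.2.edge_mem he).trans (by omega)

end Input

end OddImmersion

theorem mainTheorem4 :
    -- existence
    (∀ (α : Type u) (β : Type v) (t : ℕ) (G H : Graph α β) (x : α)
        (φ : OddImmersion.Immersion (OddImmersion.completeK (1400 * t)) G) (C : List (List β)),
      49 ≤ t →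
      φ.TotallyEven →
      OddImmersion.IsApexExtension G φ.branchVertices (20 * t) x H →
      OddImmersion.IsOddCircuitPacking H x C →
      C.length = 3500 * t ^ 2 →
      ∃ ψ : OddImmersion.Immersion (OddImmersion.completeK t) G, ψ.TotallyOdd) ∧
    -- algorithm: a single program for all `t`, with running time at most `f t * |E(G)| ^ 2`
    (∃ (P : OddImmersion.Program) (f : ℕ → ℕ),
      ∀ (t N x : ℕ) (G H : Graph ℕ ℕ) (ends : List (ℕ × ℕ))
        (φ : OddImmersion.Immersion (OddImmersion.completeK (1400 * t)) G) (C : List (List ℕ)),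
      49 ≤ t →
      φ.TotallyEven →
      OddImmersion.IsApexExtension G φ.branchVertices (20 * t) x H →
      OddImmersion.IsOddCircuitPacking H x C →
      C.length = 3500 * t ^ 2 →
      OddImmersion.IsEdgeList H N ends →
      ∃ (s : OddImmersion.Memory) (n : ℕ)
        (ψ : OddImmersion.Immersion (OddImmersion.completeK t) G),
        OddImmersion.Runs P (OddImmersion.inputMemory t N x ends φ C) s n ∧
        n ≤ f t * G.edgeSet.ncard ^ 2 ∧
        ψ.TotallyOdd ∧ OddImmersion.IsOutput s ψ) := by
  refine ⟨fun α β t G H x φ C ht hφ hH hC hlen =>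
    OddImmersion.exists_totallyOdd_immersion φ ht hφ hH hC hlen,
    OddImmersion.solve, fun t => OddImmersion.solveCost t 1 * 9,
    fun t N x G H ends φ C ht hφ hH hC hlen hends =>
    OddImmersion.exists_runs_solve φ ht hφ hH hC hlen hends⟩
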